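/- **Setting.** Let $d\ge 2$ and let $\Omega\subset\mathbb R^d$ be a bounded domain whose boundary is a disjoint union $\partial\Omega=\Gamma_D\,\dot\cup\,\Gamma_N\,\dot\cup\,\Gamma_{\rm d}$ with $\Gamma_D$ closed, and let $\Sigma\subset\Omega$; any of $\Gamma_D,\Gamma_N,\Gamma_{\rm d},\Sigma$ may be empty. A set $\mathcal S\subset\mathbb R^d$ is a *Lipschitz hypersurface in graph representation* if every $x\in\mathcal S$ has an open neighbourhood $V$ and coordinates $g:U\to\mathcal S\cap V$, bijective, with $U\subset\mathbb R^{d-1}$ open and $g(y)=Q(y,h(y))+x^*$, where $Q$ is orthogonal, $x^*\in\mathbb R^d$ and $h:U\to\mathbb R$ is Lipschitz. It is a *$(d-1)$-dimensional Lipschitz submanifold* if every $x\in\mathcal S$ has an open neighbourhood $V$ in $\mathbb R^d$ and a bi-Lipschitz map $\varphi:V\to\mathbb R^d$ with $\varphi(\mathcal S\cap V)={]0,1[}^{d-1}\times\{0\}$. Assume that $\Gamma_{\rm d}$ and $\Sigma$ are Lipschitz hypersurfaces in graph representation, that $\Gamma_N$ is a $(d-1)$-dimensional Lipschitz submanifold,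 and that each of $\overline{\Gamma_N}$, $\overline{\Gamma_{\rm d}}$, $\overline{\Sigma}$ is contained in a $(d-1)$-dimensional Lipschitz submanifold. For $\mathcal S\in\{\Gamma_{\rm d},\Sigma\}$, a point $x\in\mathcal S$ is *regular* if some coordinates $g$ as above are differentiable at $y=g^{-1}(x)$; $\mathcal H_{d-1}$-almost every point is regular. At such a point the tangent space is $T_x\mathcal S=g'(y)\mathbb R^{d-1}$, and, with $(g^{ij})$ the inverse of the matrix $\big((\partial_i g,\partial_j g)\big)_{ij}$, the surface gradient is $$\nabla_{\mathcal S}u(x)=\sum_{i,j=1}^{d-1}g^{ij}(y)\,\partial_j(u\circ g)(y)\,\partial_i g(y).$$ Both are independent of the choice of $g$. The coefficient $\mu_\Omega:\Omega\to\mathbb R^{d\times d}$ is measurable, bounded and uniformly elliptic: $(\mu_\Omega(x)\xi,\xi)\ge c|\xi|^2$ for some $c>0$ and all $x\in\Omega$, $\xi\in\mathbb R^d$. For $\mathcal S\in\{\Gamma_{\rm d},\Sigma\}$, the coefficient $\mu_{\mathcal S}:\mathcal S\to\mathbb R^{d\times d}$ is measurable and there are a measurable, bounded function $\mu_{\mathcal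 S}^*:\mathcal S\to[0,\infty)$ and constants $c_1,c_2>0$ with $(\mu_{\mathcal S}(x)\xi,\xi)\ge c_1\mu^*_{\mathcal S}(x)|\xi|^2$ for all regular $x\in\mathcal S$ and $\xi\in T_x\mathcal S$, and $\|\mu_{\mathcal S}(x)\|\le c_2\mu^*_{\mathcal S}(x)$ for all $x\in\mathcal S$. No symmetry is assumed. Let $C_D^\infty(\Omega)=\{u|_\Omega: u\in C_c^\infty(\mathbb R^d;\mathbb C),\ \operatorname{supp}u\cap\Gamma_D=\emptyset\}$ and, for $u,v\in C_D^\infty(\Omega)$, let $$\mathfrak t(u,v)=\int_\Omega(\mu_\Omega\nabla u,\overline{\nabla v})\,dx+\sum_{\mathcal S\in\{\Gamma_{\rm d},\Sigma\}}\int_{\mathcal S}(\mu_{\mathcal S}\nabla_{\mathcal S}u,\overline{\nabla_{\mathcal S}v})\,d\mathcal H_{d-1},$$ $$\|u\|_{\operatorname{dom}(\mathfrak t)}^2=\|u\|_{W^{1,2}(\Omega)}^2+\sum_{\mathcal S\in\{\Gamma_{\rm d},\Sigma\}}\int_{\mathcal S}|\nabla_{\mathcal S}u|^2\mu^*_{\mathcal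 S}\,d\mathcal H_{d-1}.$$ Here $(a,b)=\sum_i a_ib_i$, and $\mathcal H_{d-1}$ is the Hausdorff measure normalized so as to agree with Lebesgue measure on hyperplanes. Let $\operatorname{dom}(\mathfrak t)$ be the completion of $C_D^\infty(\Omega)$ in $\|\cdot\|_{\operatorname{dom}(\mathfrak t)}$, to which $\mathfrak t$ extends continuously. Let $\mathbb L^2=L^2\big((\Omega\setminus\Sigma)\cup\Gamma_{\rm d}\cup\Sigma,\ dx+\mathcal H_{d-1}\big)$ (complex-valued), where $dx$ is used on $\Omega\setminus\Sigma$ and $\mathcal H_{d-1}$ on $\Gamma_{\rm d}\cup\Sigma$; let $\mathbb L^\infty$ be the corresponding $L^\infty$-space. Let $\mathfrak J$ be the closure of the map $u\mapsto(u|_{\Omega\setminus\Sigma},u|_{\Gamma_{\rm d}},u|_\Sigma)$ from $C_D^\infty(\Omega)\subset\operatorname{dom}(\mathfrak t)$ to $\mathbb L^2$, that is, $\mathfrak Ju=\varphi$ if there are $u_k\in C_D^\infty(\Omega)$ with $u_k\to u$ in $\operatorname{dom}(\mathfrak t)$ and $\mathfrak Ju_k\to\varphi$ in $\mathbb L^2$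 (this is the continuous extension whenever the traces are continuous). Let $A_2$ be the operator in $\mathbb L^2$ for which $\varphi\in\operatorname{dom}(A_2)$ and $A_2\varphi=\psi$ if and only if there is $u\in\operatorname{dom}(\mathfrak t)$ with $\mathfrak Ju=\varphi$ and $\mathfrak t(u,v)=(\psi,\mathfrak Jv)_{\mathbb L^2}$ for all $v\in \operatorname{dom}(\mathfrak t)$ in the domain of $\mathfrak J$. **Proposition.** There is exactly one $C_0$-semigroup $T_2(\cdot)=(T_2(t))_{t\ge0}$ of bounded operators on $\mathbb L^2$ whose generator is $-A_2$, and for all $t\ge0$: 1. $T_2(t)$ leaves the subspace $\mathbb L^2_{\mathbb R}$ of real-valued elements of $\mathbb L^2$ invariant; 2. $T_2(t)$ is positive: if $f\in\mathbb L^2$ and $f\ge0$ a.e., then $T_2(t)f\ge0$ a.e.; 3. $T_2(t)$ is $\mathbb L^\infty$-contractive: $\|T_2(t)f\|_{\mathbb L^\infty}\le\|f\|_{\mathbb L^\infty}$ for all $f\in\mathbb L^2\cap\mathbb L^\infty$. -/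

import Mathlib

open MeasureTheory Filter Topology
open scoped NNReal ContDiff

noncomputable section

namespace InterfaceDiffusion

/-- `ℝ^m` with the Euclidean norm. The ambient space of the theorem is `ℝ^d` with `d = n + 1`, so
that hypersurfaces have dimension `d - 1 = n`. -/
abbrev RR (m : ℕ) : Type := EuclideanSpace ℝ (Fin m)

/-- The complex vector space `ℂ^m`, in which gradients of complex valued functions live. -/
abbrev CC (m : ℕ) : Type := EuclideanSpace ℂ (Fin m)

/-! ### Lipschitz hypersurfaces and the surface gradient -/

/-- The map `y ↦ Q (y, h y) + x₀`. -/
def graphMap {n : ℕ} (Q : RR (n + 1) ≃ₗᵢ[ℝ] RR (n + 1)) (x₀ : RR (n + 1)) (h : RR n → ℝ)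
    (y : RR n) : RR (n + 1) :=
  Q (WithLp.toLp 2 (Fin.snoc (α := fun _ => ℝ) (fun i => y i) (h y))) + x₀

/-- Lipschitz-graph coordinates `(g, U)` of `S`: `U ⊆ ℝ^(d-1)` is open, `g y = Q (y, h y) + x₀` with
`Q` orthogonal and `h` Lipschitz on `U`, and `g` maps `U` bijectively onto `S ∩ V` with `V` open. -/
structure GraphCoords {n : ℕ} (S : Set (RR (n + 1))) where
  U : Set (RR n)
  V : Set (RR (n + 1))
  Q : RR (n + 1) ≃ₗᵢ[ℝ] RR (n + 1)
  x₀ : RR (n + 1)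
  h : RR n → ℝ
  isOpen_U : IsOpen U
  isOpen_V : IsOpen V
  lipschitz : ∃ K : ℝ≥0, LipschitzOnWith K h U
  bijOn : Set.BijOn (graphMap Q x₀ h) U (S ∩ V)

/-- The coordinate map `g`. -/
def GraphCoords.g {n : ℕ} {S : Set (RR (n + 1))} (c : GraphCoords S) : RR n → RR (n + 1) :=
  graphMap c.Q c.x₀ c.h

/-- `S` is a Lipschitz hypersurface in graph representation. -/
def IsLipschitzGraphHypersurface {n : ℕ} (S : Set (RR (n + 1))) : Prop :=
  ∀ x ∈ S, ∃ c : GraphCoords S, x ∈ c.V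

/-- `S` is a `(d-1)`-dimensional Lipschitz submanifold of `ℝ^d`: near each of its points a
bi-Lipschitz map `φ` flattens `S` to `]0,1[^(d-1) × {0}`. -/
def IsLipschitzSubmanifold {n : ℕ} (S : Set (RR (n + 1))) : Prop :=
  ∀ x ∈ S, ∃ (V : Set (RR (n + 1))) (φ : RR (n + 1) → RR (n + 1)),
    IsOpen V ∧ x ∈ V ∧
    (∃ K : ℝ≥0, LipschitzOnWith K φ V) ∧
    (∃ K : ℝ≥0, AntilipschitzWith K (fun z : V => φ z)) ∧
    φ '' (S ∩ V) = {z | (∀ i : Fin n, z i.castSucc ∈ Set.Ioo (0 : ℝ) 1) ∧ z (Fin.last n) = 0}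

/-- `y` is the coordinate of `x` in the chart `c`, and `c` is regular for `x`, that is, `g` is
differentiable at `y = g⁻¹(x)`. -/
def GraphCoords.IsRegularAt {n : ℕ} {S : Set (RR (n + 1))} (c : GraphCoords S) (y : RR n)
    (x : RR (n + 1)) : Prop :=
  y ∈ c.U ∧ c.g y = x ∧ DifferentiableAt ℝ c.g y

/-- The tangent space `T_x S` at a regular point, the image of `g'(g⁻¹(x))`. It does not depend on
the regular coordinates. (At points that are not regular the set below is empty.) -/
def tangentSpace {n : ℕ} (S : Set (RR (n + 1))) (x : RR (n + 1)) : Set (RR (n + 1)) :=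
  {v | ∃ (c : GraphCoords S) (y : RR n), c.IsRegularAt y x ∧ ∃ ξ : RR n, v = fderiv ℝ c.g y ξ}

/-- The gradient `(∂₁u, …, ∂ₘu)` of a complex valued function of `m` real variables. -/
def grad {m : ℕ} (u : RR m → ℂ) (x : RR m) : CC m :=
  WithLp.toLp 2 fun i => fderiv ℝ u x (EuclideanSpace.single i 1)

/-- The partial derivative `∂ₖ g (y)` of the coordinate map. -/
def GraphCoords.partialDeriv {n : ℕ} {S : Set (RR (n + 1))} (c : GraphCoords S) (y : RR n)
    (k : Fin n) : RR (n + 1) :=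
  fderiv ℝ c.g y (EuclideanSpace.single k 1)

/-- The metric tensor `G(y) = ((∂ₖ g(y), ∂ₗ g(y)))ₖₗ`. -/
def GraphCoords.metric {n : ℕ} {S : Set (RR (n + 1))} (c : GraphCoords S) (y : RR n) :
    Matrix (Fin n) (Fin n) ℝ :=
  Matrix.of fun k l => inner ℝ (c.partialDeriv y k) (c.partialDeriv y l)

/-- The vector `∑ₖₗ gᵏˡ(y) ∂ₗ(u ∘ g)(y) ∂ₖ g(y)`. -/
def GraphCoords.gradient {n : ℕ} {S : Set (RR (n + 1))} (c : GraphCoords S)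
    (u : RR (n + 1) → ℂ) (y : RR n) : CC (n + 1) :=
  WithLp.toLp 2 fun i => ∑ k, ∑ l,
    (((c.metric y)⁻¹ k l : ℝ) : ℂ) * grad (u ∘ c.g) y l * ((c.partialDeriv y k i : ℝ) : ℂ)

open Classical in
/-- The surface gradient `∇_S u (x)` at a regular point `x` of `S`, computed in some regular
coordinates (the value does not depend on which); it is `0` at the points that are not regular,
which form a null set. It is only used for smooth `u`, for which `u ∘ g` is locally Lipschitz, so
that its weak and its classical gradient agree almost everywhere. -/
def surfaceGrad {n : ℕ} (S : Set (RR (n + 1))) (u : RR (n + 1) → ℂ) (x : RR (n + 1)) :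
    CC (n + 1) :=
  if hx : ∃ p : GraphCoords S × RR n, p.1.IsRegularAt p.2 x then
    hx.choose.1.gradient u hx.choose.2
  else 0

/-! ### Geometry, coefficients, and the space `𝕃²` -/

/-- The geometric assumptions in `ℝ^d`, `d = n + 1`. -/
structure Geometry (n : ℕ) where
  Ω : Set (RR (n + 1))
  /-- the Dirichlet part of the boundary -/
  ΓD : Set (RR (n + 1))
  /-- the Neumann part of the boundary -/
  ΓN : Set (RR (n + 1))
  /-- the dynamic part of the boundary -/
  Γd : Set (RR (n + 1))
  /-- the interface -/
  Sg : Set (RR (n + 1))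
  isOpen_Ω : IsOpen Ω
  isConnected_Ω : IsConnected Ω
  isBounded_Ω : Bornology.IsBounded Ω
  frontier_eq : frontier Ω = ΓD ∪ ΓN ∪ Γd
  disjoint_DN : Disjoint ΓD ΓN
  disjoint_Dd : Disjoint ΓD Γd
  disjoint_Nd : Disjoint ΓN Γd
  isClosed_ΓD : IsClosed ΓD
  Sg_subset : Sg ⊆ Ω
  graph_Γd : IsLipschitzGraphHypersurface Γd
  graph_Sg : IsLipschitzGraphHypersurface Sg
  submanifold_ΓN : IsLipschitzSubmanifold ΓN
  closure_ΓN : ∃ M, IsLipschitzSubmanifold M ∧ closure ΓN ⊆ M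
  closure_Γd : ∃ M, IsLipschitzSubmanifold M ∧ closure Γd ⊆ M
  closure_Sg : ∃ M, IsLipschitzSubmanifold M ∧ closure Sg ⊆ M

/-- The assumption on the diffusion coefficient `μ` on the surface `S`, with the weight `w = μ*`
that describes its degeneracy. -/
structure IsSurfaceDiffusion {n : ℕ} (S : Set (RR (n + 1)))
    (μ : RR (n + 1) → RR (n + 1) →L[ℝ] RR (n + 1)) (w : RR (n + 1) → ℝ) : Prop where
  measurable : Measurable fun x : S => μ x
  measurable_weight : Measurable fun x : S => w x
  bounded_weight : ∃ C : ℝ, ∀ x ∈ S, w x ≤ C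
  weight_nonneg : ∀ x ∈ S, 0 ≤ w x
  lower : ∃ c₁ : ℝ, 0 < c₁ ∧ ∀ x ∈ S, ∀ ξ ∈ tangentSpace S x,
    c₁ * w x * ‖ξ‖ ^ 2 ≤ inner ℝ (μ x ξ) ξ
  upper : ∃ c₂ : ℝ, 0 < c₂ ∧ ∀ x ∈ S, ‖μ x‖ ≤ c₂ * w x

/-- The diffusion coefficients `μ_Ω`, `μ_Γd`, `μ_Σ` (only their values on `Ω`, `Γd`, `Σ` matter), and
the weights `μ*_Γd`, `μ*_Σ`. -/
structure Coefficients {n : ℕ} (G : Geometry n) where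
  μΩ : RR (n + 1) → RR (n + 1) →L[ℝ] RR (n + 1)
  μΓ : RR (n + 1) → RR (n + 1) →L[ℝ] RR (n + 1)
  wΓ : RR (n + 1) → ℝ
  μSg : RR (n + 1) → RR (n + 1) →L[ℝ] RR (n + 1)
  wSg : RR (n + 1) → ℝ
  measurable_μΩ : Measurable fun x : G.Ω => μΩ x
  bounded_μΩ : ∃ C : ℝ, ∀ x ∈ G.Ω, ‖μΩ x‖ ≤ C
  elliptic_μΩ : ∃ c : ℝ, 0 < c ∧ ∀ x ∈ G.Ω, ∀ ξ : RR (n + 1), c * ‖ξ‖ ^ 2 ≤ inner ℝ (μΩ x ξ) ξ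
  diffusion_Γ : IsSurfaceDiffusion G.Γd μΓ wΓ
  diffusion_Sg : IsSurfaceDiffusion G.Sg μSg wSg

/-- The measure `dx + H_{d-1}` on `(Ω \ Σ) ∪ (Γd ∪ Σ)`: Lebesgue measure on `Ω \ Σ`, and the
`(d-1)`-dimensional Hausdorff measure (normalized to agree with Lebesgue measure on
hyperplanes) on `Γd ∪ Σ`. -/
def Geometry.measure {n : ℕ} (G : Geometry n) : Measure (RR (n + 1)) :=
  volume.restrict (G.Ω \ G.Sg) + (Measure.euclideanHausdorffMeasure n).restrict (G.Γd ∪ G.Sg)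

/-- The complex Hilbert space `𝕃² = L²((Ω \ Σ) ∪ Γd ∪ Σ, dx + H_{d-1})`. -/
abbrev Geometry.L2 {n : ℕ} (G : Geometry n) : Type := Lp ℂ 2 G.measure

/-- The test functions: complex valued `u ∈ C_c^∞(ℝ^d)` with `supp u ∩ Γ_D = ∅`. They stand for
their restrictions to `Ω`, on which everything below depends only, the values of `u` on
`Γd ⊆ ∂Ω` being determined by continuity. -/
def Geometry.testFunctions {n : ℕ} (G : Geometry n) : Set (RR (n + 1) → ℂ) :=
  {u | ContDiff ℝ ∞ u ∧ HasCompactSupport u ∧ Disjoint (tsupport u) G.ΓD}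

/-! ### The form, its domain, and the associated operator -/

/-- `(M z, w̄) = ∑ᵢⱼ Mᵢⱼ zⱼ w̄ᵢ` for a real `m × m` matrix `M` and `z, w ∈ ℂ^m`. -/
def pairing {m : ℕ} (M : RR m →L[ℝ] RR m) (z w : CC m) : ℂ :=
  ∑ i, ∑ j, ((M (EuclideanSpace.single j 1) i : ℝ) : ℂ) * z j * (starRingEnd ℂ) (w i)

/-- The sesquilinear form `𝔱(u, v)` for test functions. -/
def Coefficients.form {n : ℕ} {G : Geometry n} (C : Coefficients G) (u v : RR (n + 1) → ℂ) : ℂ :=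
  (∫ x in G.Ω, pairing (C.μΩ x) (grad u x) (grad v x))
  + (∫ x in G.Γd, pairing (C.μΓ x) (surfaceGrad G.Γd u x) (surfaceGrad G.Γd v x)
      ∂Measure.euclideanHausdorffMeasure n)
  + ∫ x in G.Sg, pairing (C.μSg x) (surfaceGrad G.Sg u x) (surfaceGrad G.Sg v x)
      ∂Measure.euclideanHausdorffMeasure n

/-- The square of the norm of `dom(𝔱)`, for a test function. -/
def Coefficients.domNormSq {n : ℕ} {G : Geometry n} (C : Coefficients G) (u : RR (n + 1) → ℂ) : ℝ :=
  (∫ x in G.Ω, (‖u x‖ ^ 2 + ‖grad u x‖ ^ 2))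
  + (∫ x in G.Γd, ‖surfaceGrad G.Γd u x‖ ^ 2 * C.wΓ x ∂Measure.euclideanHausdorffMeasure n)
  + ∫ x in G.Sg, ‖surfaceGrad G.Sg u x‖ ^ 2 * C.wSg x ∂Measure.euclideanHausdorffMeasure n

/-- The sequence `u` represents an element of `dom(𝔱)`, the completion of the test functions:
it consists of test functions and is Cauchy for the norm of `dom(𝔱)`. -/
def Coefficients.IsDomElement {n : ℕ} {G : Geometry n} (C : Coefficients G)
    (u : ℕ → RR (n + 1) → ℂ) : Prop :=
  (∀ k, u k ∈ G.testFunctions) ∧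
  ∀ ε : ℝ, 0 < ε → ∃ N, ∀ k ≥ N, ∀ l ≥ N, C.domNormSq (u k - u l) < ε

/-- `𝔍 u = φ` for the element `u` of `dom(𝔱)` given by a Cauchy sequence `(uₖ)` of test functions:
`𝔍 uₖ = (uₖ|_{Ω \ Σ}, uₖ|_{Γd}, uₖ|_Σ)` converges to `φ` in `𝕃²`. -/
def Coefficients.HasJ {n : ℕ} {G : Geometry n} (C : Coefficients G)
    (u : ℕ → RR (n + 1) → ℂ) (φ : G.L2) : Prop :=
  C.IsDomElement u ∧ Tendsto (fun k => eLpNorm (fun x => u k x - φ x) 2 G.measure) atTop (𝓝 0)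

/-- The graph of the operator `A₂`: `φ ∈ dom(A₂)` and `A₂ φ = ψ` if and only if there is
`u ∈ dom(𝔱)` with `𝔍 u = φ` and `𝔱(u, v) = (ψ, 𝔍 v)` for all `v ∈ dom(𝔱)`, where
`𝔱(u, v) = lim 𝔱(uₖ, vₖ)`. -/
def Coefficients.A₂ {n : ℕ} {G : Geometry n} (C : Coefficients G) (φ ψ : G.L2) : Prop :=
  ∃ u, C.HasJ u φ ∧ ∀ v χ, C.HasJ v χ →
    Tendsto (fun k => C.form (u k) (v k)) atTop (𝓝 (inner ℂ χ ψ))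

/-! ### Semigroups -/

/-- `T` is a `C₀`-semigroup on the complex normed space `H`. -/
structure IsC0Semigroup {H : Type*} [NormedAddCommGroup H] [NormedSpace ℂ H]
    (T : ℝ≥0 → H →L[ℂ] H) : Prop where
  zero : T 0 = 1
  add : ∀ s t, T (s + t) = T s * T t
  tendsto : ∀ φ, Tendsto (fun t => T t φ) (𝓝 0) (𝓝 φ)

/-- `T` is the `C₀`-semigroup generated by `-A`, where `A` is given by its graph:
`A φ = ψ` if and only if `(φ - T(t) φ) / t → ψ` as `t ↓ 0`. -/
structure IsSemigroupGeneratedByNeg {H : Type*} [NormedAddCommGroup H] [NormedSpace ℂ H]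
    (A : H → H → Prop) (T : ℝ≥0 → H →L[ℂ] H) : Prop extends IsC0Semigroup T where
  generator : ∀ φ ψ, A φ ψ ↔
    Tendsto (fun t : ℝ≥0 => ((t : ℝ)⁻¹ : ℂ) • (φ - T t φ)) (𝓝[≠] 0) (𝓝 ψ)

end InterfaceDiffusion

end

open MeasureTheory Filter Topology
open scoped NNReal ContDiff

noncomputable section

namespace InterfaceDiffusion

/-! ### One-parameter groups generated by bounded operators -/

section BoundedGenerators

variable {H : Type*} [NormedAddCommGroup H] [InnerProductSpace ℂ H] [CompleteSpace H]

open NormedSpace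

/-! The operator is m-accretive, so Lumer–Phillips yields the semigroup. Positivity and
contractivity come from the invariance of half planes under the resolvents.

Generation. On test functions `Re 𝔱(u,u)` is comparable to the gradient part of the norm of
`dom(𝔱)`. Since `Σ` is Lebesgue-null, `‖u‖²` on `Ω` is controlled by `‖𝔍u‖²`, so along sequences for
which `𝔍uₖ` converges, being Cauchy in `dom(𝔱)` means being Cauchy for `Re 𝔱(u,u) + ‖𝔍u‖²`. In that
semi-inner product Lax–Milgram, phrased with Cauchy sequences, solves `φ + εA₂φ = f` for every `ε >
0` (`IsFormAlong.rel_range`). Accretivity is immediate. `A₂` is single valued because `𝔍` has dense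
range, although its extension to the completion need not be injective (`IsFormAlong.rel_single`,
`Geometry.denseRange_trace`). Yosida approximation then builds the semigroup and shows that closed
convex sets invariant under all resolvents are invariant under the semigroup
(`IsMAccretive.exists_semigroup`). Uniqueness follows because the squared distance of two
trajectories has nonpositive right derivative.

Invariance. For a half plane `{z : ⟨e,z⟩ ≤ c}` with `c ≥ 0`, truncation is replaced by the smooth
map `F z = θ(⟨e,z⟩ - c) e`, with `θ` the smooth transition function; `F` vanishes exactly on the
half plane. As `F` is smooth and `F 0 = 0`, `F ∘ u` is again a test function, so no lattice property
of `dom(𝔱)` is needed. Each derivative of `F` has the form `w ↦ ⟨e',w⟩ e'`, so the real part of the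
integrand of `𝔱(u, F ∘ u)` is `(μξ,ξ)` with the real vector `ξ = ⟨e',∇u⟩`. It is nonnegative by
ellipticity, without symmetry of `μ`; on a surface this uses that `ξ` is tangential, the surface
gradient being a projection of the gradient. Hence `Re(F(φ), A₂φ) ≥ 0`. With `A₂φ = ε⁻¹(f - φ)` and
`f` valued in the half plane, the integrand of `Re(F(φ), f - φ)` is nonpositive, and negative
wherever `φ` leaves the half plane; so `φ` stays in it (`Coefficients.resolvent_halfPlane`). The
real line, the half line and discs about `0` are intersections of such half planes. -/

theorem exp_smul_sub_one_mem {K : Set H} (hK : IsClosed K) (hc : Convex ℝ K) (J : H →L[ℂ] H)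
    (hJ : ∀ f ∈ K, J f ∈ K) {s : ℝ} (hs : 0 ≤ s) {f : H} (hf : f ∈ K) :
    exp (s • (J - 1)) f ∈ K := by
  have hcomm : Commute (s • J) (-(s • (1 : H →L[ℂ] H))) := by
    refine ((Commute.one_right _).smul_right s).neg_right
  let : NormedAlgebra ℚ (H →L[ℂ] H) := NormedAlgebra.restrictScalars ℚ ℝ _
  have h1 : exp (-(s • (1 : H →L[ℂ] H))) = Real.exp (-s) • (1 : H →L[ℂ] H) := by
    rw [← neg_smul, ← Algebra.algebraMap_eq_smul_one, ← algebraMap_exp_comm,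
      Algebra.algebraMap_eq_smul_one, Real.exp_eq_exp_ℝ]
  have h2 : exp (s • (J - 1)) = Real.exp (-s) • exp (s • J) := by
    rw [smul_sub, sub_eq_add_neg, exp_add_of_commute hcomm, h1]
    simp
  have hpow : ∀ k : ℕ, (J ^ k) f ∈ K := by
    intro k
    induction k with
    | zero => simpa using hf
    | succ k ih =>
      rw [pow_succ']
      exact hJ _ ih
  have hs1 : HasSum (fun k : ℕ => ((k.factorial : ℝ)⁻¹ * s ^ k)) (Real.exp s) := by
    have := NormedSpace.exp_series_hasSum_exp' (𝕂 := ℝ) s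
    rw [← Real.exp_eq_exp_ℝ] at this
    simpa using this
  have hs2 : HasSum (fun k : ℕ => ((k.factorial : ℝ)⁻¹ * s ^ k) • (J ^ k) f)
      (exp (s • J) f) := by
    have := NormedSpace.exp_series_hasSum_exp' (𝕂 := ℝ) (s • J)
    have := this.mapL ((ContinuousLinearMap.apply ℂ H f).restrictScalars ℝ)
    simpa [smul_pow, smul_smul] using this
  have ht1 := hs1.tendsto_sum_nat
  have ht2 := hs2.tendsto_sum_nat
  have ht3 := (ht1.inv₀ (Real.exp_pos s).ne').smul ht2
  have h3 : exp (s • (J - 1)) f = (Real.exp s)⁻¹ • exp (s • J) f := by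
    rw [h2, Real.exp_neg]; rfl
  rw [h3]
  refine hK.mem_of_tendsto ht3 ?_
  filter_upwards [eventually_gt_atTop 0] with N hN
  have := hc.centerMass_mem (t := Finset.range N) (w := fun k : ℕ => ((k.factorial : ℝ)⁻¹ * s ^ k))
    (z := fun k => (J ^ k) f) (fun k _ => by positivity)
    (Finset.sum_pos' (fun k _ => by positivity) ⟨0, by simpa using hN, by simp⟩)
    (fun k _ => hpow k)
  exact this

theorem norm_exp_smul_sub_one_le (J : H →L[ℂ] H) (hJ : ∀ f, ‖J f‖ ≤ ‖f‖) {s : ℝ} (hs : 0 ≤ s)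
    (f : H) : ‖exp (s • (J - 1)) f‖ ≤ ‖f‖ := by
  have := exp_smul_sub_one_mem (K := Metric.closedBall 0 ‖f‖) Metric.isClosed_closedBall
    (convex_closedBall _ _) J
    (fun g hg => by
      rw [mem_closedBall_zero_iff] at hg ⊢
      exact (hJ g).trans hg) hs (f := f) (by simp)
  simpa using this

theorem hasDerivAt_exp_smul_apply (X : H →L[ℂ] H) (f : H) (t : ℝ) :
    HasDerivAt (fun s : ℝ => exp (s • X) f) (exp (t • X) (X f)) t :=
  ((ContinuousLinearMap.apply ℂ H f).restrictScalars ℝ).hasFDerivAt.comp_hasDerivAt t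
    (hasDerivAt_exp_smul_const X t)

/-- The path `s ↦ exp(sX) exp((t - s)Y) f` joins `exp(tY) f` to `exp(tX) f`. Commutation makes its
derivative `exp(sX) exp((t - s)Y)(Xf - Yf)`, which contractivity bounds by `‖Xf - Yf‖`. -/
theorem norm_exp_smul_sub_exp_smul_le {X Y : H →L[ℂ] H} (hXY : Commute X Y)
    (hX : ∀ t : ℝ, 0 ≤ t → ∀ f, ‖exp (t • X) f‖ ≤ ‖f‖)
    (hY : ∀ t : ℝ, 0 ≤ t → ∀ f, ‖exp (t • Y) f‖ ≤ ‖f‖) {t : ℝ} (ht : 0 ≤ t) (f : H) :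
    ‖exp (t • X) f - exp (t • Y) f‖ ≤ t * ‖X f - Y f‖ := by
  have hd : ∀ s : ℝ, HasDerivAt (fun s : ℝ => exp (s • X) (exp ((t - s) • Y) f))
      (exp (s • X) (exp ((t - s) • Y) (X f - Y f))) s := by
    intro s
    have h1 := hasDerivAt_exp_smul_const X s
    have h2 : HasDerivAt (fun s : ℝ => exp ((t - s) • Y)) (-(exp ((t - s) • Y) * Y)) s := by
      have h3 : HasDerivAt (fun s : ℝ => t - s) (-1) s := by
        simpa using (hasDerivAt_id s).const_sub t
      have := HasDerivAt.scomp s (hasDerivAt_exp_smul_const Y (t - s)) h3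
      simpa [Function.comp_def] using this
    have h3 := ((ContinuousLinearMap.apply ℂ H f).restrictScalars ℝ).hasFDerivAt.comp_hasDerivAt s
      (h1.mul h2)
    refine h3.congr_deriv ?_
    have hc : Commute X (exp ((t - s) • Y)) := (hXY.smul_right (t - s)).exp_right
    have hc' : X (exp ((t - s) • Y) f) = exp ((t - s) • Y) (X f) :=
      congrArg (fun Z : H →L[ℂ] H => Z f) hc.eq
    simp [sub_eq_add_neg] at hc' ⊢
    rw [hc']
  have hb : ∀ s ∈ Set.Ico (0 : ℝ) t,
      ‖exp (s • X) (exp ((t - s) • Y) (X f - Y f))‖ ≤ ‖X f - Y f‖ := fun s hs =>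
    (hX s hs.1 _).trans (hY _ (by linarith [hs.2]) _)
  have := norm_image_sub_le_of_norm_deriv_le_segment' (a := 0) (b := t)
    (fun s _ => (hd s).hasDerivWithinAt) hb t ⟨ht, le_rfl⟩
  simpa [mul_comm] using this

theorem norm_exp_smul_sub_self_le {X : H →L[ℂ] H}
    (hX : ∀ t : ℝ, 0 ≤ t → ∀ f, ‖exp (t • X) f‖ ≤ ‖f‖) {t : ℝ} (ht : 0 ≤ t) (f : H) :
    ‖exp (t • X) f - f‖ ≤ t * ‖X f‖ := by
  simpa using norm_exp_smul_sub_exp_smul_le (Y := 0) (Commute.zero_right X) hX (by simp) ht f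

/-- A second-order Taylor bound would involve `X²f`, which is not uniformly controlled for Yosida
approximations. Replacing `Xf` by a nearby `g` for which `Xg` is controlled costs only `2‖Xf - g‖`.
-/
theorem norm_exp_smul_sub_self_sub_smul_le {X : H →L[ℂ] H}
    (hX : ∀ t : ℝ, 0 ≤ t → ∀ f, ‖exp (t • X) f‖ ≤ ‖f‖) {t : ℝ} (ht : 0 ≤ t) (f g : H) :
    ‖exp (t • X) f - f - t • X f‖ ≤ t * (2 * ‖X f - g‖ + t * ‖X g‖) := by
  have hd : ∀ s : ℝ, HasDerivAt (fun s : ℝ => exp (s • X) f - f - s • X f)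
      (exp (s • X) (X f) - X f) s := by
    intro s
    refine HasDerivAt.congr_deriv (((hasDerivAt_exp_smul_apply X f s).sub_const f).sub
      ((hasDerivAt_id s).smul_const (X f))) ?_
    simp
  have hb : ∀ s ∈ Set.Ico (0 : ℝ) t,
      ‖exp (s • X) (X f) - X f‖ ≤ 2 * ‖X f - g‖ + t * ‖X g‖ := by
    intro s hs
    have e : exp (s • X) (X f) - X f
        = exp (s • X) (X f - g) + (exp (s • X) g - g) + (g - X f) := by
      rw [map_sub]; abel
    rw [e]
    have h1 := hX s hs.1 (X f - g)
    have h2 := norm_exp_smul_sub_self_le hX hs.1 g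
    have h3 : s * ‖X g‖ ≤ t * ‖X g‖ := by gcongr; exact hs.2.le
    have h4 := norm_sub_rev g (X f)
    linarith [norm_add₃_le (a := exp (s • X) (X f - g)) (b := exp (s • X) g - g) (c := g - X f)]
  have := norm_image_sub_le_of_norm_deriv_le_segment' (a := 0) (b := t)
    (fun s _ => (hd s).hasDerivWithinAt) hb t ⟨ht, le_rfl⟩
  simpa [mul_comm] using this

end BoundedGenerators

/-! ### m-accretive relations and the semigroups they generate -/

section MAccretive

variable {H : Type*} [NormedAddCommGroup H] [InnerProductSpace ℂ H]

/-- `A`, given by its graph, is an m-accretive operator in `H`. -/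
structure IsMAccretive (A : H → H → Prop) : Prop where
  sub : ∀ {φ ψ φ' ψ'}, A φ ψ → A φ' ψ' → A (φ - φ') (ψ - ψ')
  smul : ∀ {φ ψ} (c : ℂ), A φ ψ → A (c • φ) (c • ψ)
  accretive : ∀ {φ ψ}, A φ ψ → 0 ≤ (inner ℂ φ ψ).re
  range : ∀ ε : ℝ, 0 < ε → ∀ f, ∃ φ, A φ (ε⁻¹ • (f - φ))
  single : ∀ {ψ}, A 0 ψ → ψ = 0

theorem re_inner_self_eq (f : H) : (inner ℂ f f).re = ‖f‖ ^ 2 :=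
  inner_self_eq_norm_sq (𝕜 := ℂ) f

variable {A : H → H → Prop}

namespace IsMAccretive

theorem real_smul (hA : IsMAccretive A) {φ ψ : H} (c : ℝ) (h : A φ ψ) : A (c • φ) (c • ψ) :=
  hA.smul (c : ℂ) h

theorem add (hA : IsMAccretive A) {φ ψ φ' ψ' : H} (h : A φ ψ) (h' : A φ' ψ') :
    A (φ + φ') (ψ + ψ') := by
  simpa using hA.sub h (hA.smul (-1) h')

/-- Testing with `φ` gives `‖φ‖² ≤ Re(φ, f) ≤ ‖φ‖‖f‖`. -/
theorem norm_le (hA : IsMAccretive A) {ε : ℝ} (hε : 0 < ε) {φ f : H}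
    (h : A φ (ε⁻¹ • (f - φ))) : ‖φ‖ ≤ ‖f‖ := by
  have h1 := hA.accretive h
  have h3 := inner_smul_right_eq_smul (𝕜 := ℂ) φ (f - φ) ε⁻¹
  rw [h3, Complex.smul_re, smul_eq_mul, inner_sub_right, Complex.sub_re,
    re_inner_self_eq] at h1
  have h4 : 0 ≤ (inner ℂ φ f).re - ‖φ‖ ^ 2 := by
    by_contra! hc
    nlinarith [inv_pos.2 hε]
  have h5 : (inner ℂ φ f).re ≤ ‖φ‖ * ‖f‖ := re_inner_le_norm (𝕜 := ℂ) φ f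
  by_contra! hlt
  nlinarith [norm_nonneg f, norm_nonneg φ]

theorem eq_of_resolvent (hA : IsMAccretive A) {ε : ℝ} (hε : 0 < ε) {φ φ' f : H}
    (h : A φ (ε⁻¹ • (f - φ))) (h' : A φ' (ε⁻¹ • (f - φ'))) : φ = φ' := by
  have h1 := hA.sub h h'
  have h2 : A (φ - φ') (ε⁻¹ • (0 - (φ - φ'))) := by
    convert h1 using 1
    rw [← smul_sub]; congr 1; abel
  have := hA.norm_le hε h2
  rw [norm_zero] at this
  exact sub_eq_zero.1 (norm_le_zero_iff.1 this)

theorem exists_resolvent (hA : IsMAccretive A) {ε : ℝ} (hε : 0 < ε) :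
    ∃ J : H →L[ℂ] H, (∀ f, A (J f) (ε⁻¹ • (f - J f))) ∧ ∀ f, ‖J f‖ ≤ ‖f‖ := by
  choose J hJ using hA.range ε hε
  refine ⟨LinearMap.mkContinuous ⟨⟨J, fun f g => ?_⟩, fun c f => ?_⟩ 1 fun f => ?_, hJ,
    fun f => hA.norm_le hε (hJ f)⟩
  · refine hA.eq_of_resolvent hε (hJ _) ?_
    convert hA.add (hJ f) (hJ g) using 1
    rw [← smul_add]; congr 1; abel
  · refine hA.eq_of_resolvent hε (hJ _) ?_
    have h := hA.smul c (hJ f)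
    rw [smul_comm, smul_sub] at h
    exact h
  · simpa using hA.norm_le hε (hJ f)

/-- The resolvent commutes with `A` on its domain: `φ - εJψ` solves the equation that determines
`Jφ`. -/
theorem resolvent_mem (hA : IsMAccretive A) {ε : ℝ} (hε : 0 < ε) {J : H →L[ℂ] H}
    (hJ : ∀ f, A (J f) (ε⁻¹ • (f - J f))) {φ ψ : H} (h : A φ ψ) :
    φ - J φ = ε • J ψ ∧ A (J φ) (J ψ) := by
  have h1 : A (φ - ε • J ψ) (J ψ) := by
    have := hA.sub h (hA.real_smul ε (hJ ψ))
    rwa [smul_smul, mul_inv_cancel₀ hε.ne', one_smul, sub_sub_cancel] at this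
  have h2 : J φ = φ - ε • J ψ := by
    refine hA.eq_of_resolvent hε (hJ φ) ?_
    rwa [sub_sub_cancel, smul_smul, inv_mul_cancel₀ hε.ne', one_smul]
  exact ⟨by rw [h2, sub_sub_cancel], by rwa [h2]⟩

theorem resolvent_comm (hA : IsMAccretive A) {ε δ : ℝ} (hε : 0 < ε) (hδ : 0 < δ)
    {J L : H →L[ℂ] H} (hJ : ∀ f, A (J f) (ε⁻¹ • (f - J f)))
    (hL : ∀ f, A (L f) (δ⁻¹ • (f - L f))) : Commute J L := by
  ext f
  refine (hA.eq_of_resolvent hδ (hL (J f)) ?_).symm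
  have := (hA.resolvent_mem hε hJ (hL f)).2
  rwa [ContinuousLinearMap.map_smul_of_tower, map_sub] at this

/-- Let `h` be orthogonal to the domain and solve `φ + Aφ = h`. Accretivity gives `0 ≤ Re(φ, h - φ)
= -‖φ‖²`, so `φ = 0` and `A 0 = h`; hence `h = 0` by single-valuedness. -/
theorem dense_domain [CompleteSpace H] (hA : IsMAccretive A) : Dense {φ | ∃ ψ, A φ ψ} := by
  obtain ⟨φ₀, h₀⟩ := hA.range 1 one_pos 0
  let D : Submodule ℂ H :=
    { carrier := {φ | ∃ ψ, A φ ψ}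
      add_mem' := fun ⟨_, h⟩ ⟨_, h'⟩ => ⟨_, hA.add h h'⟩
      zero_mem' := ⟨_, by simpa using hA.smul 0 h₀⟩
      smul_mem' := fun c _ ⟨_, h⟩ => ⟨_, hA.smul c h⟩ }
  have hD : D.topologicalClosure = ⊤ := by
    rw [Submodule.topologicalClosure_eq_top_iff, Submodule.eq_bot_iff]
    intro h hh
    obtain ⟨φ, hφ⟩ := hA.range 1 one_pos h
    rw [inv_one, one_smul] at hφ
    have h1 : inner ℂ φ h = 0 := (Submodule.mem_orthogonal _ _).1 hh φ ⟨_, hφ⟩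
    have h2 := hA.accretive hφ
    rw [inner_sub_right, h1, zero_sub, Complex.neg_re, re_inner_self_eq] at h2
    have h3 : ‖φ‖ ^ 2 ≤ 0 := by linarith
    have h4 : φ = 0 := by
      rw [← norm_eq_zero]; exact pow_eq_zero_iff (two_ne_zero) |>.1 (le_antisymm h3 (by positivity))
    rw [h4, sub_zero] at hφ
    exact hA.single hφ
  exact (Submodule.dense_iff_topologicalClosure_eq_top).2 hD

end IsMAccretive

/-! ### Yosida approximation and the Lumer–Phillips theorem -/

theorem tendsto_zero_of_dense {ι : Type*} {l : Filter ι} {L : ι → H →L[ℂ] H} {C : ℝ}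
    (hL : ∀ i f, ‖L i f‖ ≤ C * ‖f‖) {D : Set H} (hD : Dense D)
    (h : ∀ f ∈ D, Tendsto (fun i => L i f) l (𝓝 0)) (f : H) :
    Tendsto (fun i => L i f) l (𝓝 0) := by
  rw [Metric.tendsto_nhds]
  intro ε hε
  obtain ⟨g, hg, hfg⟩ := hD.exists_dist_lt f (show 0 < ε / (2 * (|C| + 1)) by positivity)
  filter_upwards [(Metric.tendsto_nhds.1 (h g hg)) (ε / 2) (half_pos hε)] with i hi
  rw [dist_zero_right] at hi ⊢
  rw [dist_eq_norm] at hfg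
  have h1 : L i f = L i (f - g) + L i g := by simp
  have h2 : ‖L i (f - g)‖ ≤ (|C| + 1) * ‖f - g‖ :=
    (hL i _).trans (by gcongr; linarith [le_abs_self C])
  rw [lt_div_iff₀ (by positivity)] at hfg
  calc ‖L i f‖ ≤ ‖L i (f - g)‖ + ‖L i g‖ := by rw [h1]; exact norm_add_le _ _
    _ < ε := by nlinarith

theorem exp_smul_smul_sub_one (J : H →L[ℂ] H) (t ε : ℝ) :
    t • ε⁻¹ • (J - 1) = (t / ε) • (J - 1) := by
  rw [smul_smul, div_eq_mul_inv]

variable [CompleteSpace H]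

open NormedSpace

/-- The Yosida approximations `Xₖ = εₖ⁻¹(Jₖ - 1)` are bounded, commute and generate contractions. On
the domain `Xₖφ = -Jₖψ` converges, so the commuting-exponential estimate makes `exp(tXₖ)φ` Cauchy;
density and contractivity extend this to all vectors. Convex invariance passes from `Jₖ` through the
exponential to the limit. -/
theorem IsMAccretive.exists_approx (hA : IsMAccretive A) :
    ∃ (J X : ℕ → H →L[ℂ] H) (T : ℝ≥0 → H →L[ℂ] H),
      (∀ k (t : ℝ), 0 ≤ t → ∀ f, ‖exp (t • X k) f‖ ≤ ‖f‖) ∧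
      (∀ k φ ψ, A φ ψ → X k φ = -J k ψ) ∧
      (∀ k f, ‖J k f‖ ≤ ‖f‖) ∧
      (∀ f, Tendsto (fun k => J k f) atTop (𝓝 f)) ∧
      (∀ (t : ℝ≥0) f, Tendsto (fun k => exp ((t : ℝ) • X k) f) atTop (𝓝 (T t f))) ∧
      ∀ K : Set H, IsClosed K → Convex ℝ K →
        (∀ ε : ℝ, 0 < ε → ∀ f ∈ K, ∀ φ, A φ (ε⁻¹ • (f - φ)) → φ ∈ K) →
        ∀ t, ∀ f ∈ K, T t f ∈ K := by
  let ε : ℕ → ℝ := fun k => 1 / ((k : ℝ) + 1)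
  have hε : ∀ k, 0 < ε k := fun k => by positivity
  choose J hJ hJn using fun k => hA.exists_resolvent (hε k)
  let X : ℕ → H →L[ℂ] H := fun k => (ε k)⁻¹ • (J k - 1)
  have hX : ∀ k (t : ℝ), 0 ≤ t → ∀ f, ‖exp (t • X k) f‖ ≤ ‖f‖ := by
    intro k t ht f
    rw [exp_smul_smul_sub_one]
    exact norm_exp_smul_sub_one_le _ (hJn k) (div_nonneg ht (hε k).le) f
  have hXJ : ∀ k φ ψ, A φ ψ → X k φ = -J k ψ := by
    intro k φ ψ h
    have h1 := (hA.resolvent_mem (hε k) (hJ k) h).1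
    have h2 : X k φ = (ε k)⁻¹ • (J k φ - φ) := rfl
    rw [h2, ← neg_sub φ, h1, ← smul_neg, smul_smul, inv_mul_cancel₀ (hε k).ne', one_smul]
  have hJ1 : ∀ f, Tendsto (fun k => J k f) atTop (𝓝 f) := by
    intro f
    have := tendsto_zero_of_dense (L := fun k => J k - 1) (l := atTop) (C := 2) (fun k f => by
      have := norm_sub_le (J k f) f
      have h2 := hJn k f
      change ‖J k f - f‖ ≤ _
      linarith) hA.dense_domain (by
      rintro φ ⟨ψ, h⟩
      have h1 : Tendsto (fun k => ε k * ‖ψ‖) atTop (𝓝 0) := by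
        simpa only [zero_mul] using
          (tendsto_one_div_add_atTop_nhds_zero_nat (𝕜 := ℝ)).mul_const ‖ψ‖
      refine squeeze_zero_norm (fun k => ?_) h1
      change ‖J k φ - φ‖ ≤ _
      rw [norm_sub_rev, (hA.resolvent_mem (hε k) (hJ k) h).1, norm_smul,
        Real.norm_of_nonneg (hε k).le]
      exact mul_le_mul_of_nonneg_left (hJn k ψ) (hε k).le) f
    simpa using this.add_const f
  have hcomm : ∀ k l, Commute (X k) (X l) := fun k l => by
    have h1 := hA.resolvent_comm (hε k) (hε l) (hJ k) (hJ l)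
    exact ((((h1.sub_left (Commute.one_left _)).sub_right
      (Commute.one_right _))).smul_left _).smul_right _
  have hconv : ∀ (t : ℝ≥0) f, ∃ g, Tendsto (fun k => exp ((t : ℝ) • X k) f) atTop (𝓝 g) := by
    intro t f
    refine cauchySeq_tendsto_of_complete ?_
    rw [cauchySeq_iff_tendsto_dist_atTop_0]
    have := tendsto_zero_of_dense (l := atTop) (C := 2)
      (L := fun p : ℕ × ℕ => exp ((t : ℝ) • X p.1) - exp ((t : ℝ) • X p.2)) (fun p f => by
      have h1 := norm_sub_le (exp ((t : ℝ) • X p.1) f) (exp ((t : ℝ) • X p.2) f)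
      have h2 := hX p.1 t t.2 f
      have h3 := hX p.2 t t.2 f
      change ‖exp ((t : ℝ) • X p.1) f - exp ((t : ℝ) • X p.2) f‖ ≤ _
      linarith) hA.dense_domain (by
      rintro φ ⟨ψ, h⟩
      have h1 := (cauchySeq_iff_tendsto_dist_atTop_0.1 (hJ1 ψ).cauchySeq).const_mul (t : ℝ)
      rw [mul_zero] at h1
      refine squeeze_zero_norm (fun p => ?_) h1
      refine (norm_exp_smul_sub_exp_smul_le (hcomm p.1 p.2) (hX _) (hX _) t.2 φ).trans ?_
      rw [hXJ _ _ _ h, hXJ _ _ _ h, dist_eq_norm, ← norm_neg (J p.1 ψ - J p.2 ψ)]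
      apply le_of_eq; congr 2; abel) f
    simpa [dist_eq_norm] using this.norm
  choose T hT using hconv
  have hT' : ∀ t : ℝ≥0, Tendsto (fun k f => exp ((t : ℝ) • X k) f) atTop (𝓝 (T t)) := fun t =>
    tendsto_pi_nhds.2 (hT t)
  refine ⟨J, X, fun t => continuousLinearMapOfTendsto (fun k => exp ((t : ℝ) • X k)) (hT' t), hX,
    hXJ, hJn, hJ1, hT, ?_⟩
  intro K hK hKc hKA t f hf
  refine hK.mem_of_tendsto (hT t f) (Eventually.of_forall fun k => ?_)
  rw [exp_smul_smul_sub_one]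
  exact exp_smul_sub_one_mem hK hKc _ (fun g hg => hKA _ (hε k) g hg _ (hJ k g))
    (div_nonneg t.2 (hε k).le) hf

/-- The Lumer–Phillips theorem, with the invariance of those closed convex sets that are invariant
under the resolvents. -/
theorem IsMAccretive.exists_semigroup (hA : IsMAccretive A) :
    ∃ T : ℝ≥0 → H →L[ℂ] H, IsSemigroupGeneratedByNeg A T ∧
      ∀ K : Set H, IsClosed K → Convex ℝ K →
        (∀ ε : ℝ, 0 < ε → ∀ f ∈ K, ∀ φ, A φ (ε⁻¹ • (f - φ)) → φ ∈ K) →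
        ∀ t, ∀ f ∈ K, T t f ∈ K := by
  obtain ⟨J, X, T, hX, hXJ, hJn, hJ1, hT, hK⟩ := hA.exists_approx
  refine ⟨T, ?_, hK⟩
  have hTn : ∀ t f, ‖T t f‖ ≤ ‖f‖ := fun t f =>
    le_of_tendsto (hT t f).norm (Eventually.of_forall fun k => hX k t t.2 f)
  have hT0 : ∀ φ ψ, A φ ψ → ∀ t : ℝ≥0, ‖T t φ - φ‖ ≤ t * ‖ψ‖ := by
    intro φ ψ h t
    refine le_of_tendsto ((hT t φ).sub_const φ).norm (Eventually.of_forall fun k => ?_)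
    refine (norm_exp_smul_sub_self_le (hX k) t.2 φ).trans ?_
    rw [hXJ k φ ψ h, norm_neg]
    exact mul_le_mul_of_nonneg_left (hJn k ψ) t.2
  -- This is the limit of the Taylor estimate with `g = -φ'`, where `φ'` is an element of the domain
  -- that will be chosen near `ψ`; then `‖Xₖg‖ = ‖Jₖψ'‖ ≤ ‖ψ'‖` uniformly in `k`.
  have hT1 : ∀ φ ψ, A φ ψ → ∀ φ' ψ', A φ' ψ' → ∀ t : ℝ≥0,
      ‖φ - T t φ - (t : ℝ) • ψ‖ ≤ t * (2 * ‖φ' - ψ‖ + t * ‖ψ'‖) := by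
    intro φ ψ h φ' ψ' h' t
    have e1 : Tendsto (fun k => exp ((t : ℝ) • X k) φ - φ - (t : ℝ) • X k φ) atTop
        (𝓝 (T t φ - φ - (t : ℝ) • (-ψ))) := by
      refine ((hT t φ).sub_const φ).sub (Tendsto.const_smul ?_ _)
      simpa [hXJ _ _ _ h] using (hJ1 ψ).neg
    have e2 : ‖φ - T t φ - (t : ℝ) • ψ‖ = ‖T t φ - φ - (t : ℝ) • (-ψ)‖ := by
      rw [← norm_neg]; congr 1; rw [smul_neg]; abel
    have e3 : Tendsto (fun k => (t : ℝ) * (2 * ‖X k φ - (-φ')‖ + t * ‖ψ'‖)) atTop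
        (𝓝 (t * (2 * ‖-ψ - -φ'‖ + t * ‖ψ'‖))) := by
      refine Tendsto.const_mul _ (Tendsto.add_const _ (Tendsto.const_mul _
        (Tendsto.norm (Tendsto.sub_const ?_ _))))
      simpa [hXJ _ _ _ h] using (hJ1 ψ).neg
    rw [e2, show φ' - ψ = -ψ - -φ' by abel]
    refine le_of_tendsto_of_tendsto e1.norm e3 (Eventually.of_forall fun k => ?_)
    refine (norm_exp_smul_sub_self_sub_smul_le (hX k) t.2 φ (-φ')).trans ?_
    refine mul_le_mul_of_nonneg_left (add_le_add le_rfl (mul_le_mul_of_nonneg_left ?_ t.2)) t.2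
    rw [map_neg, hXJ k _ _ h', neg_neg]
    exact hJn k ψ'
  have hgen : ∀ φ ψ, A φ ψ →
      Tendsto (fun t : ℝ≥0 => ((t : ℝ)⁻¹ : ℂ) • (φ - T t φ)) (𝓝[≠] 0) (𝓝 ψ) := by
    intro φ ψ h
    rw [Metric.tendsto_nhds]
    intro η hη
    obtain ⟨φ', ⟨ψ', h'⟩, hφ'⟩ := hA.dense_domain.exists_dist_lt ψ (show 0 < η / 4 by positivity)
    rw [dist_comm, dist_eq_norm] at hφ'
    have e1 : Tendsto (fun t : ℝ≥0 => (t : ℝ) * ‖ψ'‖) (𝓝[≠] 0) (𝓝 0) := by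
      have : Continuous fun t : ℝ≥0 => (t : ℝ) * ‖ψ'‖ := by fun_prop
      simpa using (this.tendsto 0).mono_left nhdsWithin_le_nhds
    filter_upwards [e1.eventually (gt_mem_nhds (half_pos hη)), self_mem_nhdsWithin] with t ht1 ht2
    have htpos : (0 : ℝ) < t := by
      have : 0 < t := pos_iff_ne_zero.2 ht2
      exact_mod_cast this
    have e2 : ((t : ℝ)⁻¹ : ℂ) • (φ - T t φ) - ψ = (t : ℝ)⁻¹ • (φ - T t φ - (t : ℝ) • ψ) := by
      rw [smul_sub _ _ ((t : ℝ) • ψ), smul_smul, inv_mul_cancel₀ htpos.ne', one_smul,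
        ← Complex.ofReal_inv, Complex.coe_smul]
    rw [dist_eq_norm, e2, norm_smul, norm_inv, Real.norm_of_nonneg htpos.le]
    have e3 := hT1 φ ψ h φ' ψ' h' t
    rw [inv_mul_lt_iff₀ htpos]
    refine e3.trans_lt ?_
    gcongr
    linarith
  have hacc : ∀ φ ψ, Tendsto (fun t : ℝ≥0 => ((t : ℝ)⁻¹ : ℂ) • (φ - T t φ)) (𝓝[≠] 0) (𝓝 ψ) →
      0 ≤ (inner ℂ φ ψ).re := by
    intro φ ψ h
    have h1 : Tendsto (fun t : ℝ≥0 => (inner ℂ φ (((t : ℝ)⁻¹ : ℂ) • (φ - T t φ))).re) (𝓝[≠] 0)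
        (𝓝 (inner ℂ φ ψ).re) :=
      (Complex.continuous_re.tendsto _).comp (tendsto_const_nhds.inner h)
    refine ge_of_tendsto h1 (Eventually.of_forall fun t => ?_)
    rw [← Complex.ofReal_inv, inner_smul_right, Complex.re_ofReal_mul, inner_sub_right,
      Complex.sub_re, re_inner_self_eq]
    have h2 : (inner ℂ φ (T t φ)).re ≤ ‖φ‖ * ‖T t φ‖ := re_inner_le_norm (𝕜 := ℂ) φ (T t φ)
    have h3 := hTn t φ
    refine mul_nonneg (inv_nonneg.2 t.2) ?_
    nlinarith [norm_nonneg φ]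
  refine ⟨⟨?_, ?_, ?_⟩, fun φ ψ => ⟨hgen φ ψ, fun h => ?_⟩⟩
  · ext f
    refine tendsto_nhds_unique (hT 0 f) ?_
    simp
  · intro s t
    ext f
    refine tendsto_nhds_unique (hT (s + t) f) ?_
    have e1 : ∀ k, exp (((s + t : ℝ≥0) : ℝ) • X k) f
        = exp ((s : ℝ) • X k) (exp ((t : ℝ) • X k) f) := by
      intro k
      let : NormedAlgebra ℚ (H →L[ℂ] H) := NormedAlgebra.restrictScalars ℚ ℝ _
      rw [NNReal.coe_add, add_smul, exp_add_of_commute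
        (((Commute.refl (X k)).smul_left _).smul_right _)]
      rfl
    simp only [e1]
    have e2 : Tendsto (fun k => exp ((s : ℝ) • X k) (exp ((t : ℝ) • X k) f - T t f)) atTop
        (𝓝 0) := by
      refine squeeze_zero_norm (fun k => hX k s s.2 _) ?_
      simpa using ((hT t f).sub_const (T t f)).norm
    simpa using e2.add (hT s (T t f))
  · intro f
    have := tendsto_zero_of_dense (L := fun t => T t - 1) (l := 𝓝 0) (C := 2) (fun t f => by
      have := norm_sub_le (T t f) f
      have h2 := hTn t f
      change ‖T t f - f‖ ≤ _
      linarith) hA.dense_domain (by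
      rintro φ ⟨ψ, h⟩
      have e1 : Tendsto (fun t : ℝ≥0 => (t : ℝ) * ‖ψ‖) (𝓝 0) (𝓝 0) := by
        have : Continuous fun t : ℝ≥0 => (t : ℝ) * ‖ψ‖ := by fun_prop
        simpa using this.tendsto 0
      exact squeeze_zero_norm (fun t => hT0 φ ψ h t) e1) f
    simpa using this.add_const f
  -- Maximality: the negative generator extends `A` and is accretive. With `φ' + Aφ' = φ + ψ` it
  -- sends `φ - φ'` to `-(φ - φ')`, so `φ = φ'` lies in the domain of `A`.
  · obtain ⟨φ', h'⟩ := hA.range 1 one_pos (φ + ψ)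
    rw [inv_one, one_smul] at h'
    have h1 := h.sub (hgen _ _ h')
    have h2 := hacc (φ - φ') (-(φ - φ')) (by
      convert h1 using 2 with t
      · rw [← smul_sub, map_sub]; congr 1; abel
      · abel)
    rw [inner_neg_right, Complex.neg_re, re_inner_self_eq] at h2
    have h3 : φ - φ' = 0 := by
      rw [← norm_eq_zero]
      exact pow_eq_zero_iff two_ne_zero |>.1 (le_antisymm (by linarith) (by positivity))
    rw [sub_eq_zero] at h3
    subst h3
    simpa using h'

end MAccretive

/-! ### Uniqueness of the semigroup with a given generator -/

section Uniqueness

variable {H : Type*} [NormedAddCommGroup H] [InnerProductSpace ℂ H] {A : H → H → Prop}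

/-! ### Local boundedness and strong continuity of semigroups -/

section Continuity

variable [CompleteSpace H]

theorem IsC0Semigroup.exists_norm_le {T : ℝ≥0 → H →L[ℂ] H} (hT : IsC0Semigroup T) (b : ℝ≥0) :
    ∃ M : ℝ, 0 ≤ M ∧ ∀ t ≤ b, ‖T t‖ ≤ M := by
  obtain ⟨δ, hδ, M, hM⟩ : ∃ δ : ℝ≥0, 0 < δ ∧ ∃ M : ℝ, ∀ t ≤ δ, ‖T t‖ ≤ M := by
    by_contra! hcon
    -- Unboundedness near `0` would give `tₖ → 0` with `‖T(tₖ)‖ > k`, although `T(tₖ)x → x` for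
    -- every `x`, against Banach–Steinhaus. The semigroup law then carries the bound to multiples of
    -- `δ`.
    choose t ht1 ht2 using fun k : ℕ => hcon (1 / ((k : ℝ≥0) + 1)) (by positivity) k
    have ht0 : Tendsto t atTop (𝓝 0) :=
      tendsto_of_tendsto_of_tendsto_of_le_of_le tendsto_const_nhds
        (tendsto_one_div_add_atTop_nhds_zero_nat (𝕜 := ℝ≥0)) (fun _ => zero_le) ht1
    obtain ⟨C, hC⟩ := banach_steinhaus (g := fun k => T (t k)) (fun x => by
      obtain ⟨C, hC⟩ := (((hT.tendsto x).comp ht0).norm).bddAbove_range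
      exact ⟨C, fun i => hC ⟨i, rfl⟩⟩)
    obtain ⟨k, hk⟩ := exists_nat_gt C
    linarith [hC k, ht2 k]
  have hM0 : 0 ≤ M := (norm_nonneg _).trans (hM 0 zero_le)
  have key : ∀ N : ℕ, ∃ M : ℝ, 0 ≤ M ∧ ∀ t ≤ (N : ℝ≥0) * δ, ‖T t‖ ≤ M := by
    intro N
    induction N with
    | zero => exact ⟨M, hM0, fun t ht => hM t (by simp at ht; simp [ht])⟩
    | succ N ih =>
      obtain ⟨M', hM', h⟩ := ih
      refine ⟨M' * M + M', by positivity, fun t ht => ?_⟩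
      rcases le_total t (N * δ) with h1 | h1
      · linarith [h t h1, mul_nonneg hM' hM0]
      · have h2 : t = N * δ + (t - N * δ) := (add_tsub_cancel_of_le h1).symm
        have h3 : t - N * δ ≤ δ := by
          rw [tsub_le_iff_left]
          refine ht.trans (le_of_eq ?_)
          push_cast; ring
        rw [h2, hT.add]
        refine (norm_mul_le _ _).trans ?_
        have := mul_le_mul (h _ le_rfl) (hM _ h3) (norm_nonneg _) hM'
        linarith
  obtain ⟨N, hN⟩ := exists_nat_gt (b / δ)
  obtain ⟨M, hM, h⟩ := key N
  exact ⟨M, hM, fun t ht => h t (ht.trans ((div_le_iff₀ hδ).1 hN.le))⟩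

theorem IsC0Semigroup.continuous {T : ℝ≥0 → H →L[ℂ] H} (hT : IsC0Semigroup T) (f : H) :
    Continuous fun t => T t f := by
  rw [continuous_iff_continuousAt]
  intro t
  obtain ⟨M, hM, hb⟩ := hT.exists_norm_le (t + 1)
  rw [ContinuousAt, tendsto_iff_norm_sub_tendsto_zero]
  -- With truncated subtraction, `(s - t) + (t - s)` is `|s - t|` in `ℝ≥0`, so both sides of `t` are
  -- treated at once.
  have h1 : Tendsto (fun s : ℝ≥0 => M * ‖T ((s - t) + (t - s)) f - f‖) (𝓝 t) (𝓝 0) := by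
    have h2 : Tendsto (fun s : ℝ≥0 => (s - t) + (t - s)) (𝓝 t) (𝓝 0) := by
      have : Continuous fun s : ℝ≥0 => (s - t) + (t - s) := by fun_prop
      simpa using this.tendsto t
    simpa using ((((hT.tendsto f).comp h2).sub_const f).norm).const_mul M
  have h3 : ∀ a b : ℝ≥0, a ≤ b → a ≤ t + 1 → ‖T b f - T a f‖ ≤ M * ‖T (b - a) f - f‖ := by
    intro a b hab ha
    have e : T b f - T a f = T a (T (b - a) f - f) := by
      have : T b = T a * T (b - a) := by rw [← hT.add, add_tsub_cancel_of_le hab]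
      rw [map_sub, this]; rfl
    rw [e]
    exact (T a).le_of_opNorm_le (hb a ha) _
  refine squeeze_zero' (Eventually.of_forall fun _ => norm_nonneg _) ?_ h1
  filter_upwards with s
  rcases le_total s t with h | h
  · rw [norm_sub_rev, tsub_eq_zero_of_le h, zero_add]
    exact h3 s t h (h.trans (by simp))
  · rw [tsub_eq_zero_of_le h, add_zero]
    exact h3 t s h (by simp)

end Continuity

theorem IsSemigroupGeneratedByNeg.map {T : ℝ≥0 → H →L[ℂ] H}
    (hT : IsSemigroupGeneratedByNeg A T) {φ ψ : H} (h : A φ ψ) (t : ℝ≥0) : A (T t φ) (T t ψ) := by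
  rw [hT.generator] at h ⊢
  refine (((T t).continuous.tendsto ψ).comp h).congr fun s => ?_
  have : T t (T s φ) = T s (T t φ) := by
    have : T t * T s = T s * T t := by rw [← hT.add, ← hT.add, add_comm]
    exact congrArg (fun Z : H →L[ℂ] H => Z φ) this
  simp [this]

/-- The generator only supplies forward difference quotients. A right derivative is enough for the
monotonicity argument behind uniqueness. -/
theorem IsSemigroupGeneratedByNeg.hasDerivWithinAt {T : ℝ≥0 → H →L[ℂ] H}
    (hT : IsSemigroupGeneratedByNeg A T) {φ ψ : H} (h : A φ ψ) {x : ℝ} (hx : 0 ≤ x) :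
    HasDerivWithinAt (fun t : ℝ => T t.toNNReal φ) (-T x.toNNReal ψ) (Set.Ici x) x := by
  have h1 := (hT.generator _ _).1 (hT.map h x.toNNReal)
  rw [← hasDerivWithinAt_Ioi_iff_Ici, hasDerivWithinAt_iff_tendsto_slope' Set.self_notMem_Ioi]
  have h2 : Tendsto (fun s : ℝ => (s - x).toNNReal) (𝓝[>] x) (𝓝[≠] 0) := by
    refine tendsto_nhdsWithin_iff.2 ⟨?_, ?_⟩
    · have : Continuous fun s : ℝ => (s - x).toNNReal := by fun_prop
      simpa using (this.tendsto x).mono_left nhdsWithin_le_nhds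
    · filter_upwards [self_mem_nhdsWithin] with s hs
      have : 0 < (s - x).toNNReal := Real.toNNReal_pos.2 (sub_pos.2 hs)
      exact this.ne'
  refine (h1.comp h2).neg.congr' ?_
  filter_upwards [self_mem_nhdsWithin] with s hs
  have hs' : 0 ≤ s - x := (sub_pos.2 hs).le
  have e1 : T s.toNNReal φ = T (s - x).toNNReal (T x.toNNReal φ) := by
    have : T s.toNNReal = T (s - x).toNNReal * T x.toNNReal := by
      rw [← hT.add, ← Real.toNNReal_add hs' hx, sub_add_cancel]
    rw [this]; rfl
  simp only [Function.comp_apply, Real.coe_toNNReal _ hs', slope_def_module, e1]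
  rw [← smul_neg, neg_sub, ← Complex.ofReal_inv, Complex.coe_smul]

/-- An accretive densely defined operator is minus the generator of at most one semigroup. -/
theorem IsMAccretive.semigroup_unique [CompleteSpace H] (hA : IsMAccretive A)
    {T S : ℝ≥0 → H →L[ℂ] H}
    (hT : IsSemigroupGeneratedByNeg A T) (hS : IsSemigroupGeneratedByNeg A S) : T = S := by
  let : InnerProductSpace ℝ H := InnerProductSpace.complexToReal
  have key : ∀ φ ψ, A φ ψ → ∀ t, T t φ = S t φ := by
    intro φ ψ h t
    have hc : ∀ {T : ℝ≥0 → H →L[ℂ] H}, IsSemigroupGeneratedByNeg A T →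
        Continuous fun t : ℝ => T t.toNNReal φ := fun hT =>
      (hT.toIsC0Semigroup.continuous φ).comp continuous_real_toNNReal
    -- Both trajectories stay in the domain of `A`, so the right derivative of `‖T(x)φ - S(x)φ‖²` is
    -- `-2 Re(w, Aw)` with `w = T(x)φ - S(x)φ`. It is nonpositive by accretivity, and the function
    -- starts at `0`.
    have hd : ∀ x ∈ Set.Ico (0 : ℝ) t,
        HasDerivWithinAt (fun s : ℝ => ‖T s.toNNReal φ - S s.toNNReal φ‖ ^ 2)
        (2 * inner ℝ (T x.toNNReal φ - S x.toNNReal φ)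
          (-T x.toNNReal ψ - -S x.toNNReal ψ)) (Set.Ici x) x := fun x hx =>
      ((hT.hasDerivWithinAt h hx.1).sub (hS.hasDerivWithinAt h hx.1)).norm_sq
    have := image_le_of_deriv_right_le_deriv_boundary (a := 0) (b := (t : ℝ))
      (f := fun s : ℝ => ‖T s.toNNReal φ - S s.toNNReal φ‖ ^ 2) (B := fun _ => 0)
      (B' := fun _ => 0) (((hc hT).sub (hc hS)).norm.pow 2).continuousOn hd
      (by simp [hT.zero, hS.zero]) continuousOn_const
      (fun x _ => hasDerivWithinAt_const _ _ _) (fun x hx => by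
        have h1 := hA.accretive (hA.sub (hT.map h x.toNNReal) (hS.map h x.toNNReal))
        have h2 : inner ℝ (T x.toNNReal φ - S x.toNNReal φ) (-T x.toNNReal ψ - -S x.toNNReal ψ)
            = -(inner ℂ (T x.toNNReal φ - S x.toNNReal φ)
              (T x.toNNReal ψ - S x.toNNReal ψ)).re := by
          rw [← Complex.neg_re, ← inner_neg_right, neg_sub, sub_neg_eq_add, neg_add_eq_sub]
          rfl
        rw [h2]
        linarith) (x := t) ⟨t.2, le_rfl⟩
    simp only [Real.toNNReal_coe] at this
    have h0 : ‖T t φ - S t φ‖ = 0 :=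
      pow_eq_zero_iff two_ne_zero |>.1 (le_antisymm this (by positivity))
    exact sub_eq_zero.1 (norm_eq_zero.1 h0)
  ext t f
  have := Continuous.ext_on hA.dense_domain (T t).continuous (S t).continuous
    (fun φ ⟨ψ, h⟩ => key φ ψ h t)
  exact congrFun this f

end Uniqueness

/-! ### Operators associated with forms on pre-Hilbert spaces -/

section PreHilbert

variable {D : Type*} [SeminormedAddCommGroup D] [InnerProductSpace ℂ D]

open UniformSpace

/-- Riesz representation in the completion, applied to the continuous extension of `g`. -/
theorem exists_completion_inner_eq (g : D →ₗ[ℂ] ℂ) {C : ℝ} (hg : ∀ v, ‖g v‖ ≤ C * ‖v‖) :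
    ∃ w : Completion D, ∀ v : D, inner ℂ w (v : Completion D) = g v := by
  let G : D →L[ℂ] ℂ := g.mkContinuous C hg
  let e : D →L[ℂ] Completion D := Completion.toComplL
  refine ⟨(InnerProductSpace.toDual ℂ (Completion D)).symm (G.extend e), fun v => ?_⟩
  rw [InnerProductSpace.toDual_symm_apply]
  exact ContinuousLinearMap.extend_eq G (e := e) Completion.denseRange_coe
    (Completion.isUniformInducing_coe D) v

/-- The Lax–Milgram lemma in a pre-Hilbert space: the solution is given by a Cauchy sequence. -/
theorem exists_cauchySeq_solution (a : D →ₗ[ℂ] D →ₛₗ[starRingEnd ℂ] ℂ) {M c : ℝ}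
    (hM : ∀ u v, ‖a u v‖ ≤ M * ‖u‖ * ‖v‖) (hc : 0 < c) (hac : ∀ u, c * ‖u‖ ^ 2 ≤ (a u u).re)
    (g : D →ₗ[ℂ] ℂ) {C : ℝ} (hg : ∀ v, ‖g v‖ ≤ C * ‖v‖) :
    ∃ u : ℕ → D, CauchySeq u ∧ ∀ v : ℕ → D, CauchySeq v →
      Tendsto (fun k => a (u k) (v k) - (starRingEnd ℂ) (g (v k))) atTop (𝓝 0) := by
  have hconj : ∀ u, ∃ w : Completion D, ∀ v : D,
      inner ℂ w (v : Completion D) = (starRingEnd ℂ) (a u v) := by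
    intro u
    refine exists_completion_inner_eq (C := M * ‖u‖)
      ⟨⟨fun v => (starRingEnd ℂ) (a u v), by simp⟩, by simp⟩ fun v => ?_
    simpa using hM u v
  choose b' hb' using hconj
  have huniq : ∀ w w' : Completion D, (∀ v : D, inner ℂ w (v : Completion D) = inner ℂ w' v) →
      w = w' := by
    intro w w' h
    refine ext_inner_right ℂ fun x => ?_
    exact congrFun (Continuous.ext_on (Completion.denseRange_coe (α := D))
      (by fun_prop : Continuous fun x => inner ℂ w x) (by fun_prop)
      (by rintro _ ⟨v, rfl⟩; exact h v)) x
  let b : D →ₗ[ℂ] Completion D :=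
    { toFun := b'
      map_add' := fun u u' => huniq _ _ fun v => by simp [inner_add_left, hb']
      map_smul' := fun z u => huniq _ _ fun v => by simp [inner_smul_left, hb'] }
  have hb : ∀ u v : D, inner ℂ (b u) (v : Completion D) = (starRingEnd ℂ) (a u v) := hb'
  have hba : ∀ u v : D, inner ℂ (v : Completion D) (b u) = a u v := fun u v => by
    rw [← inner_conj_symm, hb, Complex.conj_conj]
  have hbn : ∀ u, ‖b u‖ ≤ M * ‖u‖ := by
    intro u
    have h1 : ∀ x : Completion D, ‖inner ℂ (b u) x‖ ≤ M * ‖u‖ * ‖x‖ := by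
      intro x
      induction x using Completion.induction_on with
      | hp => exact isClosed_le (by fun_prop) (by fun_prop)
      | ih v => rw [hb, Completion.norm_coe, RCLike.norm_conj]; exact hM u v
    have h2 := h1 (b u)
    rw [inner_self_eq_norm_sq_to_K] at h2
    have h3 : ‖b u‖ * ‖b u‖ ≤ M * ‖u‖ * ‖b u‖ := by
      simpa [sq] using h2
    rcases (norm_nonneg (b u)).eq_or_lt with h | h
    · rw [← h]
      by_contra! hneg
      rcases (norm_nonneg u).eq_or_lt with h0 | h0
      · rw [← h0, mul_zero] at hneg
        exact lt_irrefl _ hneg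
      · have := (norm_nonneg _).trans (hM u u)
        nlinarith
    · exact le_of_mul_le_mul_right h3 h
  have hcoer : ∀ u, c * ‖u‖ ≤ ‖b u‖ := by
    intro u
    have h1 := hac u
    rw [← hba] at h1
    have h2 : (inner ℂ (u : Completion D) (b u)).re ≤ ‖(u : Completion D)‖ * ‖b u‖ :=
      re_inner_le_norm (𝕜 := ℂ) _ _
    rw [Completion.norm_coe] at h2
    rcases (norm_nonneg u).eq_or_lt with h | h
    · rw [← h, mul_zero]; exact norm_nonneg _
    · nlinarith
  obtain ⟨r, hr⟩ := exists_completion_inner_eq g hg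
  have hr' : ∀ v : D, inner ℂ (v : Completion D) r = (starRingEnd ℂ) (g v) := fun v => by
    rw [← inner_conj_symm, hr]
  -- If `x` is orthogonal to the range and `uₖ → x`, then `a(uₖ,uₖ) = (uₖ - x, b uₖ)`. Coercivity
  -- turns this into `c‖uₖ‖ ≤ M‖uₖ - x‖ → 0`, so `x = 0`.
  have hdense : (LinearMap.range b).topologicalClosure = ⊤ := by
    rw [Submodule.topologicalClosure_eq_top_iff, Submodule.eq_bot_iff]
    intro x hx
    obtain ⟨u, hu⟩ : ∃ u : ℕ → D, Tendsto (fun k => (u k : Completion D)) atTop (𝓝 x) := by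
      obtain ⟨y, hy, hyx⟩ := mem_closure_iff_seq_limit.1 (Completion.denseRange_coe (α := D) x)
      choose u hu using hy
      exact ⟨u, by simpa [hu] using hyx⟩
    have h1 : ∀ k, c * ‖u k‖ ≤ M * ‖(u k : Completion D) - x‖ := by
      intro k
      have h2 : inner ℂ (b (u k)) x = 0 :=
        (Submodule.mem_orthogonal _ _).1 hx _ (LinearMap.mem_range_self _ _)
      have h3 : a (u k) (u k) = inner ℂ ((u k : Completion D) - x) (b (u k)) := by
        rw [inner_sub_left, hba, ← inner_conj_symm x, h2, map_zero, sub_zero]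
      have h4 := hac (u k)
      have h5 : (a (u k) (u k)).re ≤ ‖(u k : Completion D) - x‖ * ‖b (u k)‖ := by
        rw [h3]; exact re_inner_le_norm (𝕜 := ℂ) _ _
      have h6 := hbn (u k)
      rcases (norm_nonneg (u k)).eq_or_lt with h | h
      · rw [← h] at h6 ⊢
        rw [mul_zero]
        by_contra! hneg
        -- The sign of `M` is not prescribed. A negative `M` would force the seminorm of `D` to
        -- vanish identically, and with it the completion, contrary to `x ≠ 0`.
        have hM0 : M < 0 := by
          by_contra! h0
          exact absurd (mul_nonneg h0 (norm_nonneg ((u k : Completion D) - x))) (not_le.2 hneg)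
        have hx0 : x ≠ 0 := by
          rintro rfl
          rw [sub_zero, Completion.norm_coe, ← h, mul_zero] at hneg
          exact lt_irrefl _ hneg
        have : ∀ v : D, ‖v‖ = 0 := by
          intro v
          have := (norm_nonneg _).trans (hbn v)
          nlinarith [norm_nonneg v]
        refine hx0 (tendsto_nhds_unique hu ?_)
        refine squeeze_zero_norm (fun k => ?_) tendsto_const_nhds
        rw [Completion.norm_coe, this]
      · have := mul_le_mul_of_nonneg_left h6 (norm_nonneg ((u k : Completion D) - x))
        nlinarith
    have h2 : Tendsto (fun k => M * ‖(u k : Completion D) - x‖) atTop (𝓝 0) := by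
      simpa using ((hu.sub_const x).norm).const_mul M
    have h3 : Tendsto (fun k => c * ‖(u k : Completion D)‖) atTop (𝓝 (c * ‖x‖)) :=
      hu.norm.const_mul c
    have h4 : c * ‖x‖ ≤ 0 := le_of_tendsto_of_tendsto h3 h2
      (Eventually.of_forall fun k => by simpa using h1 k)
    exact norm_le_zero_iff.1 (nonpos_of_mul_nonpos_right h4 hc)
  obtain ⟨u, hu⟩ : ∃ u : ℕ → D, Tendsto (fun k => b (u k)) atTop (𝓝 r) := by
    have : r ∈ (LinearMap.range b).topologicalClosure := hdense ▸ Submodule.mem_top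
    obtain ⟨y, hy, hyr⟩ := mem_closure_iff_seq_limit.1 this
    choose u hu using hy
    exact ⟨u, by simpa [hu] using hyr⟩
  -- By `hcoer`, convergence of `b uₖ` to the representative `r` of `g` makes `uₖ` Cauchy. The error
  -- is `(vₖ, b uₖ - r)`, which tends to `0` as Cauchy sequences are bounded.
  refine ⟨u, ?_, fun v hv => ?_⟩
  · rw [cauchySeq_iff_tendsto_dist_atTop_0]
    have h1 := (cauchySeq_iff_tendsto_dist_atTop_0.1 hu.cauchySeq).const_mul c⁻¹
    rw [mul_zero] at h1
    refine squeeze_zero (fun _ => dist_nonneg) (fun p => ?_) h1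
    rw [dist_eq_norm, dist_eq_norm, ← map_sub, le_inv_mul_iff₀ hc]
    exact hcoer _
  · obtain ⟨R, hR⟩ := hv.norm_bddAbove
    have h1 : Tendsto (fun k => R * ‖b (u k) - r‖) atTop (𝓝 0) := by
      simpa using ((hu.sub_const r).norm).const_mul R
    refine squeeze_zero_norm (fun k => ?_) h1
    rw [← hba, ← hr', ← inner_sub_right]
    refine (norm_inner_le_norm _ _).trans ?_
    rw [Completion.norm_coe]
    exact mul_le_mul_of_nonneg_right (hR ⟨k, rfl⟩) (norm_nonneg _)

variable {H : Type*} [NormedAddCommGroup H] [InnerProductSpace ℂ H]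
  (t : D →ₗ[ℂ] D →ₛₗ[starRingEnd ℂ] ℂ) (j : D →ₗ[ℂ] H)

/-- The graph of the operator associated with the form `t` along `j`, in terms of Cauchy
sequences. -/
def FormRel (φ ψ : H) : Prop :=
  ∃ u : ℕ → D, (CauchySeq u ∧ Tendsto (fun k => j (u k)) atTop (𝓝 φ)) ∧
    ∀ (v : ℕ → D) (χ : H), CauchySeq v ∧ Tendsto (fun k => j (v k)) atTop (𝓝 χ) →
      Tendsto (fun k => t (u k) (v k)) atTop (𝓝 (inner ℂ χ ψ))

/-- `t` is an accretive bounded form, whose real part together with `j` gives the norm of `D`. -/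
structure IsFormAlong (t : D →ₗ[ℂ] D →ₛₗ[starRingEnd ℂ] ℂ) (j : D →ₗ[ℂ] H) : Prop where
  bound : ∃ M : ℝ, ∀ u v, ‖t u v‖ ≤ M * ‖u‖ * ‖v‖
  nonneg : ∀ u, 0 ≤ (t u u).re
  normSq : ∀ u, ‖u‖ ^ 2 = (t u u).re + ‖j u‖ ^ 2

variable {t j}

namespace IsFormAlong

theorem norm_le (h : IsFormAlong t j) (u : D) : ‖j u‖ ≤ ‖u‖ := by
  refine abs_le_of_sq_le_sq' ?_ (norm_nonneg _) |>.2
  rw [h.normSq]; linarith [h.nonneg u]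

theorem rel_sub {φ ψ φ' ψ' : H} (h₁ : FormRel t j φ ψ)
    (h₂ : FormRel t j φ' ψ') : FormRel t j (φ - φ') (ψ - ψ') := by
  obtain ⟨u, ⟨hu, hju⟩, h⟩ := h₁
  obtain ⟨u', ⟨hu', hju'⟩, h'⟩ := h₂
  refine ⟨fun k => u k - u' k, ⟨?_, by simpa using hju.sub hju'⟩, fun v χ hv => ?_⟩
  · simp only [sub_eq_add_neg]
    exact hu.add hu'.neg
  · simpa [inner_sub_right] using (h v χ hv).sub (h' v χ hv)

theorem rel_smul {φ ψ : H} (c : ℂ) (h : FormRel t j φ ψ) : FormRel t j (c • φ) (c • ψ) := by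
  obtain ⟨u, ⟨hu, hju⟩, h⟩ := h
  refine ⟨fun k => c • u k, ⟨?_, by simpa using hju.const_smul c⟩, fun v χ hv => ?_⟩
  · rw [cauchySeq_iff_tendsto_dist_atTop_0] at hu ⊢
    simpa [dist_smul₀] using hu.const_mul ‖c‖
  · simpa [inner_smul_right] using (h v χ hv).const_mul c

theorem rel_accretive (ht : IsFormAlong t j) {φ ψ : H} (h : FormRel t j φ ψ) :
    0 ≤ (inner ℂ φ ψ).re := by
  obtain ⟨u, hu, h⟩ := h
  exact ge_of_tendsto ((Complex.continuous_re.tendsto _).comp (h u φ hu))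
    (Eventually.of_forall fun k => ht.nonneg (u k))

/-- Testing `u` with itself gives `Re t(uₖ,uₖ) → Re(0, ψ) = 0`; with `j uₖ → 0` this means `‖uₖ‖ →
0`. Hence `(j v, ψ) = lim t(uₖ, v) = 0` for all `v`, and density of the range finishes. -/
theorem rel_single (ht : IsFormAlong t j) (hj : DenseRange j) {ψ : H} (h : FormRel t j 0 ψ) :
    ψ = 0 := by
  obtain ⟨u, hu, h⟩ := h
  obtain ⟨M, hM⟩ := ht.bound
  have h1 : Tendsto (fun k => ‖u k‖ ^ 2) atTop (𝓝 0) := by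
    have h2 := ((Complex.continuous_re.tendsto _).comp (h u 0 hu)).add (hu.2.norm.pow 2)
    simpa [ht.normSq] using h2
  have h2 : Tendsto (fun k => ‖u k‖) atTop (𝓝 0) := by
    simpa using h1.sqrt
  refine ext_inner_left ℂ fun χ => ?_
  rw [inner_zero_right]
  refine congrFun (Continuous.ext_on hj (f := fun χ => inner ℂ χ ψ) (g := fun _ => 0)
    (by fun_prop) continuous_const ?_) χ
  rintro _ ⟨v, rfl⟩
  refine tendsto_nhds_unique (h (fun _ => v) (j v) ⟨cauchySeq_const v, tendsto_const_nhds⟩) ?_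
  refine squeeze_zero_norm (fun k => hM (u k) v) ?_
  simpa using (h2.const_mul M).mul_const ‖v‖

theorem rel_range [CompleteSpace H] (ht : IsFormAlong t j) {ε : ℝ} (hε : 0 < ε) (f : H) :
    ∃ φ, FormRel t j φ (ε⁻¹ • (f - φ)) := by
  obtain ⟨M, hM⟩ := ht.bound
  -- The weak form of `φ + εAφ = f`. It is coercive with constant `min ε 1`, since `‖u‖² = Re t(u,u)
  -- + ‖ju‖²`.
  let a : D →ₗ[ℂ] D →ₛₗ[starRingEnd ℂ] ℂ := LinearMap.mk₂'ₛₗ (RingHom.id ℂ) (starRingEnd ℂ)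
    (fun u v => (ε : ℂ) * t u v + inner ℂ (j v) (j u))
    (fun u u' v => by simp; ring)
    (fun c u v => by simp; ring)
    (fun u v v' => by simp; ring)
    (fun c u v => by simp; ring)
  have ha : ∀ u v, a u v = (ε : ℂ) * t u v + inner ℂ (j v) (j u) := fun u v => rfl
  let g : D →ₗ[ℂ] ℂ := ⟨⟨fun v => inner ℂ f (j v), by simp⟩, by simp⟩
  have hg : ∀ v, (starRingEnd ℂ) (g v) = inner ℂ (j v) f := fun v => inner_conj_symm _ _
  obtain ⟨u, hu, h⟩ := exists_cauchySeq_solution a (M := ε * M + 1) (c := min ε 1)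
    (fun u v => by
      rw [ha]
      refine (norm_add_le _ _).trans ?_
      rw [norm_mul, Complex.norm_real, Real.norm_of_nonneg hε.le]
      have h1 := mul_le_mul_of_nonneg_left (hM u v) hε.le
      have h2 := (norm_inner_le_norm (𝕜 := ℂ) (j v) (j u)).trans
        (mul_le_mul (ht.norm_le v) (ht.norm_le u) (norm_nonneg _) (norm_nonneg _))
      linarith)
    (lt_min hε one_pos)
    (fun u => by
      rw [ha, Complex.add_re, Complex.re_ofReal_mul, re_inner_self_eq, ht.normSq, mul_add]
      refine add_le_add ?_ ?_
      · exact mul_le_mul_of_nonneg_right (min_le_left _ _) (ht.nonneg u)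
      · simpa using mul_le_mul_of_nonneg_right (min_le_right ε 1) (sq_nonneg ‖j u‖))
    g (C := ‖f‖) (fun v => (norm_inner_le_norm _ _).trans
      (mul_le_mul_of_nonneg_left (ht.norm_le v) (norm_nonneg _)))
  have hju : CauchySeq fun k => j (u k) := by
    rw [cauchySeq_iff_tendsto_dist_atTop_0] at hu ⊢
    refine squeeze_zero (fun _ => dist_nonneg) (fun p => ?_) hu
    rw [dist_eq_norm, dist_eq_norm, ← map_sub]
    exact ht.norm_le _
  obtain ⟨φ, hφ⟩ := cauchySeq_tendsto_of_complete hju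
  refine ⟨φ, u, ⟨hu, hφ⟩, fun v χ hv => ?_⟩
  have h1 := (((h v hv.1).add (hv.2.inner (𝕜 := ℂ) (tendsto_const_nhds (x := f)))).sub
    (hv.2.inner (𝕜 := ℂ) hφ)).const_mul ((ε : ℂ)⁻¹)
  have hε' : (ε : ℂ) ≠ 0 := by exact_mod_cast hε.ne'
  convert h1 using 2 with k
  · rw [ha, hg]
    field_simp
    ring
  · rw [zero_add, ← inner_sub_right, ← inner_smul_right, ← Complex.ofReal_inv, Complex.coe_smul]

theorem isMAccretive [CompleteSpace H] (ht : IsFormAlong t j) (hj : DenseRange j) :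
    IsMAccretive (FormRel t j) where
  sub h h' := rel_sub h h'
  smul c h := rel_smul c h
  accretive h := ht.rel_accretive h
  range _ hε f := ht.rel_range hε f
  single h := ht.rel_single hj h

/-- If `F` is a bounded nonlinear map with `0 ≤ Re t(u, F u)` that acts as `Φ` on `H`, then
`0 ≤ Re (A φ, Φ φ)`. -/
theorem re_inner_nonneg (ht : IsFormAlong t j) {F : D → D} {C : ℝ}
    (hF : ∀ u, ‖F u‖ ≤ C * ‖u‖) (htF : ∀ u, 0 ≤ (t u (F u)).re) {Φ : H → H}
    (hΦ : Continuous Φ) (hjF : ∀ u, j (F u) = Φ (j u)) {φ ψ : H} (h : FormRel t j φ ψ) :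
    0 ≤ (inner ℂ (Φ φ) ψ).re := by
  obtain ⟨u, hu, h⟩ := h
  obtain ⟨M, hM⟩ := ht.bound
  obtain ⟨R, hR⟩ := hu.1.norm_bddAbove
  obtain ⟨b, hb0, hb, hb'⟩ := cauchySeq_iff_le_tendsto_0.1 hu.1
  -- As `F` is nonlinear and only bounded, `F uₖ` need not be Cauchy. So `k` is frozen and the
  -- constant sequence `F uₖ` is the test element; replacing `t(u_l, F uₖ)` by `t(uₖ, F uₖ)` costs
  -- at most a multiple of `b k → 0`.
  have h1 : ∀ k, -(|M| * (|C| * R) * b k) ≤ (inner ℂ (Φ (j (u k))) ψ).re := by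
    intro k
    have h2 := h (fun _ => F (u k)) (j (F (u k))) ⟨cauchySeq_const _, tendsto_const_nhds⟩
    rw [hjF] at h2
    refine ge_of_tendsto ((Complex.continuous_re.tendsto _).comp h2) ?_
    filter_upwards [eventually_ge_atTop k] with l hl
    have h3 : t (u l) (F (u k)) = t (u k) (F (u k)) + t (u l - u k) (F (u k)) := by simp
    have h4 : ‖t (u l - u k) (F (u k))‖ ≤ |M| * (|C| * R) * b k := by
      have h5 : ‖u l - u k‖ ≤ b k := by
        rw [← dist_eq_norm]; exact hb l k k hl le_rfl
      have h6 : ‖F (u k)‖ ≤ |C| * R := (hF _).trans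
        (mul_le_mul (le_abs_self C) (hR ⟨k, rfl⟩) (norm_nonneg _) (abs_nonneg _))
      calc _ ≤ M * ‖u l - u k‖ * ‖F (u k)‖ := hM _ _
        _ ≤ |M| * ‖u l - u k‖ * ‖F (u k)‖ := by gcongr; exact le_abs_self M
        _ ≤ |M| * b k * (|C| * R) := by
          refine mul_le_mul ?_ h6 (norm_nonneg _) (mul_nonneg (abs_nonneg _) (hb0 k))
          exact mul_le_mul_of_nonneg_left h5 (abs_nonneg _)
        _ = _ := by ring
    have h7 := (abs_le.1 (Complex.abs_re_le_norm (t (u l - u k) (F (u k))))).1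
    have h8 := htF (u k)
    simp only [Function.comp_apply, h3, Complex.add_re]
    linarith
  have h2 : Tendsto (fun k => (inner ℂ (Φ (j (u k))) ψ).re) atTop (𝓝 (inner ℂ (Φ φ) ψ).re) :=
    (Complex.continuous_re.tendsto _).comp
      (((hΦ.tendsto φ).comp hu.2).inner tendsto_const_nhds)
  refine le_of_tendsto_of_tendsto ?_ h2 (Eventually.of_forall h1)
  simpa using (hb'.const_mul (|M| * (|C| * R))).neg

/-- The functional `p` need not dominate `‖u‖²`: it controls `Re t(u,u)`, while convergence of `j
uₖ` supplies the remaining `‖ju‖²`. -/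
theorem cauchySeq_iff (ht : IsFormAlong t j) {p : D → ℝ} {C : ℝ} (hC : 0 ≤ C)
    (hp : ∀ u, p u ≤ C * ‖u‖ ^ 2) (hp' : ∀ u, (t u u).re ≤ C * p u) {u : ℕ → D} {φ : H}
    (hju : Tendsto (fun k => j (u k)) atTop (𝓝 φ)) :
    CauchySeq u ↔ ∀ ε : ℝ, 0 < ε → ∃ N, ∀ k ≥ N, ∀ l ≥ N, p (u k - u l) < ε := by
  constructor
  · intro hu ε hε
    obtain ⟨N, hN⟩ := Metric.cauchySeq_iff.1 hu (√(ε / (C + 1))) (by positivity)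
    refine ⟨N, fun k hk l hl => (hp _).trans_lt ?_⟩
    have h1 := hN k hk l hl
    rw [dist_eq_norm, Real.lt_sqrt (norm_nonneg _), lt_div_iff₀ (by positivity)] at h1
    nlinarith [sq_nonneg ‖u k - u l‖]
  · intro h
    rw [Metric.cauchySeq_iff]
    intro ε hε
    obtain ⟨N, hN⟩ := h (ε ^ 2 / (2 * (C + 1))) (by positivity)
    obtain ⟨N', hN'⟩ := Metric.cauchySeq_iff.1 hju.cauchySeq (ε / 2) (by positivity)
    refine ⟨max N N', fun k hk l hl => ?_⟩
    have h1 := hN k (le_of_max_le_left hk) l (le_of_max_le_left hl)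
    have h2 := hN' k (le_of_max_le_right hk) l (le_of_max_le_right hl)
    rw [dist_eq_norm, ← map_sub] at h2
    rw [dist_eq_norm]
    refine lt_of_pow_lt_pow_left₀ 2 hε.le ?_
    have h3 : ‖j (u k - u l)‖ ^ 2 < (ε / 2) ^ 2 := by gcongr
    have h4 := mul_le_mul_of_nonneg_left h1.le hC
    have h5 : C * (ε ^ 2 / (2 * (C + 1))) ≤ ε ^ 2 / 2 := by
      rw [mul_div_assoc', div_le_div_iff₀ (by positivity) (by positivity)]
      nlinarith [sq_nonneg ε]
    rw [ht.normSq]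
    nlinarith [hp' (u k - u l)]

end IsFormAlong

end PreHilbert

/-- Polarization by scaling: replace `u`, `v` by multiples of norm one. If one of them has seminorm
zero, scaling it up leaves the right side bounded, so `t u v` must vanish. -/
theorem norm_sesquilinear_le {D : Type*} [SeminormedAddCommGroup D] [NormedSpace ℂ D]
    (t : D →ₗ[ℂ] D →ₛₗ[starRingEnd ℂ] ℂ) {M : ℝ}
    (hM : ∀ u v, ‖t u v‖ ≤ M * (‖u‖ ^ 2 + ‖v‖ ^ 2)) (u v : D) :
    ‖t u v‖ ≤ 2 * M * ‖u‖ * ‖v‖ := by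
  have key : ∀ s : ℝ, 0 < s → ∀ r : ℝ, 0 < r →
      s * r * ‖t u v‖ ≤ M * ((s * ‖u‖) ^ 2 + (r * ‖v‖) ^ 2) := by
    intro s hs r hr
    have := hM ((s : ℂ) • u) ((r : ℂ) • v)
    have e : t ((s : ℂ) • u) ((r : ℂ) • v) = ((s * r : ℝ) : ℂ) * t u v := by
      rw [LinearMap.map_smulₛₗ, LinearMap.map_smulₛₗ, LinearMap.smul_apply, Complex.conj_ofReal,
        RingHom.id_apply, smul_eq_mul, smul_eq_mul, Complex.ofReal_mul]
      ring
    rwa [e, norm_mul, norm_smul, norm_smul, Complex.norm_real, Complex.norm_real,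
      Complex.norm_real, Real.norm_of_nonneg hs.le, Real.norm_of_nonneg hr.le,
      Real.norm_of_nonneg (mul_pos hs hr).le] at this
  rcases (norm_nonneg u).eq_or_lt with hu | hu
  · rw [← hu, mul_zero, zero_mul]
    by_contra! hpos
    have h1 := key ((|M| * ‖v‖ ^ 2 + 1) / ‖t u v‖) (by positivity) 1 one_pos
    rw [← hu, mul_one, div_mul_cancel₀ _ hpos.ne'] at h1
    have h2 : M * ‖v‖ ^ 2 ≤ |M| * ‖v‖ ^ 2 := by gcongr; exact le_abs_self M
    norm_num at h1
    linarith
  rcases (norm_nonneg v).eq_or_lt with hv | hv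
  · rw [← hv, mul_zero]
    by_contra! hpos
    have h1 := key 1 one_pos ((|M| * ‖u‖ ^ 2 + 1) / ‖t u v‖) (by positivity)
    rw [← hv, one_mul, div_mul_cancel₀ _ hpos.ne'] at h1
    have h2 : M * ‖u‖ ^ 2 ≤ |M| * ‖u‖ ^ 2 := by gcongr; exact le_abs_self M
    norm_num at h1
    linarith
  have h1 := key ‖u‖⁻¹ (inv_pos.2 hu) ‖v‖⁻¹ (inv_pos.2 hv)
  rw [inv_mul_cancel₀ hu.ne', inv_mul_cancel₀ hv.ne', ← mul_inv,
    inv_mul_le_iff₀ (by positivity)] at h1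
  linarith

/-- The (semi-)inner product given by the real part of an accretive form `t` and by `j`. -/
@[reducible] def formCore {D H : Type*} [AddCommGroup D] [Module ℂ D] [NormedAddCommGroup H]
    [InnerProductSpace ℂ H] (t : D →ₗ[ℂ] D →ₛₗ[starRingEnd ℂ] ℂ) (j : D →ₗ[ℂ] H)
    (hpos : ∀ u, 0 ≤ (t u u).re) : PreInnerProductSpace.Core ℂ D where
  -- The arguments are exchanged because `t` is linear in its first variable and the inner product
  -- in its second.
  inner u v := (t v u + (starRingEnd ℂ) (t u v)) / 2 + inner ℂ (j u) (j v)
  conj_inner_symm u v := by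
    simp only [map_add, map_div₀, inner_conj_symm, Complex.conj_conj, map_ofNat]
    ring
  re_inner_nonneg u := by
    have h1 := hpos u
    have h2 : 0 ≤ (inner ℂ (j u) (j u)).re := inner_self_nonneg (𝕜 := ℂ)
    have h3 : ((t u u + (starRingEnd ℂ) (t u u)) / 2).re = (t u u).re := by simp
    rw [map_add]
    exact add_nonneg (h3.ge.trans' h1) h2
  add_left u v w := by simp; ring
  smul_left u v c := by simp; ring

/-- A nonnegative form `t` and a densely ranged map `j` on a complex vector space `D`, together
with a functional `p` that is equivalent to `Re t(u, u)` up to `‖j u‖²`, define an m-accretive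
operator, and its resolvents satisfy the inequality that belongs to a nonlinear map `F` of `D`. -/
theorem form_isMAccretive {D H : Type*} [AddCommGroup D] [Module ℂ D] [NormedAddCommGroup H]
    [InnerProductSpace ℂ H] [CompleteSpace H] (t : D →ₗ[ℂ] D →ₛₗ[starRingEnd ℂ] ℂ)
    (j : D →ₗ[ℂ] H) (p : D → ℝ) (hpos : ∀ u, 0 ≤ (t u u).re) {M C : ℝ}
    (hM : ∀ u v, ‖t u v‖ ≤
      M * (((t u u).re + ‖j u‖ ^ 2) + ((t v v).re + ‖j v‖ ^ 2)))
    (hj : DenseRange j) (hC : 0 ≤ C) (hp : ∀ u, p u ≤ C * ((t u u).re + ‖j u‖ ^ 2))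
    (hp' : ∀ u, (t u u).re ≤ C * p u) {A : H → H → Prop}
    (hA : ∀ φ ψ, A φ ψ ↔ ∃ u : ℕ → D,
      ((∀ ε : ℝ, 0 < ε → ∃ N, ∀ k ≥ N, ∀ l ≥ N, p (u k - u l) < ε) ∧
        Tendsto (fun k => j (u k)) atTop (𝓝 φ)) ∧
      ∀ (v : ℕ → D) (χ : H), ((∀ ε : ℝ, 0 < ε → ∃ N, ∀ k ≥ N, ∀ l ≥ N, p (v k - v l) < ε) ∧
        Tendsto (fun k => j (v k)) atTop (𝓝 χ)) →
        Tendsto (fun k => t (u k) (v k)) atTop (𝓝 (inner ℂ χ ψ))) :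
    IsMAccretive A ∧ ∀ (F : D → D) (K : ℝ) (Φ : H → H), 0 ≤ K →
      (∀ u, (t (F u) (F u)).re + ‖j (F u)‖ ^ 2 ≤ K ^ 2 * ((t u u).re + ‖j u‖ ^ 2)) →
      (∀ u, 0 ≤ (t u (F u)).re) → Continuous Φ → (∀ u, j (F u) = Φ (j u)) →
      ∀ φ ψ, A φ ψ → 0 ≤ (inner ℂ (Φ φ) ψ).re := by
  let core := formCore t j hpos
  -- Only a seminorm is available in the application: test functions supported away from the closure
  -- of `Ω` have norm zero.
  let : SeminormedAddCommGroup D :=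
    @InnerProductSpace.Core.toSeminormedAddCommGroup ℂ D _ _ _ core
  let : InnerProductSpace ℂ D := InnerProductSpace.ofCore core
  have hq : ∀ u : D, ‖u‖ ^ 2 = (t u u).re + ‖j u‖ ^ 2 := by
    intro u
    have h1 : ‖u‖ ^ 2
        = ((t u u + (starRingEnd ℂ) (t u u)) / 2 + inner ℂ (j u) (j u)).re :=
      (inner_self_eq_norm_sq (𝕜 := ℂ) u).symm
    rw [h1, Complex.add_re, re_inner_self_eq]
    simp
  have ht : IsFormAlong t j :=
    ⟨⟨2 * M, norm_sesquilinear_le t (by simpa only [hq] using hM)⟩, hpos, hq⟩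
  have hAR : A = FormRel t j := by
    ext φ ψ
    have h1 : ∀ (u : ℕ → D) (φ : H),
        ((∀ ε : ℝ, 0 < ε → ∃ N, ∀ k ≥ N, ∀ l ≥ N, p (u k - u l) < ε) ∧
        Tendsto (fun k => j (u k)) atTop (𝓝 φ)) ↔
        (CauchySeq u ∧ Tendsto (fun k => j (u k)) atTop (𝓝 φ)) := fun u φ =>
      and_congr_left fun hju =>
        (ht.cauchySeq_iff hC (by simpa only [hq] using hp) hp' hju).symm
    rw [hA]
    simp only [h1]
    rfl
  subst hAR
  refine ⟨ht.isMAccretive hj, fun F K Φ hK hF htF hΦ hjF φ ψ h => ?_⟩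
  refine ht.re_inner_nonneg (C := K) (fun u => ?_) htF hΦ hjF h
  refine abs_le_of_sq_le_sq' ?_ (by positivity) |>.2
  rw [mul_pow, hq, hq]
  exact hF u

/-! ### Graph coordinates -/

section GraphCoordinates

variable {n : ℕ}

/-- The embedding `y ↦ (y, 0)`. -/
def snocZero (n : ℕ) : RR n →ₗ[ℝ] RR (n + 1) where
  toFun y := WithLp.toLp 2 (Fin.snoc (α := fun _ => ℝ) (fun i => y i) 0)
  map_add' y z := by
    ext i
    refine Fin.lastCases ?_ (fun i => ?_) i <;> simp
  map_smul' c y := by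
    ext i
    refine Fin.lastCases ?_ (fun i => ?_) i <;> simp

theorem snocZero_castSucc (y : RR n) (i : Fin n) : snocZero n y i.castSucc = y i := by
  simp [snocZero]

theorem snocZero_last (y : RR n) : snocZero n y (Fin.last n) = 0 := by
  simp [snocZero]

theorem norm_snocZero (y : RR n) : ‖snocZero n y‖ = ‖y‖ := by
  rw [EuclideanSpace.norm_eq, EuclideanSpace.norm_eq, Fin.sum_univ_castSucc]
  simp [snocZero_castSucc, snocZero_last]

theorem graphMap_eq (Q : RR (n + 1) ≃ₗᵢ[ℝ] RR (n + 1)) (x₀ : RR (n + 1)) (h : RR n → ℝ)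
    (y : RR n) : graphMap Q x₀ h y
      = Q (snocZero n y + h y • EuclideanSpace.single (Fin.last n) 1) + x₀ := by
  rw [graphMap]
  congr 2
  ext i
  refine Fin.lastCases ?_ (fun i => ?_) i
  · simp [snocZero_last]
  · simp [snocZero_castSucc]

/-- The linear part of the inverse of graph coordinates. -/
def graphProjL (Q : RR (n + 1) ≃ₗᵢ[ℝ] RR (n + 1)) : RR (n + 1) →L[ℝ] RR n :=
  (EuclideanSpace.equiv (Fin n) ℝ).symm.toContinuousLinearMap ∘L
    ContinuousLinearMap.pi fun i => (EuclideanSpace.proj (𝕜 := ℝ) (i.castSucc : Fin (n + 1))) ∘L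
      Q.symm.toContinuousLinearEquiv.toContinuousLinearMap

theorem graphProjL_apply (Q : RR (n + 1) ≃ₗᵢ[ℝ] RR (n + 1)) (x : RR (n + 1)) (i : Fin n) :
    graphProjL Q x i = Q.symm x i.castSucc := rfl

namespace GraphCoords

variable {S : Set (RR (n + 1))} (c : GraphCoords S)

/-- The inverse of graph coordinates, extended to an affine map of the whole space. -/
def proj (x : RR (n + 1)) : RR n := graphProjL c.Q (x - c.x₀)

theorem proj_g (y : RR n) : c.proj (c.g y) = y := by
  ext i
  rw [proj, graphProjL_apply, g, graphMap_eq]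
  simp [snocZero_castSucc]

theorem continuous_proj : Continuous c.proj :=
  (graphProjL c.Q).continuous.comp (continuous_id.sub continuous_const)

theorem hasFDerivAt_proj (x : RR (n + 1)) : HasFDerivAt c.proj (graphProjL c.Q) x := by
  have := (graphProjL c.Q).hasFDerivAt.comp x ((hasFDerivAt_id x).sub_const c.x₀)
  exact this

theorem g_proj {x : RR (n + 1)} (hx : x ∈ S ∩ c.V) : c.g (c.proj x) = x := by
  obtain ⟨y, -, rfl⟩ := c.bijOn.surjOn hx
  exact congrArg c.g (c.proj_g y)

theorem proj_mem {x : RR (n + 1)} (hx : x ∈ S ∩ c.V) : c.proj x ∈ c.U := by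
  obtain ⟨y, hy, rfl⟩ := c.bijOn.surjOn hx
  rwa [show graphMap c.Q c.x₀ c.h y = c.g y from rfl, c.proj_g]

theorem lipschitzOn_g : ∃ K : ℝ≥0, LipschitzOnWith K c.g c.U := by
  obtain ⟨K, hK⟩ := c.lipschitz
  refine ⟨1 + K, LipschitzOnWith.of_dist_le_mul fun y hy z hz => ?_⟩
  rw [g, graphMap_eq, graphMap_eq, dist_add_right, c.Q.dist_map, dist_eq_norm]
  have e : snocZero n y + c.h y • EuclideanSpace.single (Fin.last n) (1 : ℝ)
      - (snocZero n z + c.h z • EuclideanSpace.single (Fin.last n) 1)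
      = snocZero n (y - z) + (c.h y - c.h z) • EuclideanSpace.single (Fin.last n) 1 := by
    rw [map_sub, sub_smul]; abel
  rw [e]
  refine (norm_add_le _ _).trans ?_
  rw [norm_snocZero, norm_smul, PiLp.norm_single, norm_one, mul_one, ← dist_eq_norm,
    ← dist_eq_norm]
  have := hK.dist_le_mul y hy z hz
  push_cast
  linarith

theorem continuousOn_g : ContinuousOn c.g c.U :=
  c.lipschitzOn_g.choose_spec.continuousOn

theorem image_g : c.g '' c.U = S ∩ c.V := c.bijOn.image_eq

theorem measurableSet_inter : MeasurableSet (S ∩ c.V) := by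
  rw [← c.image_g]
  exact c.isOpen_U.measurableSet.image_of_continuousOn_injOn c.continuousOn_g c.bijOn.injOn

/-- The chain rule for `proj ∘ g = id`; in particular `g'(y)` is injective. -/
theorem graphProjL_comp_fderiv {y : RR n} (h : DifferentiableAt ℝ c.g y) (ξ : RR n) :
    graphProjL c.Q (fderiv ℝ c.g y ξ) = ξ := by
  have h1 := (c.hasFDerivAt_proj (c.g y)).comp y h.hasFDerivAt
  have h2 : c.proj ∘ c.g = id := funext c.proj_g
  rw [h2] at h1
  exact congrArg (fun L : RR n →L[ℝ] RR n => L ξ) (h1.unique (hasFDerivAt_id y))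

/-- Near `y` one has `g = g' ∘ proj' ∘ g`, where `g'` and `proj'` are the coordinates `c'.g` and
their affine left inverse. The chain rule factors the derivative of `g` through that of `g'`. -/
theorem range_fderiv_le {c c' : GraphCoords S} {y y' : RR n} {x : RR (n + 1)}
    (h : c.IsRegularAt y x) (h' : c'.IsRegularAt y' x) :
    LinearMap.range (fderiv ℝ c.g y : RR n →ₗ[ℝ] RR (n + 1))
      ≤ LinearMap.range (fderiv ℝ c'.g y' : RR n →ₗ[ℝ] RR (n + 1)) := by
  obtain ⟨hy, hyx, hd⟩ := h
  obtain ⟨hy', hyx', hd'⟩ := h'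
  have hxV' : x ∈ S ∩ c'.V := hyx' ▸ c'.bijOn.mapsTo hy'
  have hproj : c'.proj (c.g y) = y' := by rw [hyx, ← hyx', c'.proj_g]
  have heq : c.g =ᶠ[𝓝 y] c'.g ∘ c'.proj ∘ c.g := by
    have h1 : ∀ᶠ z in 𝓝 y, c.g z ∈ c'.V :=
      hd.continuousAt.eventually (c'.isOpen_V.mem_nhds (hyx ▸ hxV'.2))
    filter_upwards [h1, c.isOpen_U.mem_nhds hy] with z hz hzU
    exact (c'.g_proj ⟨(c.bijOn.mapsTo hzU).1, hz⟩).symm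
  have h1 := (c'.hasFDerivAt_proj (c.g y)).comp y hd.hasFDerivAt
  have h2 : HasFDerivAt c'.g (fderiv ℝ c'.g y') ((c'.proj ∘ c.g) y) := by
    rw [Function.comp_apply, hproj]; exact hd'.hasFDerivAt
  have h3 := (h2.comp y h1).congr_of_eventuallyEq heq
  have h4 := hd.hasFDerivAt.unique h3
  rintro _ ⟨ξ, rfl⟩
  exact ⟨_, (congrArg (fun L : RR n →L[ℝ] RR (n + 1) => L ξ) h4).symm⟩

theorem range_fderiv_eq {c c' : GraphCoords S} {y y' : RR n} {x : RR (n + 1)}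
    (h : c.IsRegularAt y x) (h' : c'.IsRegularAt y' x) :
    LinearMap.range (fderiv ℝ c.g y : RR n →ₗ[ℝ] RR (n + 1))
      = LinearMap.range (fderiv ℝ c'.g y' : RR n →ₗ[ℝ] RR (n + 1)) :=
  le_antisymm (range_fderiv_le h h') (range_fderiv_le h' h)

end GraphCoords

/-! ### The surface gradient as a projection -/

/-- Apply a real linear functional to every component of a complex vector. -/
def mapCoord {m : ℕ} (l : ℂ →L[ℝ] ℝ) (z : CC m) : RR m := WithLp.toLp 2 fun i => l (z i)

theorem mapCoord_apply {m : ℕ} (l : ℂ →L[ℝ] ℝ) (z : CC m) (i : Fin m) :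
    mapCoord l z i = l (z i) := rfl

theorem norm_sq_eq_mapCoord {m : ℕ} (z : CC m) :
    ‖z‖ ^ 2 = ‖mapCoord Complex.reCLM z‖ ^ 2 + ‖mapCoord Complex.imCLM z‖ ^ 2 := by
  rw [EuclideanSpace.norm_sq_eq, EuclideanSpace.norm_sq_eq, EuclideanSpace.norm_sq_eq,
    ← Finset.sum_add_distrib]
  refine Finset.sum_congr rfl fun i _ => ?_
  rw [mapCoord_apply, mapCoord_apply, Complex.reCLM_apply, Complex.imCLM_apply, Real.norm_eq_abs,
    Real.norm_eq_abs, sq_abs, sq_abs, ← Complex.normSq_eq_norm_sq, Complex.normSq_apply]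
  ring

theorem sum_smul_single_one {m : ℕ} (ξ : RR m) :
    ∑ i, ξ i • EuclideanSpace.single i (1 : ℝ) = ξ := by
  ext i
  simp [Finset.sum_apply, Pi.single_apply]

theorem ext_mapCoord {m : ℕ} {z w : CC m} (h : ∀ l, mapCoord l z = mapCoord l w) : z = w := by
  ext i
  refine Complex.ext ?_ ?_
  · exact congrArg (fun v : RR m => v i) (h Complex.reCLM)
  · exact congrArg (fun v : RR m => v i) (h Complex.imCLM)

namespace GraphCoords

variable {S : Set (RR (n + 1))} (c : GraphCoords S)

/-- A kernel vector `v` of this Gram matrix satisfies `|∑ vₗ ∂ₗg|² = 0`, and the `∂ₗg` are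
independent because `g'(y)` has a left inverse. -/
theorem metric_isUnit_det {y : RR n} (h : DifferentiableAt ℝ c.g y) :
    IsUnit (c.metric y).det := by
  rw [← Matrix.isUnit_iff_isUnit_det, ← Matrix.mulVec_injective_iff_isUnit]
  refine (injective_iff_map_eq_zero (Matrix.mulVecLin (c.metric y))).2 fun v hv => ?_
  have h1 : ∀ k, inner ℝ (c.partialDeriv y k) (∑ l, v l • c.partialDeriv y l) = 0 := by
    intro k
    rw [inner_sum]
    have := congrFun hv k
    simpa [Matrix.mulVec, dotProduct, metric, inner_smul_right, mul_comm] using this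
  have h2 : ∑ l, v l • c.partialDeriv y l = 0 := by
    rw [← inner_self_eq_zero (𝕜 := ℝ), sum_inner]
    exact Finset.sum_eq_zero fun k _ => by rw [real_inner_smul_left, h1, mul_zero]
  have h3 := congrArg (graphProjL c.Q) h2
  simp only [map_sum, map_smul, partialDeriv, c.graphProjL_comp_fderiv h, map_zero] at h3
  ext i
  have := congrArg (fun w : RR n => w i) h3
  simpa [Finset.sum_apply, Pi.single_apply] using this

/-- The surface gradient at a regular point is the orthogonal projection of the gradient onto the
tangent space. -/
theorem mapCoord_gradient {y : RR n} (h : DifferentiableAt ℝ c.g y) {u : RR (n + 1) → ℂ}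
    (hu : DifferentiableAt ℝ u (c.g y)) (l : ℂ →L[ℝ] ℝ) :
    mapCoord l (c.gradient u y)
      = (LinearMap.range (fderiv ℝ c.g y : RR n →ₗ[ℝ] RR (n + 1))).starProjection
        (mapCoord l (grad u (c.g y))) := by
  have hgrad : ∀ k, l (grad (u ∘ c.g) y k)
      = inner ℝ (c.partialDeriv y k) (mapCoord l (grad u (c.g y))) := by
    intro k
    have h1 : grad (u ∘ c.g) y k = fderiv ℝ u (c.g y) (c.partialDeriv y k) := by
      change fderiv ℝ (u ∘ c.g) y _ = _
      rw [fderiv_comp y hu h]; rfl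
    have h2 := (sum_smul_single_one (c.partialDeriv y k)).symm
    rw [h1, h2, map_sum, map_sum, ← h2, PiLp.inner_apply]
    refine Finset.sum_congr rfl fun i _ => ?_
    rw [map_smul, map_smul, mapCoord_apply]
    simp [grad, mul_comm]
  set a := mapCoord l (grad u (c.g y)) with ha
  have hw : mapCoord l (c.gradient u y)
      = ∑ k, (∑ m, (c.metric y)⁻¹ k m * inner ℝ (c.partialDeriv y m) a) • c.partialDeriv y k := by
    ext i
    rw [mapCoord_apply]
    simp only [gradient, map_sum, Finset.sum_apply, WithLp.ofLp_sum, WithLp.ofLp_smul,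
      Pi.smul_apply, smul_eq_mul, Finset.sum_mul]
    refine Finset.sum_congr rfl fun k _ => Finset.sum_congr rfl fun m _ => ?_
    rw [← hgrad, mul_comm _ ((c.partialDeriv y k i : ℝ) : ℂ)]
    have e : ∀ (r s : ℝ) (z : ℂ), l ((r : ℂ) * ((s : ℂ) * z)) = s * l z * r := by
      intro r s z
      have : (r : ℂ) * ((s : ℂ) * z) = (r * s) • z := by
        rw [Complex.real_smul]; push_cast; ring
      rw [this, map_smul, smul_eq_mul]; ring
    rw [e]
  rw [hw]
  -- The vector lies in the span of the `∂ₖg`. Its difference from `a` is orthogonal to each `∂ⱼg`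
  -- because the inverse metric cancels the metric.
  refine (Submodule.eq_starProjection_of_mem_of_inner_eq_zero ?_ ?_).symm
  · refine Submodule.sum_mem _ fun k _ => Submodule.smul_mem _ _ ?_
    exact ⟨_, rfl⟩
  · rintro _ ⟨ξ, rfl⟩
    have hξ : (fderiv ℝ c.g y : RR n →ₗ[ℝ] RR (n + 1)) ξ = ∑ k, ξ k • c.partialDeriv y k := by
      conv_lhs => rw [← sum_smul_single_one ξ]
      simp [partialDeriv]
    rw [hξ, inner_sum]
    refine Finset.sum_eq_zero fun j _ => ?_
    rw [inner_smul_right, inner_sub_left, sum_inner, sub_eq_zero.2, mul_zero]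
    have h1 : c.metric y * (c.metric y)⁻¹ = 1 := Matrix.mul_nonsing_inv _ (c.metric_isUnit_det h)
    have h3 : ∀ m, ∑ k, (c.metric y)⁻¹ k m * inner ℝ (c.partialDeriv y k) (c.partialDeriv y j)
        = if j = m then 1 else 0 := by
      intro m
      have h4 := congrFun (congrFun h1 j) m
      rw [Matrix.mul_apply, Matrix.one_apply] at h4
      rw [← h4]
      refine Finset.sum_congr rfl fun k _ => ?_
      rw [mul_comm, real_inner_comm]; rfl
    simp only [real_inner_smul_left, Finset.sum_mul]
    rw [Finset.sum_comm]
    have h5 : ∀ m, ∑ k, (c.metric y)⁻¹ k m * inner ℝ (c.partialDeriv y m) a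
        * inner ℝ (c.partialDeriv y k) (c.partialDeriv y j)
        = if j = m then inner ℝ (c.partialDeriv y m) a else 0 := by
      intro m
      have : ∀ k, (c.metric y)⁻¹ k m * inner ℝ (c.partialDeriv y m) a
        * inner ℝ (c.partialDeriv y k) (c.partialDeriv y j)
        = inner ℝ (c.partialDeriv y m) a * ((c.metric y)⁻¹ k m *
          inner ℝ (c.partialDeriv y k) (c.partialDeriv y j)) := fun k => by ring
      simp only [this, ← Finset.mul_sum, h3]
      simp
    simp only [h5]
    simp [real_inner_comm]

theorem gradient_eq_of_isRegularAt {c c' : GraphCoords S} {y y' : RR n} {x : RR (n + 1)}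
    (h : c.IsRegularAt y x) (h' : c'.IsRegularAt y' x) {u : RR (n + 1) → ℂ}
    (hu : DifferentiableAt ℝ u x) : c.gradient u y = c'.gradient u y' := by
  refine ext_mapCoord fun l => ?_
  rw [c.mapCoord_gradient h.2.2 (by rwa [h.2.1]), c'.mapCoord_gradient h'.2.2 (by rwa [h'.2.1]),
    h.2.1, h'.2.1]
  simp only [range_fderiv_eq h h']

theorem measurable_gradient (u : RR (n + 1) → ℂ) : Measurable (c.gradient u) := by
  have hg : Measurable (fderiv ℝ c.g) := measurable_fderiv ℝ c.g
  have h1 : ∀ k i, Measurable fun y => c.partialDeriv y k i := fun k i => by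
    have : Continuous fun L : RR n →L[ℝ] RR (n + 1) => L (EuclideanSpace.single k 1) i := by
      fun_prop
    exact this.measurable.comp hg
  have h2 : ∀ k l, Measurable fun y => (c.metric y)⁻¹ k l := by
    intro k l
    let G : (RR n →L[ℝ] RR (n + 1)) → Matrix (Fin n) (Fin n) ℝ := fun L =>
      Matrix.of fun k l => inner ℝ (L (EuclideanSpace.single k 1)) (L (EuclideanSpace.single l 1))
    have hG : Continuous G := by
      refine continuous_matrix fun i j => ?_
      change Continuous fun L : RR n →L[ℝ] RR (n + 1) =>
        inner ℝ (L (EuclideanSpace.single i 1)) (L (EuclideanSpace.single j 1))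
      fun_prop
    -- Cramer's rule writes the entry through the determinant and the adjugate, which are continuous
    -- in the derivative. At a singular metric both sides are `0`, so no regularity of `y` is
    -- needed.
    have h3 : (fun y => (c.metric y)⁻¹ k l)
        = fun y => ((G (fderiv ℝ c.g y)).det)⁻¹ * (G (fderiv ℝ c.g y)).adjugate k l := by
      funext y
      rw [Matrix.inv_def, Ring.inverse_eq_inv', Matrix.smul_apply, smul_eq_mul]
      rfl
    rw [h3]
    exact (hG.matrix_det.measurable.comp hg).inv.mul
      ((hG.matrix_adjugate.matrix_elem k l).measurable.comp hg)
  have h4 : ∀ l, Measurable fun y => grad (u ∘ c.g) y l := fun l => by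
    have : Continuous fun L : RR n →L[ℝ] ℂ => L (EuclideanSpace.single l 1) := by fun_prop
    exact this.measurable.comp (measurable_fderiv ℝ (u ∘ c.g))
  have h5 : Measurable fun y => fun i : Fin (n + 1) => ∑ k, ∑ l,
      (((c.metric y)⁻¹ k l : ℝ) : ℂ) * grad (u ∘ c.g) y l * ((c.partialDeriv y k i : ℝ) : ℂ) := by
    refine measurable_pi_lambda _ fun i => Finset.measurable_sum _ fun k _ =>
      Finset.measurable_sum _ fun l _ => ?_
    exact ((Complex.measurable_ofReal.comp (h2 k l)).mul (h4 l)).mul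
      (Complex.measurable_ofReal.comp (h1 k i))
  exact (WithLp.measurable_toLp 2 (Fin (n + 1) → ℂ)).comp h5

end GraphCoords

end GraphCoordinates

/-! ### Hypersurfaces as measurable sets -/

section Hypersurfaces

variable {n : ℕ} {S : Set (RR (n + 1))}

theorem IsLipschitzGraphHypersurface.exists_countable (hS : IsLipschitzGraphHypersurface S) :
    ∃ (ι : Type) (_ : Countable ι) (c : ι → GraphCoords S), S = ⋃ i, S ∩ (c i).V := by
  choose c hc using fun x : S => hS x x.2
  obtain ⟨T, hT, hTU⟩ := TopologicalSpace.isOpen_iUnion_countable (fun x : S => (c x).V)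
    (fun x => (c x).isOpen_V)
  obtain hemp | ⟨⟨x₀⟩⟩ := isEmpty_or_nonempty S
  · refine ⟨Empty, inferInstance, Empty.elim, ?_⟩
    simpa using hemp
  · obtain hTe | hTn := T.eq_empty_or_nonempty
    · have h1 : (x₀ : RR (n + 1)) ∈ ⋃ x : S, (c x).V := Set.mem_iUnion.2 ⟨x₀, hc _⟩
      rw [← hTU, hTe] at h1
      simp at h1
    · obtain ⟨f, rfl⟩ := hT.exists_eq_range hTn
      refine ⟨ℕ, inferInstance, fun k => c (f k), ?_⟩
      rw [← Set.inter_iUnion]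
      refine (Set.inter_eq_left.2 fun x hx => ?_).symm
      have h1 : x ∈ ⋃ x : S, (c x).V := Set.mem_iUnion.2 ⟨⟨x, hx⟩, hc ⟨x, hx⟩⟩
      rw [← hTU] at h1
      simpa using h1

theorem IsLipschitzGraphHypersurface.measurableSet (hS : IsLipschitzGraphHypersurface S) :
    MeasurableSet S := by
  obtain ⟨ι, _, c, hc⟩ := hS.exists_countable
  rw [hc]
  exact MeasurableSet.iUnion fun i => (c i).measurableSet_inter

theorem euclideanHausdorffMeasure_cube_lt_top :
    Measure.euclideanHausdorffMeasure n {z : RR (n + 1) |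
      (∀ i : Fin n, z i.castSucc ∈ Set.Ioo (0 : ℝ) 1) ∧ z (Fin.last n) = 0} < ⊤ := by
  have hiso : Isometry (snocZero n) := AddMonoidHomClass.isometry_of_norm _ norm_snocZero
  refine (measure_mono (t := snocZero n '' Metric.closedBall 0 √n) ?_).trans_lt ?_
  · rintro z ⟨h1, h2⟩
    refine ⟨WithLp.toLp 2 fun i => z i.castSucc, ?_, ?_⟩
    · rw [mem_closedBall_zero_iff, EuclideanSpace.norm_eq]
      refine Real.sqrt_le_sqrt ?_
      calc ∑ i : Fin n, ‖z i.castSucc‖ ^ 2 ≤ ∑ i : Fin n, (1 : ℝ) := by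
            refine Finset.sum_le_sum fun i _ => ?_
            rw [Real.norm_of_nonneg (h1 i).1.le]
            exact pow_le_one₀ (h1 i).1.le (h1 i).2.le
        _ = n := by simp
    · ext i
      refine Fin.lastCases ?_ (fun i => ?_) i
      · rw [snocZero_last, h2]
      · rw [snocZero_castSucc]
  · rw [hiso.euclideanHausdorffMeasure_image, EuclideanSpace.euclideanHausdorffMeasure_eq_volume]
    exact measure_closedBall_lt_top

/-- The inverse of the flattening chart is Lipschitz, so `M ∩ V` has Hausdorff measure at most a
constant times that of the unit cube. -/
theorem IsLipschitzSubmanifold.finiteAtFilter {M : Set (RR (n + 1))}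
    (hM : IsLipschitzSubmanifold M) {x : RR (n + 1)} (hx : x ∈ M) :
    (Measure.euclideanHausdorffMeasure n : Measure (RR (n + 1))).FiniteAtFilter (𝓝[M] x) := by
  obtain ⟨V, φ, hV, hxV, -, ⟨K, hK⟩, hφ⟩ := hM x hx
  refine ⟨M ∩ V, inter_mem self_mem_nhdsWithin (mem_nhdsWithin_of_mem_nhds (hV.mem_nhds hxV)), ?_⟩
  have h1 := hK.le_hausdorffMeasure_image (d := n) (by positivity) (Subtype.val ⁻¹' M)
  have h2 : (fun z : V => φ z) '' (Subtype.val ⁻¹' M) = φ '' (M ∩ V) := by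
    ext z; simp [and_comm]
  rw [h2, hφ, ← isometry_subtype_coe.hausdorffMeasure_image (Or.inl (by positivity)),
    Subtype.image_preimage_coe, Set.inter_comm V M] at h1
  have h3 := euclideanHausdorffMeasure_cube_lt_top (n := n)
  rw [Measure.euclideanHausdorffMeasure_def, Measure.smul_apply, ENNReal.smul_def, smul_eq_mul]
    at h3 ⊢
  have h0 := Measure.addHaarScalarFactor_volume_hausdorffMeasure_ne_zero n
  have h4 := ENNReal.lt_top_of_mul_ne_top_right h3.ne (by exact_mod_cast h0)
  exact ENNReal.mul_lt_top ENNReal.coe_lt_top (h1.trans_lt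
    (ENNReal.mul_lt_top (ENNReal.rpow_lt_top_of_nonneg (by positivity) ENNReal.coe_ne_top) h4))

theorem euclideanHausdorffMeasure_lt_top_of_closure {M : Set (RR (n + 1))}
    (hM : IsLipschitzSubmanifold M) (hSM : closure S ⊆ M) (hb : Bornology.IsBounded S) :
    Measure.euclideanHausdorffMeasure n S < ⊤ := by
  refine (measure_mono subset_closure).trans_lt ?_
  refine hb.isCompact_closure.measure_lt_top_of_nhdsWithin fun x hx => ?_
  exact (hM.finiteAtFilter (hSM hx)).filter_mono (nhdsWithin_mono x hSM)

/-- Finite measure in dimension `n` forces measure zero in dimension `n + 1`, where the Hausdorff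
measure is Lebesgue measure. -/
theorem volume_eq_zero_of_euclideanHausdorffMeasure_lt_top
    (h : Measure.euclideanHausdorffMeasure n S < ⊤) : volume S = 0 := by
  rw [← EuclideanSpace.euclideanHausdorffMeasure_eq_volume]
  exact (Measure.euclideanHausdorffMeasure_zero_or_top (Nat.lt_succ_self n) S).resolve_right h.ne

/-! ### The surface gradient -/

theorem surfaceGrad_eq {c : GraphCoords S} {y : RR n} {x : RR (n + 1)} (h : c.IsRegularAt y x)
    {u : RR (n + 1) → ℂ} (hu : DifferentiableAt ℝ u x) : surfaceGrad S u x = c.gradient u y := by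
  have hx : ∃ p : GraphCoords S × RR n, p.1.IsRegularAt p.2 x := ⟨(c, y), h⟩
  rw [surfaceGrad, dif_pos hx]
  exact GraphCoords.gradient_eq_of_isRegularAt hx.choose_spec h hu

theorem norm_surfaceGrad_le {u : RR (n + 1) → ℂ} {x : RR (n + 1)} (hu : DifferentiableAt ℝ u x) :
    ‖surfaceGrad S u x‖ ≤ ‖grad u x‖ := by
  by_cases hx : ∃ p : GraphCoords S × RR n, p.1.IsRegularAt p.2 x
  · obtain ⟨⟨c, y⟩, h⟩ := hx
    rw [surfaceGrad_eq h hu]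
    refine abs_le_of_sq_le_sq' ?_ (norm_nonneg _) |>.2
    rw [norm_sq_eq_mapCoord, norm_sq_eq_mapCoord (grad u x),
      c.mapCoord_gradient h.2.2 (by rwa [h.2.1]), c.mapCoord_gradient h.2.2 (by rwa [h.2.1]), h.2.1]
    gcongr <;> exact Submodule.norm_starProjection_apply_le _ _
  · rw [surfaceGrad, dif_neg hx, norm_zero]
    exact norm_nonneg _

/-- Ellipticity on the surface holds only for real tangent vectors; this makes it applicable to
every real component of the surface gradient. The alternative `0` covers nonregular points, where
`tangentSpace` is empty. -/
theorem mapCoord_surfaceGrad_mem {u : RR (n + 1) → ℂ} {x : RR (n + 1)}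
    (hu : DifferentiableAt ℝ u x) (l : ℂ →L[ℝ] ℝ) :
    mapCoord l (surfaceGrad S u x) = 0 ∨ mapCoord l (surfaceGrad S u x) ∈ tangentSpace S x := by
  by_cases hx : ∃ p : GraphCoords S × RR n, p.1.IsRegularAt p.2 x
  · right
    obtain ⟨⟨c, y⟩, h⟩ := hx
    rw [surfaceGrad_eq h hu, c.mapCoord_gradient h.2.2 (by rwa [h.2.1])]
    obtain ⟨ξ, hξ⟩ := Submodule.starProjection_apply_mem
      (LinearMap.range (fderiv ℝ c.g y : RR n →ₗ[ℝ] RR (n + 1))) (mapCoord l (grad u (c.g y)))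
    exact ⟨c, y, h, ξ, hξ.symm⟩
  · left
    rw [surfaceGrad, dif_neg hx]
    ext i
    simp [mapCoord_apply]

theorem grad_comp_apply {m : ℕ} {u : RR m → ℂ} {F : ℂ → ℂ} {x : RR m}
    (hF : DifferentiableAt ℝ F (u x)) (hu : DifferentiableAt ℝ u x) (i : Fin m) :
    grad (F ∘ u) x i = fderiv ℝ F (u x) (grad u x i) := by
  change fderiv ℝ (F ∘ u) x _ = _
  rw [fderiv_comp x hF hu]; rfl

theorem grad_add {m : ℕ} {u v : RR m → ℂ} {x : RR m}
    (hu : DifferentiableAt ℝ u x) (hv : DifferentiableAt ℝ v x) :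
    grad (u + v) x = grad u x + grad v x := by
  ext i
  change fderiv ℝ (u + v) x _ = fderiv ℝ u x _ + fderiv ℝ v x _
  rw [fderiv_add hu hv]; rfl

theorem grad_smul {m : ℕ} {u : RR m → ℂ} {x : RR m} (z : ℂ) (hu : DifferentiableAt ℝ u x) :
    grad (z • u) x = z • grad u x := by
  ext i
  change fderiv ℝ (z • u) x _ = z • fderiv ℝ u x _
  rw [fderiv_const_smul hu]; rfl

theorem surfaceGrad_add {u v : RR (n + 1) → ℂ} {x : RR (n + 1)}
    (hu : DifferentiableAt ℝ u x) (hv : DifferentiableAt ℝ v x) :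
    surfaceGrad S (u + v) x = surfaceGrad S u x + surfaceGrad S v x := by
  by_cases hx : ∃ p : GraphCoords S × RR n, p.1.IsRegularAt p.2 x
  · obtain ⟨⟨c, y⟩, h⟩ := hx
    rw [surfaceGrad_eq h hu, surfaceGrad_eq h hv, surfaceGrad_eq h (hu.add hv)]
    obtain ⟨-, rfl, hd⟩ := h
    ext i
    have e : grad ((u + v) ∘ c.g) y = grad (u ∘ c.g) y + grad (v ∘ c.g) y :=
      grad_add (hu.comp y hd) (hv.comp y hd)
    simp only [GraphCoords.gradient, e, PiLp.add_apply, mul_add, add_mul, Finset.sum_add_distrib]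
  · simp [surfaceGrad, dif_neg hx]

/-- The derivative of `F` is only real linear, but the coefficients in the surface gradient are
real, so it passes through the sum. -/
theorem surfaceGrad_comp_apply {u : RR (n + 1) → ℂ} {F : ℂ → ℂ} {x : RR (n + 1)}
    (hF : DifferentiableAt ℝ F (u x)) (hu : DifferentiableAt ℝ u x) (i : Fin (n + 1)) :
    surfaceGrad S (F ∘ u) x i = fderiv ℝ F (u x) (surfaceGrad S u x i) := by
  by_cases hx : ∃ p : GraphCoords S × RR n, p.1.IsRegularAt p.2 x
  · obtain ⟨⟨c, y⟩, h⟩ := hx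
    rw [surfaceGrad_eq h hu, surfaceGrad_eq h (hF.comp x hu)]
    obtain ⟨-, rfl, hd⟩ := h
    have e : ∀ l, grad ((F ∘ u) ∘ c.g) y l
        = fderiv ℝ F (u (c.g y)) (grad (u ∘ c.g) y l) := fun l =>
      grad_comp_apply (u := u ∘ c.g) hF (hu.comp y hd) l
    have e' : ∀ (a b : ℝ) (z : ℂ), fderiv ℝ F (u (c.g y)) ((a : ℂ) * z * (b : ℂ))
        = (a : ℂ) * fderiv ℝ F (u (c.g y)) z * (b : ℂ) := by
      intro a b z
      have h1 : ∀ w : ℂ, (a : ℂ) * w * (b : ℂ) = (a * b) • w := fun w => by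
        rw [Complex.real_smul]; push_cast; ring
      rw [h1, h1, map_smul]
    simp only [GraphCoords.gradient, e, map_sum, e']
  · simp [surfaceGrad, dif_neg hx]

theorem surfaceGrad_smul {u : RR (n + 1) → ℂ} {x : RR (n + 1)} (z : ℂ)
    (hu : DifferentiableAt ℝ u x) : surfaceGrad S (z • u) x = z • surfaceGrad S u x := by
  ext i
  have h : HasFDerivAt (fun w : ℂ => z • w) (z • ContinuousLinearMap.id ℝ ℂ) (u x) :=
    (hasFDerivAt_id _).const_smul z
  have := surfaceGrad_comp_apply (S := S) h.differentiableAt hu i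
  rw [h.fderiv] at this
  exact this

/-- By Rademacher's theorem `g` is differentiable off a Lebesgue-null subset of `U`, and the
Lipschitz map `g` sends that subset to a Hausdorff-null set. -/
theorem GraphCoords.ae_surfaceGrad_eq (c : GraphCoords S) {u : RR (n + 1) → ℂ}
    (hu : Differentiable ℝ u) :
    ∀ᵐ x ∂(Measure.euclideanHausdorffMeasure n).restrict (S ∩ c.V),
      surfaceGrad S u x = c.gradient u (c.proj x) := by
  obtain ⟨K, hK⟩ := c.lipschitzOn_g
  rw [ae_restrict_iff' c.measurableSet_inter]
  have h1 : volume {y | ¬(y ∈ c.U → DifferentiableWithinAt ℝ c.g c.U y)} = 0 :=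
    hK.ae_differentiableWithinAt_of_mem
  set N := {y | ¬(y ∈ c.U → DifferentiableWithinAt ℝ c.g c.U y)} with hN
  have h2 : Measure.euclideanHausdorffMeasure n (c.g '' N) = 0 := by
    have hNU : N ⊆ c.U := fun y hy => by
      by_contra h; exact hy fun h' => absurd h' h
    have h3 := (hK.mono hNU).hausdorffMeasure_image_le (d := n) (by positivity)
    rw [← EuclideanSpace.euclideanHausdorffMeasure_eq_volume,
      Measure.euclideanHausdorffMeasure_def, Measure.smul_apply, ENNReal.smul_def, smul_eq_mul,
      mul_eq_zero] at h1
    have h0 := Measure.addHaarScalarFactor_volume_hausdorffMeasure_ne_zero n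
    have h4 := h1.resolve_left (by exact_mod_cast h0)
    rw [h4, mul_zero, nonpos_iff_eq_zero] at h3
    rw [Measure.euclideanHausdorffMeasure_def, Measure.smul_apply, h3, smul_zero]
  filter_upwards [compl_mem_ae_iff.2 h2] with x hx hxV
  have h3 : c.proj x ∈ c.U := c.proj_mem hxV
  have h4 : DifferentiableAt ℝ c.g (c.proj x) := by
    by_contra h
    refine hx ⟨c.proj x, fun h' => h ?_, c.g_proj hxV⟩
    exact (h' h3).differentiableAt (c.isOpen_U.mem_nhds h3)
  exact surfaceGrad_eq ⟨h3, c.g_proj hxV, h4⟩ (hu x)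

theorem IsLipschitzGraphHypersurface.aestronglyMeasurable_surfaceGrad
    (hS : IsLipschitzGraphHypersurface S) {u : RR (n + 1) → ℂ} (hu : Differentiable ℝ u) :
    AEStronglyMeasurable (surfaceGrad S u) ((Measure.euclideanHausdorffMeasure n).restrict S) := by
  obtain ⟨ι, _, c, hc⟩ := hS.exists_countable
  have h : AEStronglyMeasurable (surfaceGrad S u)
      ((Measure.euclideanHausdorffMeasure n).restrict (⋃ i, S ∩ (c i).V)) := by
    refine AEStronglyMeasurable.iUnion fun i => ?_
    have h1 : Measurable fun x => (c i).gradient u ((c i).proj x) :=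
      ((c i).measurable_gradient u).comp (c i).continuous_proj.measurable
    exact h1.aestronglyMeasurable.congr (Filter.EventuallyEq.symm ((c i).ae_surfaceGrad_eq hu))
  rwa [← hc] at h

end Hypersurfaces

/-! ### The pairing -/

section Pairing

variable {m : ℕ}

theorem pairing_add_left (M : RR m →L[ℝ] RR m) (z z' w : CC m) :
    pairing M (z + z') w = pairing M z w + pairing M z' w := by
  simp [pairing, mul_add, add_mul, Finset.sum_add_distrib]

theorem pairing_add_right (M : RR m →L[ℝ] RR m) (z w w' : CC m) :
    pairing M z (w + w') = pairing M z w + pairing M z w' := by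
  simp [pairing, mul_add, Finset.sum_add_distrib]

theorem pairing_smul_left (M : RR m →L[ℝ] RR m) (c : ℂ) (z w : CC m) :
    pairing M (c • z) w = c * pairing M z w := by
  simp only [pairing, Finset.mul_sum, PiLp.smul_apply, smul_eq_mul]
  exact Finset.sum_congr rfl fun i _ => Finset.sum_congr rfl fun j _ => by ring

theorem pairing_smul_right (M : RR m →L[ℝ] RR m) (c : ℂ) (z w : CC m) :
    pairing M z (c • w) = (starRingEnd ℂ) c * pairing M z w := by
  simp only [pairing, Finset.mul_sum, PiLp.smul_apply, smul_eq_mul, map_mul]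
  exact Finset.sum_congr rfl fun i _ => Finset.sum_congr rfl fun j _ => by ring

theorem norm_pairing_le (M : RR m →L[ℝ] RR m) (z w : CC m) :
    ‖pairing M z w‖ ≤ m ^ 2 * (‖M‖ * ‖z‖ * ‖w‖) := by
  have h : ∀ i j, ‖((M (EuclideanSpace.single j 1) i : ℝ) : ℂ) * z j * (starRingEnd ℂ) (w i)‖
      ≤ ‖M‖ * ‖z‖ * ‖w‖ := by
    intro i j
    rw [norm_mul, norm_mul, RCLike.norm_conj, Complex.norm_real]
    have h1 : ‖M (EuclideanSpace.single j 1) i‖ ≤ ‖M‖ := by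
      refine (PiLp.norm_apply_le _ i).trans ((M.le_opNorm _).trans ?_)
      simp
    gcongr
    · exact PiLp.norm_apply_le z j
    · exact PiLp.norm_apply_le w i
  refine (norm_sum_le_of_le _ fun i _ => norm_sum_le_of_le _ fun j _ => h i j).trans ?_
  simp [sq, mul_assoc]

theorem inner_map_self_eq (M : RR m →L[ℝ] RR m) (ρ : RR m) :
    inner ℝ (M ρ) ρ = ∑ i, ∑ j, M (EuclideanSpace.single j 1) i * ρ j * ρ i := by
  conv_lhs => rw [← sum_smul_single_one ρ, map_sum]
  rw [sum_smul_single_one, PiLp.inner_apply]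
  refine Finset.sum_congr rfl fun i _ => ?_
  simp only [map_smul, WithLp.ofLp_sum, Finset.sum_apply, PiLp.smul_apply, smul_eq_mul]
  simp only [RCLike.inner_apply, conj_trivial, Finset.mul_sum]
  exact Finset.sum_congr rfl fun j _ => by ring

/-- If `w` arises from `z` by the real linear map `∑ ⟨eₖ,·⟩eₖ`, then `Re (Mz, w̄)` splits into real
quadratic forms `(Mξₖ,ξₖ)` with `ξₖ = ⟨eₖ,z⟩`. Lower bounds for `M` therefore apply without
symmetry. -/
theorem re_pairing_eq_sum {ι : Type*} [Fintype ι] (e : ι → ℂ) (M : RR m →L[ℝ] RR m)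
    {z w : CC m} (hw : ∀ i, w i = ∑ k, (inner ℝ (e k) (z i) : ℝ) • e k) :
    (pairing M z w).re = ∑ k, inner ℝ (M (mapCoord (innerSL ℝ (e k)) z))
      (mapCoord (innerSL ℝ (e k)) z) := by
  simp only [inner_map_self_eq, pairing, Complex.re_sum]
  refine Eq.trans ?_ (Finset.sum_comm.trans (Finset.sum_congr rfl fun i _ =>
    Finset.sum_comm)).symm
  refine Finset.sum_congr rfl fun i _ => ?_
  refine Finset.sum_congr rfl fun j _ => ?_
  rw [hw, map_sum, Finset.mul_sum, Complex.re_sum]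
  refine Finset.sum_congr rfl fun k _ => ?_
  simp only [mapCoord_apply, innerSL_apply_apply]
  rw [Complex.real_smul, map_mul, Complex.conj_ofReal]
  have : ((M (EuclideanSpace.single j 1) i : ℝ) : ℂ) * z j *
      ((inner ℝ (e k) (z i) : ℝ) * (starRingEnd ℂ) (e k))
      = ((M (EuclideanSpace.single j 1) i * inner ℝ (e k) (z i) : ℝ) : ℂ)
        * (z j * (starRingEnd ℂ) (e k)) := by push_cast; ring
  rw [this, Complex.re_ofReal_mul]
  have : (z j * (starRingEnd ℂ) (e k)).re = inner ℝ (e k) (z j) := rfl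
  rw [this]; ring

theorem re_pairing_self (M : RR m →L[ℝ] RR m) (z : CC m) :
    (pairing M z z).re
      = inner ℝ (M (mapCoord Complex.reCLM z)) (mapCoord Complex.reCLM z)
        + inner ℝ (M (mapCoord Complex.imCLM z)) (mapCoord Complex.imCLM z) := by
  have h1 : innerSL ℝ (1 : ℂ) = Complex.reCLM := by
    ext w; simp [Complex.inner]
  have h2 : innerSL ℝ Complex.I = Complex.imCLM := by
    ext w; simp [Complex.inner]
  rw [re_pairing_eq_sum ![1, Complex.I] M (z := z) (w := z) fun i => ?_]
  · simp [h1, h2]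
  · simp [Complex.inner, Complex.re_add_im]

end Pairing

/-! ### Smooth monotone maps of the complex plane -/

/-- `F` is a smooth Lipschitz map with `F 0 = 0`, all of whose derivatives are symmetric, positive
semidefinite and of rank at most one. -/
structure IsSmoothMonotone (F : ℂ → ℂ) (K : ℝ≥0) : Prop where
  contDiff : ContDiff ℝ ∞ F
  map_zero : F 0 = 0
  lipschitz : LipschitzWith K F
  fderiv_eq : ∀ z, ∃ e : ℂ, ∀ w, fderiv ℝ F z w = (inner ℝ e w : ℝ) • e

/-! ### The parts of the form -/

/-- Smooth functions with compact support. -/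
def IsTest {m : ℕ} (u : RR m → ℂ) : Prop := ContDiff ℝ ∞ u ∧ HasCompactSupport u

theorem IsTest.differentiable {m : ℕ} {u : RR m → ℂ} (hu : IsTest u) : Differentiable ℝ u :=
  hu.1.differentiable (by simp)

theorem IsTest.comp {m : ℕ} {u : RR m → ℂ} (hu : IsTest u) {F : ℂ → ℂ} {K : ℝ≥0}
    (hF : IsSmoothMonotone F K) : IsTest (F ∘ u) :=
  ⟨hF.contDiff.comp hu.1, hu.2.comp_left hF.map_zero⟩

theorem IsTest.norm_grad_le {m : ℕ} {u : RR m → ℂ} (hu : IsTest u) :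
    ∃ B, ∀ x, ‖grad u x‖ ≤ B := by
  have h1 : Continuous (fderiv ℝ u) := hu.1.continuous_fderiv (by simp)
  obtain ⟨B, hB⟩ := (hu.2.fderiv ℝ).exists_bound_of_continuous h1
  refine ⟨√m * B, fun x => ?_⟩
  have hB0 : 0 ≤ B := (norm_nonneg _).trans (hB x)
  rw [EuclideanSpace.norm_eq]
  refine Real.sqrt_le_iff.2 ⟨by positivity, ?_⟩
  rw [mul_pow, Real.sq_sqrt (by positivity)]
  calc ∑ i, ‖grad u x i‖ ^ 2 ≤ ∑ _i : Fin m, B ^ 2 := by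
        refine Finset.sum_le_sum fun i _ => ?_
        gcongr
        refine ((fderiv ℝ u x).le_opNorm _).trans ?_
        simpa using hB x
    _ = _ := by simp

theorem IsTest.continuous_grad {m : ℕ} {u : RR m → ℂ} (hu : IsTest u) : Continuous (grad u) := by
  have h1 : Continuous (fderiv ℝ u) := hu.1.continuous_fderiv (by simp)
  refine (PiLp.continuous_toLp 2 _).comp (continuous_pi fun i => ?_)
  exact h1.clm_apply continuous_const

/-- A gradient operator `𝒢` on test functions together with a diffusion coefficient `M` and its
weight `w`, with respect to a measure `μ`. -/
structure IsFormPart {m : ℕ} (μ : Measure (RR m)) (𝒢 : (RR m → ℂ) → RR m → CC m)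
    (M : RR m → RR m →L[ℝ] RR m) (w : RR m → ℝ) : Prop where
  finite : IsFiniteMeasure μ
  aestronglyMeasurable : ∀ {u}, IsTest u → AEStronglyMeasurable (𝒢 u) μ
  norm_le : ∀ {u}, IsTest u → ∀ x, ‖𝒢 u x‖ ≤ ‖grad u x‖
  add : ∀ {u v}, IsTest u → IsTest v → ∀ x, 𝒢 (u + v) x = 𝒢 u x + 𝒢 v x
  smul : ∀ {u} (c : ℂ), IsTest u → ∀ x, 𝒢 (c • u) x = c • 𝒢 u x
  comp : ∀ {u} {F : ℂ → ℂ} {K : ℝ≥0}, IsTest u → IsSmoothMonotone F K → ∀ x i,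
    𝒢 (F ∘ u) x i = fderiv ℝ F (u x) (𝒢 u x i)
  aemeasurable : AEMeasurable M μ
  aemeasurable_weight : AEMeasurable w μ
  weight_nonneg : ∀ᵐ x ∂μ, 0 ≤ w x
  weight_le : ∃ C, ∀ᵐ x ∂μ, w x ≤ C
  upper : ∃ c : ℝ, 0 < c ∧ ∀ᵐ x ∂μ, ‖M x‖ ≤ c * w x
  -- One null set serves all `u` and `l`, so that `l` may be chosen depending on the value `u x`.
  lower : ∃ c : ℝ, 0 < c ∧ ∀ᵐ x ∂μ, ∀ u, IsTest u → ∀ l : ℂ →L[ℝ] ℝ,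
    c * w x * ‖mapCoord l (𝒢 u x)‖ ^ 2
      ≤ inner ℝ (M x (mapCoord l (𝒢 u x))) (mapCoord l (𝒢 u x))

namespace IsFormPart

variable {m : ℕ} {μ : Measure (RR m)} {𝒢 : (RR m → ℂ) → RR m → CC m}
  {M : RR m → RR m →L[ℝ] RR m} {w : RR m → ℝ}

theorem integrable_weight (h : IsFormPart μ 𝒢 M w) {u : RR m → ℂ} (hu : IsTest u) :
    Integrable (fun x => ‖𝒢 u x‖ ^ 2 * w x) μ := by
  have := h.finite
  obtain ⟨B, hB⟩ := hu.norm_grad_le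
  obtain ⟨C, hC⟩ := h.weight_le
  refine Integrable.of_bound (C := B ^ 2 * C) ?_ ?_
  · exact ((h.aestronglyMeasurable hu).norm.pow 2).mul h.aemeasurable_weight.aestronglyMeasurable
  · filter_upwards [hC, h.weight_nonneg] with x hx hx0
    rw [norm_mul, norm_pow, norm_norm, Real.norm_of_nonneg hx0]
    have h1 := (h.norm_le hu x).trans (hB x)
    gcongr

theorem aestronglyMeasurable_pairing (h : IsFormPart μ 𝒢 M w) {u v : RR m → ℂ} (hu : IsTest u)
    (hv : IsTest v) : AEStronglyMeasurable (fun x => pairing (M x) (𝒢 u x) (𝒢 v x)) μ := by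
  have h1 : ∀ {u}, IsTest u → ∀ i, AEMeasurable (fun x => 𝒢 u x i) μ := fun hu i => by
    have : Continuous fun z : CC m => z i := by fun_prop
    exact this.measurable.comp_aemeasurable (h.aestronglyMeasurable hu).aemeasurable
  refine AEMeasurable.aestronglyMeasurable ?_
  refine Finset.aemeasurable_fun_sum _ fun i _ => Finset.aemeasurable_fun_sum _ fun j _ => ?_
  refine AEMeasurable.mul (AEMeasurable.mul ?_ (h1 hu j)) ?_
  · have : Continuous fun L : RR m →L[ℝ] RR m => ((L (EuclideanSpace.single j 1) i : ℝ) : ℂ) := by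
      fun_prop
    exact this.measurable.comp_aemeasurable h.aemeasurable
  · exact Complex.continuous_conj.measurable.comp_aemeasurable (h1 hv i)

theorem exists_norm_pairing_le (h : IsFormPart μ 𝒢 M w) :
    ∃ C : ℝ, 0 ≤ C ∧ ∀ᵐ x ∂μ, ∀ u v, ‖pairing (M x) (𝒢 u x) (𝒢 v x)‖
      ≤ C * (‖𝒢 u x‖ ^ 2 * w x + ‖𝒢 v x‖ ^ 2 * w x) := by
  obtain ⟨c, hc, hM⟩ := h.upper
  refine ⟨m ^ 2 * c, by positivity, ?_⟩
  filter_upwards [hM, h.weight_nonneg] with x hx hx0 u v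
  refine (norm_pairing_le _ _ _).trans ?_
  have h1 : ‖M x‖ * ‖𝒢 u x‖ * ‖𝒢 v x‖ ≤ c * w x * ‖𝒢 u x‖ * ‖𝒢 v x‖ := by gcongr
  have h2 : ‖𝒢 u x‖ * ‖𝒢 v x‖ ≤ ‖𝒢 u x‖ ^ 2 + ‖𝒢 v x‖ ^ 2 := by
    nlinarith [sq_nonneg (‖𝒢 u x‖ - ‖𝒢 v x‖), sq_nonneg (‖𝒢 u x‖), sq_nonneg (‖𝒢 v x‖)]
  have h3 := mul_le_mul_of_nonneg_left h2 (mul_nonneg hc.le hx0)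
  have h4 : ‖M x‖ * ‖𝒢 u x‖ * ‖𝒢 v x‖ ≤ c * (‖𝒢 u x‖ ^ 2 * w x + ‖𝒢 v x‖ ^ 2 * w x) := by
    linarith
  rw [mul_assoc (_ ^ 2) c]
  exact mul_le_mul_of_nonneg_left h4 (by positivity)

theorem integrable_pairing (h : IsFormPart μ 𝒢 M w) {u v : RR m → ℂ} (hu : IsTest u)
    (hv : IsTest v) : Integrable (fun x => pairing (M x) (𝒢 u x) (𝒢 v x)) μ := by
  obtain ⟨C, hC, hb⟩ := h.exists_norm_pairing_le
  refine Integrable.mono' (((h.integrable_weight hu).add (h.integrable_weight hv)).const_mul C)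
    (h.aestronglyMeasurable_pairing hu hv) ?_
  filter_upwards [hb] with x hx
  exact hx u v

theorem exists_norm_integral_le (h : IsFormPart μ 𝒢 M w) :
    ∃ C : ℝ, 0 ≤ C ∧ ∀ u v, IsTest u → IsTest v → ‖∫ x, pairing (M x) (𝒢 u x) (𝒢 v x) ∂μ‖
      ≤ C * ((∫ x, ‖𝒢 u x‖ ^ 2 * w x ∂μ) + ∫ x, ‖𝒢 v x‖ ^ 2 * w x ∂μ) := by
  obtain ⟨C, hC, hb⟩ := h.exists_norm_pairing_le
  refine ⟨C, hC, fun u v hu hv => ?_⟩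
  rw [← integral_add (h.integrable_weight hu) (h.integrable_weight hv), ← integral_const_mul]
  refine norm_integral_le_of_norm_le
    (((h.integrable_weight hu).add (h.integrable_weight hv)).const_mul C) ?_
  filter_upwards [hb] with x hx
  exact hx u v

theorem exists_le_re_integral (h : IsFormPart μ 𝒢 M w) :
    ∃ c : ℝ, 0 < c ∧ ∀ u, IsTest u →
      c * ∫ x, ‖𝒢 u x‖ ^ 2 * w x ∂μ ≤ (∫ x, pairing (M x) (𝒢 u x) (𝒢 u x) ∂μ).re := by
  obtain ⟨c, hc, hb⟩ := h.lower
  refine ⟨c, hc, fun u hu => ?_⟩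
  rw [← integral_const_mul]
  have h1 : (∫ x, pairing (M x) (𝒢 u x) (𝒢 u x) ∂μ).re
      = ∫ x, (pairing (M x) (𝒢 u x) (𝒢 u x)).re ∂μ :=
    (integral_re (𝕜 := ℂ) (h.integrable_pairing hu hu)).symm
  rw [h1]
  refine integral_mono_ae ((h.integrable_weight hu).const_mul c)
    (h.integrable_pairing hu hu).re ?_
  filter_upwards [hb] with x hx
  change _ ≤ (pairing (M x) (𝒢 u x) (𝒢 u x)).re
  rw [re_pairing_self]
  have h2 := add_le_add (hx u hu Complex.reCLM) (hx u hu Complex.imCLM)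
  refine le_trans (le_of_eq ?_) h2
  rw [norm_sq_eq_mapCoord]; ring

theorem integral_weight_nonneg (h : IsFormPart μ 𝒢 M w) (u : RR m → ℂ) :
    0 ≤ ∫ x, ‖𝒢 u x‖ ^ 2 * w x ∂μ := by
  refine integral_nonneg_of_ae ?_
  filter_upwards [h.weight_nonneg] with x hx
  positivity

/-- At each point the derivative of `F` is `⟨e,·⟩e`, so `re_pairing_eq_sum` with a single vector
reduces the integrand to `(Mξ,ξ)` for `ξ = ⟨e,𝒢u⟩`. -/
theorem re_integral_comp_nonneg (h : IsFormPart μ 𝒢 M w) {u : RR m → ℂ} (hu : IsTest u)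
    {F : ℂ → ℂ} {K : ℝ≥0} (hF : IsSmoothMonotone F K) :
    0 ≤ (∫ x, pairing (M x) (𝒢 u x) (𝒢 (F ∘ u) x) ∂μ).re := by
  have h1 : (∫ x, pairing (M x) (𝒢 u x) (𝒢 (F ∘ u) x) ∂μ).re
      = ∫ x, (pairing (M x) (𝒢 u x) (𝒢 (F ∘ u) x)).re ∂μ :=
    (integral_re (𝕜 := ℂ) (h.integrable_pairing hu (hu.comp hF))).symm
  rw [h1]
  obtain ⟨c, hc, hb⟩ := h.lower
  refine integral_nonneg_of_ae ?_
  filter_upwards [hb, h.weight_nonneg] with x hx hx0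
  obtain ⟨e, he⟩ := hF.fderiv_eq (u x)
  change 0 ≤ (pairing (M x) (𝒢 u x) (𝒢 (F ∘ u) x)).re
  rw [re_pairing_eq_sum (fun _ : Unit => e) (M x) fun i => by
    rw [h.comp hu hF, he, Fintype.sum_unique]]
  exact Finset.sum_nonneg fun k _ => le_trans (by positivity) (hx u hu (innerSL ℝ e))

theorem integral_weight_comp_le (h : IsFormPart μ 𝒢 M w) {u : RR m → ℂ} (hu : IsTest u)
    {F : ℂ → ℂ} {K : ℝ≥0} (hF : IsSmoothMonotone F K) :
    ∫ x, ‖𝒢 (F ∘ u) x‖ ^ 2 * w x ∂μ ≤ K ^ 2 * ∫ x, ‖𝒢 u x‖ ^ 2 * w x ∂μ := by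
  rw [← integral_const_mul]
  refine integral_mono_ae (h.integrable_weight (hu.comp hF))
    ((h.integrable_weight hu).const_mul _) ?_
  filter_upwards [h.weight_nonneg] with x hx0
  have h1 : ‖𝒢 (F ∘ u) x‖ ^ 2 ≤ K ^ 2 * ‖𝒢 u x‖ ^ 2 := by
    rw [EuclideanSpace.norm_sq_eq, EuclideanSpace.norm_sq_eq, Finset.mul_sum]
    refine Finset.sum_le_sum fun i _ => ?_
    rw [h.comp hu hF, ← mul_pow]
    gcongr
    exact (ContinuousLinearMap.le_opNorm _ _).trans
      (mul_le_mul_of_nonneg_right (norm_fderiv_le_of_lipschitz ℝ hF.lipschitz) (norm_nonneg _))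
  change _ ≤ (K : ℝ) ^ 2 * (‖𝒢 u x‖ ^ 2 * w x)
  rw [← mul_assoc]
  gcongr

theorem integral_add_left (h : IsFormPart μ 𝒢 M w) {u u' v : RR m → ℂ} (hu : IsTest u)
    (hu' : IsTest u') (hv : IsTest v) :
    ∫ x, pairing (M x) (𝒢 (u + u') x) (𝒢 v x) ∂μ
      = (∫ x, pairing (M x) (𝒢 u x) (𝒢 v x) ∂μ) + ∫ x, pairing (M x) (𝒢 u' x) (𝒢 v x) ∂μ := by
  rw [← integral_add (h.integrable_pairing hu hv) (h.integrable_pairing hu' hv)]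
  exact integral_congr_ae (ae_of_all _ fun x => by
    simp only [h.add hu hu', pairing_add_left])

theorem integral_add_right (h : IsFormPart μ 𝒢 M w) {u v v' : RR m → ℂ} (hu : IsTest u)
    (hv : IsTest v) (hv' : IsTest v') :
    ∫ x, pairing (M x) (𝒢 u x) (𝒢 (v + v') x) ∂μ
      = (∫ x, pairing (M x) (𝒢 u x) (𝒢 v x) ∂μ) + ∫ x, pairing (M x) (𝒢 u x) (𝒢 v' x) ∂μ := by
  rw [← integral_add (h.integrable_pairing hu hv) (h.integrable_pairing hu hv')]
  exact integral_congr_ae (ae_of_all _ fun x => by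
    simp only [h.add hv hv', pairing_add_right])

theorem integral_smul_left (h : IsFormPart μ 𝒢 M w) (c : ℂ) {u : RR m → ℂ} (v : RR m → ℂ)
    (hu : IsTest u) :
    ∫ x, pairing (M x) (𝒢 (c • u) x) (𝒢 v x) ∂μ
      = c * ∫ x, pairing (M x) (𝒢 u x) (𝒢 v x) ∂μ := by
  rw [← integral_const_mul]
  exact integral_congr_ae (ae_of_all _ fun x => by simp only [h.smul c hu, pairing_smul_left])

theorem integral_smul_right (h : IsFormPart μ 𝒢 M w) (c : ℂ) (u : RR m → ℂ) {v : RR m → ℂ}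
    (hv : IsTest v) :
    ∫ x, pairing (M x) (𝒢 u x) (𝒢 (c • v) x) ∂μ
      = (starRingEnd ℂ) c * ∫ x, pairing (M x) (𝒢 u x) (𝒢 v x) ∂μ := by
  rw [← integral_const_mul]
  exact integral_congr_ae (ae_of_all _ fun x => by simp only [h.smul c hv, pairing_smul_right])

end IsFormPart

/-! ### The form of the interface problem -/

section Form

variable {n : ℕ}

/-! ### The finite measure, test functions and density of the trace -/

namespace Geometry

variable (G : Geometry n)

theorem isBounded_Γd : Bornology.IsBounded G.Γd :=
  G.isBounded_Ω.closure.subset fun _ hx =>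
    frontier_subset_closure (G.frontier_eq ▸ Or.inr hx)

theorem isBounded_Sg : Bornology.IsBounded G.Sg := G.isBounded_Ω.subset G.Sg_subset

theorem hausdorff_Γd_lt_top : Measure.euclideanHausdorffMeasure n G.Γd < ⊤ := by
  obtain ⟨M, hM, hS⟩ := G.closure_Γd
  exact euclideanHausdorffMeasure_lt_top_of_closure hM hS G.isBounded_Γd

theorem hausdorff_Sg_lt_top : Measure.euclideanHausdorffMeasure n G.Sg < ⊤ := by
  obtain ⟨M, hM, hS⟩ := G.closure_Sg
  exact euclideanHausdorffMeasure_lt_top_of_closure hM hS G.isBounded_Sg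

theorem volume_Sg : volume G.Sg = 0 :=
  volume_eq_zero_of_euclideanHausdorffMeasure_lt_top G.hausdorff_Sg_lt_top

instance : IsFiniteMeasure (volume.restrict G.Ω) :=
  ⟨by simpa using G.isBounded_Ω.measure_lt_top⟩

instance : IsFiniteMeasure G.measure := by
  refine ⟨?_⟩
  rw [measure, Measure.add_apply, Measure.restrict_apply_univ, Measure.restrict_apply_univ]
  refine ENNReal.add_lt_top.2 ⟨(measure_mono Set.sdiff_subset).trans_lt
    G.isBounded_Ω.measure_lt_top, (measure_union_le _ _).trans_lt
      (ENNReal.add_lt_top.2 ⟨G.hausdorff_Γd_lt_top, G.hausdorff_Sg_lt_top⟩)⟩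

theorem measure_ΓD : G.measure G.ΓD = 0 := by
  have hD : MeasurableSet G.ΓD := G.isClosed_ΓD.measurableSet
  have hΩ : ∀ x ∈ G.ΓD, x ∉ G.Ω := fun x hx hxΩ => by
    have h1 : x ∈ frontier G.Ω := G.frontier_eq ▸ Or.inl (Or.inl hx)
    rw [G.isOpen_Ω.frontier_eq] at h1
    exact h1.2 hxΩ
  rw [measure, Measure.add_apply, Measure.restrict_apply hD, Measure.restrict_apply hD]
  have h1 : G.ΓD ∩ (G.Ω \ G.Sg) = ∅ := Set.eq_empty_of_forall_notMem fun x hx => hΩ x hx.1 hx.2.1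
  have h2 : G.ΓD ∩ (G.Γd ∪ G.Sg) = ∅ := Set.eq_empty_of_forall_notMem fun x hx =>
    hx.2.elim (fun h => Set.disjoint_left.1 G.disjoint_Dd hx.1 h)
      (fun h => hΩ x hx.1 (G.Sg_subset h))
  rw [h1, h2, measure_empty, measure_empty, add_zero]

/-- The test functions as a complex vector space. -/
def testModule : Submodule ℂ (RR (n + 1) → ℂ) where
  carrier := G.testFunctions
  add_mem' {u v} hu hv := ⟨hu.1.add hv.1, hu.2.1.add hv.2.1,
    (hu.2.2.union_left hv.2.2).mono_left (tsupport_add u v)⟩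
  zero_mem' := ⟨contDiff_const, HasCompactSupport.zero, by simp [tsupport]⟩
  smul_mem' c u hu := ⟨hu.1.const_smul c, hu.2.1.smul_left,
    hu.2.2.mono_left (tsupport_smul_subset_right (fun _ => c) u)⟩

variable {G}

theorem isTest (u : G.testModule) : IsTest (u : RR (n + 1) → ℂ) := ⟨u.2.1, u.2.2.1⟩

theorem memLp_of_isTest {μ : Measure (RR (n + 1))} [IsFiniteMeasure μ] {u : RR (n + 1) → ℂ}
    (hu : IsTest u) : MemLp u 2 μ := by
  obtain ⟨B, hB⟩ := hu.2.exists_bound_of_continuous hu.1.continuous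
  exact MemLp.of_bound hu.1.continuous.aestronglyMeasurable B (ae_of_all _ hB)

theorem integrable_norm_sq {μ : Measure (RR (n + 1))} [IsFiniteMeasure μ] {u : RR (n + 1) → ℂ}
    (hu : IsTest u) : Integrable (fun x => ‖u x‖ ^ 2) μ :=
  (memLp_two_iff_integrable_sq_norm hu.1.continuous.aestronglyMeasurable).1 (memLp_of_isTest hu)

variable (G)

/-- The map `𝔍` on test functions. -/
def trace : G.testModule →ₗ[ℂ] G.L2 where
  toFun u := (memLp_of_isTest (isTest u)).toLp u
  map_add' _ _ := rfl
  map_smul' _ _ := rfl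

theorem coeFn_trace (u : G.testModule) : G.trace u =ᵐ[G.measure] (u : RR (n + 1) → ℂ) :=
  MemLp.coeFn_toLp (memLp_of_isTest (isTest u))

theorem norm_trace_sq (u : G.testModule) :
    ‖G.trace u‖ ^ 2 = ∫ x, ‖(u : RR (n + 1) → ℂ) x‖ ^ 2 ∂G.measure := by
  rw [← re_inner_self_eq, L2.inner_def]
  have h1 : (∫ a, inner ℂ (G.trace u a) (G.trace u a) ∂G.measure).re
      = ∫ a, (inner ℂ (G.trace u a) (G.trace u a)).re ∂G.measure :=
    (integral_re (𝕜 := ℂ) (L2.integrable_inner (G.trace u) (G.trace u))).symm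
  rw [h1]
  refine integral_congr_ae ?_
  filter_upwards [G.coeFn_trace u] with x hx
  rw [re_inner_self_eq, hx]

theorem integral_norm_sq_le (u : G.testModule) :
    ∫ x in G.Ω, ‖(u : RR (n + 1) → ℂ) x‖ ^ 2 ≤ ‖G.trace u‖ ^ 2 := by
  rw [norm_trace_sq]
  have h1 : volume.restrict G.Ω = volume.restrict (G.Ω \ G.Sg) :=
    (Measure.restrict_congr_set (sdiff_null_ae_eq_self G.volume_Sg)).symm
  rw [h1]
  refine integral_mono_measure ?_ (ae_of_all _ fun x => by positivity)
    (integrable_norm_sq (isTest u))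
  exact Measure.le_add_right le_rfl

theorem denseRange_trace : DenseRange G.trace := by
  -- An `f` orthogonal to all traces integrates to zero against real smooth functions supported off
  -- `Γ_D`, so it vanishes almost everywhere off `Γ_D`, which is a null set for this measure.
  have h : (LinearMap.range G.trace).topologicalClosure = ⊤ := by
    rw [Submodule.topologicalClosure_eq_top_iff, Submodule.eq_bot_iff]
    intro f hf
    have hint : Integrable f G.measure := (Lp.memLp f).integrable (by norm_num)
    have h1 : ∀ g : RR (n + 1) → ℝ, ContDiff ℝ ∞ g → HasCompactSupport g → tsupport g ⊆ G.ΓDᶜ →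
        ∫ x, g x • f x ∂G.measure = 0 := by
      intro g hg hgc hgs
      let u : G.testModule := ⟨fun x => (g x : ℂ), Complex.ofRealCLM.contDiff.comp hg,
        hgc.comp_left (g := fun r : ℝ => (r : ℂ)) Complex.ofReal_zero, by
          refine Disjoint.mono_left ?_ (Set.disjoint_compl_left_iff_subset.2 subset_rfl)
          refine (closure_mono fun x hx => ?_).trans hgs
          contrapose! hx
          simp only [Function.mem_support, not_not] at hx
          simp [hx]⟩
      have h2 : inner ℂ (G.trace u) f = 0 :=
        (Submodule.mem_orthogonal _ _).1 hf _ (LinearMap.mem_range_self _ _)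
      rw [L2.inner_def] at h2
      rw [← h2]
      refine integral_congr_ae ?_
      filter_upwards [G.coeFn_trace u] with x hx
      rw [hx, Complex.real_smul, RCLike.inner_apply, Complex.conj_ofReal, mul_comm]
    have h2 := G.isClosed_ΓD.isOpen_compl.ae_eq_zero_of_integral_contDiff_smul_eq_zero
      (hint.locallyIntegrable.locallyIntegrableOn _) h1
    refine (Lp.eq_zero_iff_ae_eq_zero).2 ?_
    filter_upwards [h2, measure_eq_zero_iff_ae_notMem.1 G.measure_ΓD] with x hx hxD
    exact hx hxD
  exact (Submodule.dense_iff_topologicalClosure_eq_top).2 h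

end Geometry

theorem IsSurfaceDiffusion.isFormPart {S : Set (RR (n + 1))}
    {M : RR (n + 1) → RR (n + 1) →L[ℝ] RR (n + 1)} {w : RR (n + 1) → ℝ}
    (h : IsSurfaceDiffusion S M w) (hS : IsLipschitzGraphHypersurface S)
    (hfin : Measure.euclideanHausdorffMeasure n S < ⊤) :
    IsFormPart ((Measure.euclideanHausdorffMeasure n).restrict S) (surfaceGrad S) M w where
  finite := ⟨by simpa using hfin⟩
  aestronglyMeasurable hu := hS.aestronglyMeasurable_surfaceGrad hu.differentiable
  norm_le hu x := norm_surfaceGrad_le (hu.differentiable x)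
  add hu hv x := surfaceGrad_add (hu.differentiable x) (hv.differentiable x)
  smul c hu x := surfaceGrad_smul c (hu.differentiable x)
  comp hu hF x i := surfaceGrad_comp_apply (hF.contDiff.differentiable (by simp) _)
    (hu.differentiable x) i
  aemeasurable := aemeasurable_restrict_of_measurable_subtype hS.measurableSet h.measurable
  aemeasurable_weight :=
    aemeasurable_restrict_of_measurable_subtype hS.measurableSet h.measurable_weight
  weight_nonneg := by
    filter_upwards [ae_restrict_mem hS.measurableSet] with x hx using h.weight_nonneg x hx
  weight_le := by
    obtain ⟨C, hC⟩ := h.bounded_weight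
    refine ⟨C, ?_⟩
    filter_upwards [ae_restrict_mem hS.measurableSet] with x hx using hC x hx
  upper := by
    obtain ⟨c, hc, hM⟩ := h.upper
    refine ⟨c, hc, ?_⟩
    filter_upwards [ae_restrict_mem hS.measurableSet] with x hx using hM x hx
  lower := by
    obtain ⟨c, hc, hM⟩ := h.lower
    refine ⟨c, hc, ?_⟩
    filter_upwards [ae_restrict_mem hS.measurableSet] with x hx u hu l
    rcases mapCoord_surfaceGrad_mem (S := S) (hu.differentiable x) l with h0 | h0
    · simp [h0]
    · exact hM x hx _ h0

/-! ### Bounds for the interface form and m-accretivity of its operator -/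

namespace Coefficients

variable {G : Geometry n} (C : Coefficients G)

theorem isFormPart_Ω : IsFormPart (volume.restrict G.Ω) grad C.μΩ (fun _ => 1) where
  finite := inferInstance
  aestronglyMeasurable hu := hu.continuous_grad.aestronglyMeasurable
  norm_le _ _ := le_rfl
  add hu hv x := grad_add (hu.differentiable x) (hv.differentiable x)
  smul c hu x := grad_smul c (hu.differentiable x)
  comp hu hF x i := grad_comp_apply (hF.contDiff.differentiable (by simp) _)
    (hu.differentiable x) i
  aemeasurable :=
    aemeasurable_restrict_of_measurable_subtype G.isOpen_Ω.measurableSet C.measurable_μΩ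
  aemeasurable_weight := aemeasurable_const
  weight_nonneg := ae_of_all _ fun _ => zero_le_one
  weight_le := ⟨1, ae_of_all _ fun _ => le_rfl⟩
  upper := by
    obtain ⟨c, hc⟩ := C.bounded_μΩ
    refine ⟨max c 1, by positivity, ?_⟩
    filter_upwards [ae_restrict_mem G.isOpen_Ω.measurableSet] with x hx
    rw [mul_one]
    exact (hc x hx).trans (le_max_left _ _)
  lower := by
    obtain ⟨c, hc, hM⟩ := C.elliptic_μΩ
    refine ⟨c, hc, ?_⟩
    filter_upwards [ae_restrict_mem G.isOpen_Ω.measurableSet] with x hx u hu l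
    rw [mul_one]
    exact hM x hx _

theorem isFormPart_Γ : IsFormPart ((Measure.euclideanHausdorffMeasure n).restrict G.Γd)
    (surfaceGrad G.Γd) C.μΓ C.wΓ :=
  C.diffusion_Γ.isFormPart G.graph_Γd G.hausdorff_Γd_lt_top

theorem isFormPart_Sg : IsFormPart ((Measure.euclideanHausdorffMeasure n).restrict G.Sg)
    (surfaceGrad G.Sg) C.μSg C.wSg :=
  C.diffusion_Sg.isFormPart G.graph_Sg G.hausdorff_Sg_lt_top

/-- The form `𝔱` as a sesquilinear map on test functions. -/
def sesqForm : G.testModule →ₗ[ℂ] G.testModule →ₛₗ[starRingEnd ℂ] ℂ :=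
  LinearMap.mk₂'ₛₗ (RingHom.id ℂ) (starRingEnd ℂ) (fun u v => C.form u v)
    (fun u u' v => by
      simp only [form, Submodule.coe_add]
      rw [C.isFormPart_Ω.integral_add_left (Geometry.isTest u) (Geometry.isTest u')
        (Geometry.isTest v), C.isFormPart_Γ.integral_add_left (Geometry.isTest u)
        (Geometry.isTest u') (Geometry.isTest v), C.isFormPart_Sg.integral_add_left
        (Geometry.isTest u) (Geometry.isTest u') (Geometry.isTest v)]
      ring)
    (fun c u v => by
      simp only [form, Submodule.coe_smul]
      rw [C.isFormPart_Ω.integral_smul_left c _ (Geometry.isTest u),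
        C.isFormPart_Γ.integral_smul_left c _ (Geometry.isTest u),
        C.isFormPart_Sg.integral_smul_left c _ (Geometry.isTest u)]
      simp only [RingHom.id_apply, smul_eq_mul]
      ring)
    (fun u v v' => by
      simp only [form, Submodule.coe_add]
      rw [C.isFormPart_Ω.integral_add_right (Geometry.isTest u) (Geometry.isTest v)
        (Geometry.isTest v'), C.isFormPart_Γ.integral_add_right (Geometry.isTest u)
        (Geometry.isTest v) (Geometry.isTest v'), C.isFormPart_Sg.integral_add_right
        (Geometry.isTest u) (Geometry.isTest v) (Geometry.isTest v')]
      ring)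
    (fun c u v => by
      simp only [form, Submodule.coe_smul]
      rw [C.isFormPart_Ω.integral_smul_right c _ (Geometry.isTest v),
        C.isFormPart_Γ.integral_smul_right c _ (Geometry.isTest v),
        C.isFormPart_Sg.integral_smul_right c _ (Geometry.isTest v)]
      simp only [smul_eq_mul]
      ring)

theorem sesqForm_apply (u v : G.testModule) : C.sesqForm u v = C.form u v := rfl

/-- The part of the squared norm of `dom(𝔱)` that contains the gradients. -/
def energy (u : RR (n + 1) → ℂ) : ℝ :=
  (∫ x in G.Ω, ‖grad u x‖ ^ 2 * 1)
  + (∫ x in G.Γd, ‖surfaceGrad G.Γd u x‖ ^ 2 * C.wΓ x ∂Measure.euclideanHausdorffMeasure n)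
  + ∫ x in G.Sg, ‖surfaceGrad G.Sg u x‖ ^ 2 * C.wSg x ∂Measure.euclideanHausdorffMeasure n

theorem energy_nonneg (u : RR (n + 1) → ℂ) : 0 ≤ C.energy u :=
  add_nonneg (add_nonneg (C.isFormPart_Ω.integral_weight_nonneg u)
    (C.isFormPart_Γ.integral_weight_nonneg u)) (C.isFormPart_Sg.integral_weight_nonneg u)

theorem domNormSq_eq {u : RR (n + 1) → ℂ} (hu : IsTest u) :
    C.domNormSq u = (∫ x in G.Ω, ‖u x‖ ^ 2) + C.energy u := by
  have h1 := C.isFormPart_Ω.integrable_weight hu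
  simp only [mul_one] at h1
  rw [domNormSq, energy, integral_add (Geometry.integrable_norm_sq hu) h1]
  simp only [mul_one]
  ring

theorem exists_energy_le : ∃ c : ℝ, 0 < c ∧ ∀ u : G.testModule,
    c * C.energy u ≤ (C.sesqForm u u).re := by
  obtain ⟨c₁, hc₁, h₁⟩ := C.isFormPart_Ω.exists_le_re_integral
  obtain ⟨c₂, hc₂, h₂⟩ := C.isFormPart_Γ.exists_le_re_integral
  obtain ⟨c₃, hc₃, h₃⟩ := C.isFormPart_Sg.exists_le_re_integral
  refine ⟨min c₁ (min c₂ c₃), by positivity, fun u => ?_⟩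
  have hu := Geometry.isTest u
  rw [sesqForm_apply, form, Complex.add_re, Complex.add_re, energy, mul_add, mul_add]
  refine add_le_add (add_le_add (le_trans ?_ (h₁ u hu)) (le_trans ?_ (h₂ u hu)))
    (le_trans ?_ (h₃ u hu))
  · exact mul_le_mul_of_nonneg_right (min_le_left _ _) (C.isFormPart_Ω.integral_weight_nonneg u)
  · exact mul_le_mul_of_nonneg_right ((min_le_right _ _).trans (min_le_left _ _))
      (C.isFormPart_Γ.integral_weight_nonneg u)
  · exact mul_le_mul_of_nonneg_right ((min_le_right _ _).trans (min_le_right _ _))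
      (C.isFormPart_Sg.integral_weight_nonneg u)

theorem exists_norm_sesqForm_le : ∃ K : ℝ, 0 ≤ K ∧ ∀ u v : G.testModule,
    ‖C.sesqForm u v‖ ≤ K * (C.energy u + C.energy v) := by
  obtain ⟨c₁, hc₁, h₁⟩ := C.isFormPart_Ω.exists_norm_integral_le
  obtain ⟨c₂, hc₂, h₂⟩ := C.isFormPart_Γ.exists_norm_integral_le
  obtain ⟨c₃, hc₃, h₃⟩ := C.isFormPart_Sg.exists_norm_integral_le
  refine ⟨c₁ + c₂ + c₃, by positivity, fun u v => ?_⟩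
  have hu := Geometry.isTest u
  have hv := Geometry.isTest v
  rw [sesqForm_apply, form]
  refine norm_add₃_le.trans ((add_le_add (add_le_add (h₁ u v hu hv) (h₂ u v hu hv))
    (h₃ u v hu hv)).trans ?_)
  have a1 := C.isFormPart_Ω.integral_weight_nonneg u
  have a2 := C.isFormPart_Γ.integral_weight_nonneg u
  have a3 := C.isFormPart_Sg.integral_weight_nonneg u
  have b1 := C.isFormPart_Ω.integral_weight_nonneg v
  have b2 := C.isFormPart_Γ.integral_weight_nonneg v
  have b3 := C.isFormPart_Sg.integral_weight_nonneg v
  rw [add_mul, add_mul]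
  refine add_le_add (add_le_add ?_ ?_) ?_
  all_goals
    refine mul_le_mul_of_nonneg_left ?_ (by assumption)
    simp only [energy]
    linarith

theorem energy_comp_le {u : RR (n + 1) → ℂ} (hu : IsTest u) {F : ℂ → ℂ} {K : ℝ≥0}
    (hF : IsSmoothMonotone F K) : C.energy (F ∘ u) ≤ K ^ 2 * C.energy u := by
  rw [energy, energy, mul_add, mul_add]
  exact add_le_add (add_le_add (C.isFormPart_Ω.integral_weight_comp_le hu hF)
    (C.isFormPart_Γ.integral_weight_comp_le hu hF)) (C.isFormPart_Sg.integral_weight_comp_le hu hF)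

/-- Composition with a smooth monotone map, on test functions. -/
def compTest {F : ℂ → ℂ} {K : ℝ≥0} (hF : IsSmoothMonotone F K) (u : G.testModule) :
    G.testModule :=
  ⟨F ∘ u, (Geometry.isTest u).comp hF |>.1, (Geometry.isTest u).comp hF |>.2,
    u.2.2.2.mono_left (closure_mono (Function.support_comp_subset hF.map_zero _))⟩

theorem re_sesqForm_compTest_nonneg {F : ℂ → ℂ} {K : ℝ≥0} (hF : IsSmoothMonotone F K)
    (u : G.testModule) : 0 ≤ (C.sesqForm u (compTest hF u)).re := by
  have hu := Geometry.isTest u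
  rw [sesqForm_apply, form, Complex.add_re, Complex.add_re]
  exact add_nonneg (add_nonneg (C.isFormPart_Ω.re_integral_comp_nonneg hu hF)
    (C.isFormPart_Γ.re_integral_comp_nonneg hu hF)) (C.isFormPart_Sg.re_integral_comp_nonneg hu hF)

theorem trace_compTest {F : ℂ → ℂ} {K : ℝ≥0} (hF : IsSmoothMonotone F K) (u : G.testModule) :
    G.trace (compTest hF u) = hF.lipschitz.compLp hF.map_zero (G.trace u) := by
  refine Lp.ext ?_
  filter_upwards [G.coeFn_trace (compTest hF u), G.coeFn_trace u,
    hF.lipschitz.coeFn_compLp hF.map_zero (G.trace u)] with x h1 h2 h3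
  rw [h1, h3, Function.comp_apply, h2]
  rfl

theorem hasJ_coe_iff (u : ℕ → G.testModule) (φ : G.L2) :
    C.HasJ (fun k => (u k : RR (n + 1) → ℂ)) φ ↔
      (∀ ε : ℝ, 0 < ε → ∃ N, ∀ k ≥ N, ∀ l ≥ N,
        C.domNormSq ((u k - u l : G.testModule) : RR (n + 1) → ℂ) < ε) ∧
      Tendsto (fun k => G.trace (u k)) atTop (𝓝 φ) := by
  rw [Lp.tendsto_Lp_iff_tendsto_eLpNorm']
  have h : ∀ k, eLpNorm (fun x => (u k : RR (n + 1) → ℂ) x - φ x) 2 G.measure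
      = eLpNorm (⇑(G.trace (u k)) - ⇑φ) 2 G.measure := fun k =>
    eLpNorm_congr_ae (by
      filter_upwards [G.coeFn_trace (u k)] with x hx
      rw [Pi.sub_apply, hx])
  simp only [HasJ, IsDomElement, h]
  exact and_congr_left fun _ => ⟨fun h' => h'.2, fun h' => ⟨fun k => (u k).2, h'⟩⟩

theorem A₂_iff (φ ψ : G.L2) : C.A₂ φ ψ ↔ ∃ u : ℕ → G.testModule,
    ((∀ ε : ℝ, 0 < ε → ∃ N, ∀ k ≥ N, ∀ l ≥ N,
      C.domNormSq ((u k - u l : G.testModule) : RR (n + 1) → ℂ) < ε) ∧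
        Tendsto (fun k => G.trace (u k)) atTop (𝓝 φ)) ∧
      ∀ (v : ℕ → G.testModule) (χ : G.L2), ((∀ ε : ℝ, 0 < ε → ∃ N, ∀ k ≥ N, ∀ l ≥ N,
        C.domNormSq ((v k - v l : G.testModule) : RR (n + 1) → ℂ) < ε) ∧
        Tendsto (fun k => G.trace (v k)) atTop (𝓝 χ)) →
        Tendsto (fun k => C.sesqForm (u k) (v k)) atTop (𝓝 (inner ℂ χ ψ)) := by
  simp only [← hasJ_coe_iff]
  constructor
  · rintro ⟨u, hu, h⟩
    exact ⟨fun k => ⟨u k, hu.1.1 k⟩, hu, fun v χ hv => h _ χ hv⟩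
  · rintro ⟨u, hu, h⟩
    exact ⟨_, hu, fun v χ hv => h (fun k => ⟨v k, hv.1.1 k⟩) χ hv⟩

theorem A₂_isMAccretive : IsMAccretive C.A₂ ∧
    ∀ {F : ℂ → ℂ} {K : ℝ≥0} (hF : IsSmoothMonotone F K) (φ ψ : G.L2), C.A₂ φ ψ →
      0 ≤ (inner ℂ (hF.lipschitz.compLp hF.map_zero φ) ψ).re := by
  obtain ⟨c, hc, hlow⟩ := C.exists_energy_le
  obtain ⟨K₀, hK₀, hup⟩ := C.exists_norm_sesqForm_le
  have hpos : ∀ u, 0 ≤ (C.sesqForm u u).re := fun u =>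
    le_trans (mul_nonneg hc.le (C.energy_nonneg _)) (hlow u)
  have hen : ∀ u : G.testModule, C.energy u ≤ c⁻¹ * (C.sesqForm u u).re := fun u => by
    rw [le_inv_mul_iff₀ hc]; exact hlow u
  have hre : ∀ u : G.testModule, (C.sesqForm u u).re ≤ 2 * K₀ * C.energy u := fun u => by
    have := (Complex.re_le_norm _).trans (hup u u)
    linarith
  have hdom : ∀ u : G.testModule, C.energy u ≤ C.domNormSq u := fun u => by
    rw [C.domNormSq_eq (Geometry.isTest u)]
    have : 0 ≤ ∫ x in G.Ω, ‖(u : RR (n + 1) → ℂ) x‖ ^ 2 :=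
      integral_nonneg fun x => by positivity
    linarith
  -- In `C`, the summand `1` pays for the `L²` part of `domNormSq`, `c⁻¹` for its gradient part, and
  -- `2K₀` bounds `Re 𝔱(u,u)` by the energy.
  obtain ⟨h1, h2⟩ := form_isMAccretive C.sesqForm G.trace (fun u => C.domNormSq u) hpos
    (M := K₀ * c⁻¹) (C := 1 + c⁻¹ + 2 * K₀) (fun u v => by
      refine (hup u v).trans ?_
      rw [mul_assoc]
      refine mul_le_mul_of_nonneg_left ?_ hK₀
      rw [mul_add]
      have e : ∀ u : G.testModule,
          C.energy u ≤ c⁻¹ * ((C.sesqForm u u).re + ‖G.trace u‖ ^ 2) := fun u =>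
        (hen u).trans (mul_le_mul_of_nonneg_left (le_add_of_nonneg_right (sq_nonneg _))
          (inv_pos.2 hc).le)
      exact add_le_add (e u) (e v))
    G.denseRange_trace (by positivity)
    (fun u => by
      have a1 := G.integral_norm_sq_le u
      have a2 := hen u
      rw [C.domNormSq_eq (Geometry.isTest u)]
      have a3 := hpos u
      have a4 := sq_nonneg ‖G.trace u‖
      have a5 := inv_pos.2 hc
      have a6 := mul_nonneg a5.le a4
      have a7 := mul_nonneg hK₀ (add_nonneg a3 a4)
      nlinarith)
    (fun u => by
      refine (hre u).trans ?_
      have a1 := hdom u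
      have a2 := C.energy_nonneg u
      have a3 := inv_pos.2 hc
      have a4 := mul_le_mul_of_nonneg_left a1 hK₀
      have a5 := mul_nonneg a3.le (a2.trans a1)
      nlinarith)
    C.A₂_iff
  refine ⟨h1, fun {F K} hF φ ψ h => ?_⟩
  -- The energy of `F ∘ u` is at most `K²` times that of `u`. Passing from `Re 𝔱` to the energy and
  -- back costs `2K₀c⁻¹`; the summand `1` is for the trace.
  refine h2 (compTest hF) (K * √(2 * K₀ * c⁻¹ + 1)) _ (by positivity) (fun u => ?_)
    (C.re_sesqForm_compTest_nonneg hF) (hF.lipschitz.continuous_compLp hF.map_zero)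
    (trace_compTest hF) φ ψ h
  rw [trace_compTest, mul_pow, Real.sq_sqrt (by positivity)]
  have a1 := hF.lipschitz.norm_compLp_le hF.map_zero (G.trace u)
  have a2 : ‖hF.lipschitz.compLp hF.map_zero (G.trace u)‖ ^ 2 ≤ K ^ 2 * ‖G.trace u‖ ^ 2 := by
    rw [← mul_pow]; gcongr
  have a3 : (C.sesqForm (compTest hF u) (compTest hF u)).re
      ≤ 2 * K₀ * (K ^ 2 * (c⁻¹ * (C.sesqForm u u).re)) := by
    refine (hre _).trans (mul_le_mul_of_nonneg_left ?_ (by positivity))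
    exact (C.energy_comp_le (Geometry.isTest u) hF).trans
      (mul_le_mul_of_nonneg_left (hen u) (by positivity))
  have a4 : 0 ≤ (K : ℝ) ^ 2 * (2 * K₀ * c⁻¹) * ‖G.trace u‖ ^ 2 := by positivity
  have a5 : 0 ≤ (K : ℝ) ^ 2 * (C.sesqForm u u).re := mul_nonneg (by positivity) (hpos u)
  linarith

end Coefficients

end Form

/-! ### Invariant half planes -/

theorem exists_lipschitzWith_smoothTransition :
    ∃ K : ℝ≥0, LipschitzWith K Real.smoothTransition := by
  have hd : ContDiff ℝ 1 Real.smoothTransition := Real.smoothTransition.contDiff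
  have hsupp : HasCompactSupport (deriv Real.smoothTransition) := by
    refine HasCompactSupport.intro (isCompact_Icc (a := (0 : ℝ)) (b := 1)) fun x hx => ?_
    rcases lt_or_ge x 0 with h | h
    · have : Real.smoothTransition =ᶠ[𝓝 x] fun _ => 0 := by
        filter_upwards [Iio_mem_nhds h] with y hy
          using Real.smoothTransition.zero_of_nonpos (le_of_lt hy)
      rw [this.deriv_eq, deriv_const]
    · have h1 : 1 < x := by
        by_contra h1
        exact hx ⟨h, not_lt.1 h1⟩
      have : Real.smoothTransition =ᶠ[𝓝 x] fun _ => 1 := by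
        filter_upwards [Ioi_mem_nhds h1] with y hy
          using Real.smoothTransition.one_of_one_le (le_of_lt hy)
      rw [this.deriv_eq, deriv_const]
  obtain ⟨B, hB⟩ := hsupp.exists_bound_of_continuous (hd.continuous_deriv le_rfl)
  exact ⟨B.toNNReal, lipschitzWith_of_nnnorm_deriv_le (hd.differentiable one_ne_zero)
    fun x => NNReal.le_toNNReal_of_coe_le (hB x)⟩

/-- A smooth monotone map of the plane that vanishes exactly on a half plane. -/
def halfPlaneMap (e : ℂ) (c : ℝ) (z : ℂ) : ℂ := Real.smoothTransition (inner ℝ e z - c) • e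

theorem halfPlaneMap_eq_zero {e : ℂ} (he : e ≠ 0) {c : ℝ} {z : ℂ} :
    halfPlaneMap e c z = 0 ↔ inner ℝ e z ≤ c := by
  rw [halfPlaneMap, smul_eq_zero_iff_left he, Real.smoothTransition.zero_iff_nonpos, sub_nonpos]

/-- The derivative is `θ'⟨e,·⟩e`, which has the required form with the vector `√θ' e` since `θ' ≥
0`. The condition `0 ≤ c` places `0` in the half plane, so that the map fixes `0`. -/
theorem exists_isSmoothMonotone_halfPlaneMap (e : ℂ) {c : ℝ} (hc : 0 ≤ c) :
    ∃ K, IsSmoothMonotone (halfPlaneMap e c) K := by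
  obtain ⟨K, hK⟩ := exists_lipschitzWith_smoothTransition
  have hθ : ContDiff ℝ ∞ Real.smoothTransition := Real.smoothTransition.contDiff
  refine ⟨K * (‖e‖₊ * ‖e‖₊), ⟨?_, ?_, ?_, fun z => ?_⟩⟩
  · exact (hθ.comp ((contDiff_const.inner ℝ contDiff_id).sub contDiff_const)).smul contDiff_const
  · rw [halfPlaneMap, inner_zero_right, zero_sub,
      Real.smoothTransition.zero_of_nonpos (neg_nonpos.2 hc), zero_smul]
  · refine LipschitzWith.of_dist_le_mul fun z w => ?_
    rw [dist_eq_norm, halfPlaneMap, halfPlaneMap, ← sub_smul, norm_smul, ← dist_eq_norm]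
    have h1 := hK.dist_le_mul (inner ℝ e z - c) (inner ℝ e w - c)
    have h2 : dist (inner ℝ e z - c : ℝ) (inner ℝ e w - c) ≤ ‖e‖ * dist z w := by
      rw [Real.dist_eq, dist_eq_norm, sub_sub_sub_cancel_right, ← inner_sub_right]
      exact abs_real_inner_le_norm _ _
    calc _ ≤ K * (‖e‖ * dist z w) * ‖e‖ := by gcongr; exact h1.trans (by gcongr)
      _ = _ := by push_cast; ring
  · have hdθ := (hθ.differentiable (by simp) (inner ℝ e z - c)).hasDerivAt
    have hd0 : 0 ≤ deriv Real.smoothTransition (inner ℝ e z - c) :=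
      Real.smoothTransition.monotone.deriv_nonneg
    have hin : HasFDerivAt (fun z : ℂ => inner ℝ e z - c) (innerSL ℝ e) z :=
      (innerSL ℝ e).hasFDerivAt.sub_const c
    have h := (HasDerivAt.comp_hasFDerivAt (h₂ := Real.smoothTransition) z hdθ hin).smul_const e
    change HasFDerivAt (halfPlaneMap e c) _ z at h
    refine ⟨√(deriv Real.smoothTransition (inner ℝ e z - c)) • e, fun w => ?_⟩
    rw [h.fderiv]
    simp only [ContinuousLinearMap.smulRight_apply, smul_apply,
      innerSL_apply_apply, smul_eq_mul, real_inner_smul_left, smul_smul]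
    congr 1
    nth_rewrite 1 [← Real.mul_self_sqrt hd0]
    ring

theorem inner_halfPlaneMap_neg {e : ℂ} {c : ℝ} {z w : ℂ} (hw : inner ℝ e w ≤ c)
    (hz : ¬ inner ℝ e z ≤ c) : inner ℝ (halfPlaneMap e c z) (w - z) < 0 := by
  rw [halfPlaneMap, real_inner_smul_left, inner_sub_right]
  refine mul_neg_of_pos_of_neg (Real.smoothTransition.pos_of_pos ?_) ?_ <;> linarith

/-! ### Half planes under the resolvents and the semigroup -/

namespace Coefficients

variable {n : ℕ} {G : Geometry n} (C : Coefficients G)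

theorem resolvent_halfPlane {e : ℂ} (he : e ≠ 0) {c : ℝ} (hc : 0 ≤ c) {ε : ℝ} (hε : 0 < ε)
    {f φ : G.L2} (hf : ∀ᵐ x ∂G.measure, inner ℝ e (f x) ≤ c) (h : C.A₂ φ (ε⁻¹ • (f - φ))) :
    ∀ᵐ x ∂G.measure, inner ℝ e (φ x) ≤ c := by
  obtain ⟨K, hF⟩ := exists_isSmoothMonotone_halfPlaneMap e hc
  set Fφ := hF.lipschitz.compLp hF.map_zero φ with hFφ
  have h0 := C.A₂_isMAccretive.2 hF _ _ h
  have hR : ε⁻¹ • (f - φ) = ((ε⁻¹ : ℝ) : ℂ) • (f - φ) := (Complex.coe_smul _ _).symm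
  rw [hR, inner_smul_right, Complex.re_ofReal_mul] at h0
  replace h0 := nonneg_of_mul_nonneg_right h0 (inv_pos.2 hε)
  have hint := (L2.integrable_inner (𝕜 := ℂ) Fφ (f - φ)).re
  have h1 : (inner ℂ Fφ (f - φ)).re = ∫ x, (inner ℂ (Fφ x) ((f - φ) x)).re ∂G.measure := by
    rw [L2.inner_def]
    exact (integral_re (𝕜 := ℂ) (L2.integrable_inner Fφ (f - φ))).symm
  have hle : ∀ᵐ x ∂G.measure, (inner ℂ (Fφ x) ((f - φ) x)).re ≤ 0 ∧
      ((inner ℂ (Fφ x) ((f - φ) x)).re = 0 → inner ℝ e (φ x) ≤ c) := by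
    filter_upwards [hf, hF.lipschitz.coeFn_compLp hF.map_zero φ, Lp.coeFn_sub f φ]
      with x hx h2 h3
    rw [h2, h3, Function.comp_apply, Pi.sub_apply]
    by_cases hz : inner ℝ e (φ x) ≤ c
    · rw [(halfPlaneMap_eq_zero he).2 hz]
      simpa using hz
    · have h4 : (inner ℂ (halfPlaneMap e c (φ x)) (f x - φ x)).re < 0 :=
        inner_halfPlaneMap_neg hx hz
      exact ⟨h4.le, fun h5 => absurd h5 h4.ne⟩
  -- The integral is nonnegative by the form inequality and its integrand is nonpositive, so the
  -- integrand vanishes almost everywhere; at such points `φ x` cannot lie outside the half plane.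
  have h2 : ∫ x, -(inner ℂ (Fφ x) ((f - φ) x)).re ∂G.measure = 0 := by
    refine le_antisymm ?_ (integral_nonneg_of_ae ?_)
    · rw [integral_neg, ← h1]; linarith
    · filter_upwards [hle] with x hx using neg_nonneg.2 hx.1
  have h3 := (integral_eq_zero_iff_of_nonneg_ae (by
    filter_upwards [hle] with x hx using neg_nonneg.2 hx.1) hint.neg).1 h2
  filter_upwards [hle, h3] with x hx hx0 using hx.2 (neg_eq_zero.1 hx0)

/-- The set is the preimage of `0` under superposition with `halfPlaneMap`, which is continuous on
`𝕃²` because the map is Lipschitz. -/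
theorem isClosed_halfPlane {e : ℂ} (he : e ≠ 0) {c : ℝ} (hc : 0 ≤ c) :
    IsClosed {f : G.L2 | ∀ᵐ x ∂G.measure, inner ℝ e (f x) ≤ c} := by
  obtain ⟨K, hF⟩ := exists_isSmoothMonotone_halfPlaneMap e hc
  convert isClosed_singleton (x := (0 : G.L2)).preimage (hF.lipschitz.continuous_compLp hF.map_zero)
    using 1
  ext f
  simp only [Set.mem_ofPred_eq, Set.mem_preimage, Set.mem_singleton_iff, Lp.eq_zero_iff_ae_eq_zero]
  refine eventually_congr ?_
  filter_upwards [hF.lipschitz.coeFn_compLp hF.map_zero f] with x hx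
  rw [hx, Function.comp_apply, Pi.zero_apply, halfPlaneMap_eq_zero he]

theorem convex_halfPlane (e : ℂ) (c : ℝ) :
    Convex ℝ {f : G.L2 | ∀ᵐ x ∂G.measure, inner ℝ e (f x) ≤ c} := by
  intro f hf g hg a b ha hb hab
  filter_upwards [hf, hg, Lp.coeFn_add (a • f) (b • g), Lp.coeFn_smul a f, Lp.coeFn_smul b g]
    with x h1 h2 h3 h4 h5
  rw [h3, Pi.add_apply, h4, h5, Pi.smul_apply, Pi.smul_apply, inner_add_right,
    real_inner_smul_right, real_inner_smul_right]
  calc _ ≤ a * c + b * c := by gcongr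
    _ = c := by rw [← add_mul, hab, one_mul]

theorem semigroup_halfPlane {T : ℝ≥0 → G.L2 →L[ℂ] G.L2} (hT : IsSemigroupGeneratedByNeg C.A₂ T)
    (t : ℝ≥0) (e : ℂ) {c : ℝ} (hc : 0 ≤ c) {f : G.L2}
    (hf : ∀ᵐ x ∂G.measure, inner ℝ e (f x) ≤ c) :
    ∀ᵐ x ∂G.measure, inner ℝ e (T t f x) ≤ c := by
  rcases eq_or_ne e 0 with rfl | he
  · simpa using ae_of_all _ fun _ => hc
  -- The invariance is known for the constructed semigroup; uniqueness transfers it to `T`.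
  obtain ⟨S, hS, hinv⟩ := C.A₂_isMAccretive.1.exists_semigroup
  rw [C.A₂_isMAccretive.1.semigroup_unique hT hS]
  exact hinv _ (isClosed_halfPlane he hc) (convex_halfPlane e c)
    (fun ε hε f hf φ h => C.resolvent_halfPlane he hc hε hf h) t f hf

theorem semigroup_re_nonneg {T : ℝ≥0 → G.L2 →L[ℂ] G.L2} (hT : IsSemigroupGeneratedByNeg C.A₂ T)
    (t : ℝ≥0) {f : G.L2} (hf : ∀ᵐ x ∂G.measure, 0 ≤ (f x).re) :
    ∀ᵐ x ∂G.measure, 0 ≤ (T t f x).re := by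
  have := C.semigroup_halfPlane hT t (-1) le_rfl (f := f)
  simpa [Complex.inner] using this (by simpa [Complex.inner] using hf)

theorem semigroup_im_eq_zero {T : ℝ≥0 → G.L2 →L[ℂ] G.L2} (hT : IsSemigroupGeneratedByNeg C.A₂ T)
    (t : ℝ≥0) {f : G.L2} (hf : ∀ᵐ x ∂G.measure, (f x).im = 0) :
    ∀ᵐ x ∂G.measure, (T t f x).im = 0 := by
  have h1 := C.semigroup_halfPlane hT t Complex.I le_rfl (f := f) (by
    filter_upwards [hf] with x hx using by simp [Complex.inner, hx])
  have h2 := C.semigroup_halfPlane hT t (-Complex.I) le_rfl (f := f) (by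
    filter_upwards [hf] with x hx using by simp [Complex.inner, hx])
  filter_upwards [h1, h2] with x h1 h2
  simp only [Complex.inner, map_neg, Complex.conj_I, neg_neg, mul_neg, Complex.neg_re,
    Complex.mul_I_re] at h1 h2
  linarith

theorem semigroup_eLpNorm_top_le {T : ℝ≥0 → G.L2 →L[ℂ] G.L2}
    (hT : IsSemigroupGeneratedByNeg C.A₂ T) (t : ℝ≥0) (f : G.L2) :
    eLpNorm (T t f) ⊤ G.measure ≤ eLpNorm f ⊤ G.measure := by
  rcases eq_or_ne (eLpNorm f ⊤ G.measure) ⊤ with htop | htop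
  · rw [htop]; exact le_top
  set c := (eLpNorm f ⊤ G.measure).toReal with hc
  have hf : ∀ᵐ x ∂G.measure, ‖f x‖ ≤ c := by
    rw [eLpNorm_exponent_top] at hc htop
    filter_upwards [ae_le_eLpNormEssSup (f := f) (μ := G.measure)] with x hx
    rw [hc, ← toReal_enorm]
    exact ENNReal.toReal_mono htop hx
  -- The disc of radius `c` is the intersection of the half planes `⟨e,z⟩ ≤ ‖e‖c`. A countable dense
  -- set of `e` keeps the exceptional set null; continuity then admits every `e`, in particular the
  -- value `T t f x` itself.
  have h : ∀ k, ∀ᵐ x ∂G.measure, inner ℝ (TopologicalSpace.denseSeq ℂ k) (T t f x) ≤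
      ‖TopologicalSpace.denseSeq ℂ k‖ * c := by
    refine fun k => C.semigroup_halfPlane hT t _ (by positivity) ?_
    filter_upwards [hf] with x hx
    exact (real_inner_le_norm _ _).trans (by gcongr)
  have h' : ∀ᵐ x ∂G.measure, ‖T t f x‖ ≤ c := by
    filter_upwards [ae_all_iff.2 h] with x hx
    have hcl : IsClosed {e : ℂ | inner ℝ e (T t f x) ≤ ‖e‖ * c} :=
      isClosed_le (by fun_prop) (by fun_prop)
    have hall := hcl.closure_subset_iff.2 (Set.range_subset_iff.2 hx)
      ((TopologicalSpace.denseRange_denseSeq ℂ).closure_range ▸ Set.mem_univ (T t f x))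
    rw [Set.mem_ofPred_eq, real_inner_self_eq_norm_mul_norm] at hall
    rcases eq_or_lt_of_le (norm_nonneg (T t f x)) with h0 | h0
    · rw [← h0]; exact ENNReal.toReal_nonneg
    · exact le_of_mul_le_mul_left hall h0
  rw [← ENNReal.ofReal_toReal htop, ← hc, eLpNorm_exponent_top]
  exact eLpNormEssSup_le_of_ae_bound h'

end Coefficients

end InterfaceDiffusion

end

theorem proposition4p6 {n : ℕ} (hn : 1 ≤ n) (G : InterfaceDiffusion.Geometry n)
    (C : InterfaceDiffusion.Coefficients G) :
    (∃! T : ℝ≥0 → G.L2 →L[ℂ] G.L2, InterfaceDiffusion.IsSemigroupGeneratedByNeg C.A₂ T) ∧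
    ∀ T : ℝ≥0 → G.L2 →L[ℂ] G.L2, InterfaceDiffusion.IsSemigroupGeneratedByNeg C.A₂ T →
      ∀ t : ℝ≥0,
        (∀ f : G.L2, (∀ᵐ x ∂G.measure, (f x).im = 0) →
          ∀ᵐ x ∂G.measure, (T t f x).im = 0) ∧
        (∀ f : G.L2, (∀ᵐ x ∂G.measure, 0 ≤ (f x).re ∧ (f x).im = 0) →
          ∀ᵐ x ∂G.measure, 0 ≤ (T t f x).re ∧ (T t f x).im = 0) ∧
        (∀ f : G.L2, eLpNorm (T t f) ⊤ G.measure ≤ eLpNorm f ⊤ G.measure) := by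
  refine ⟨?_, fun T hT t => ⟨fun f hf => C.semigroup_im_eq_zero hT t hf, fun f hf => ?_,
    C.semigroup_eLpNorm_top_le hT t⟩⟩
  · obtain ⟨T, hT, -⟩ := C.A₂_isMAccretive.1.exists_semigroup
    exact ⟨T, hT, fun S hS => C.A₂_isMAccretive.1.semigroup_unique hS hT⟩
  · exact (C.semigroup_re_nonneg hT t (hf.mono fun x hx => hx.1)).and
      (C.semigroup_im_eq_zero hT t (hf.mono fun x hx => hx.2))
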